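/- Let $W=\mathbb R^{2,2}$ be $\mathbb R^4$ with a quadratic form of signature $(2,2)$, polar form $\langle\cdot,\cdot\rangle$ and the determinant $\det$, and let $$\mathsf U\mathbf H^{2,1}_+=\{(x,n)\in W\times W \mid \langle x,x\rangle=-1,\ \langle n,n\rangle=1,\ \langle x,n\rangle=0\}$$ be the spacelike unit tangent bundle of (the double cover of) the anti-de Sitter space. For vectors $u=(u_1,u_2)$, $v=(v_1,v_2)$, $w=(w_1,w_2)$ tangent to it at $(x,n)$ put $$\omega(u,v,w)=\det(x,u_1,v_1,w_1),\qquad \alpha(u,v)=\tfrac14\bigl(\det(x,n,u_2,v_1)+\det(x,n,u_1,v_2)\bigr).$$ Let $M$ be an oriented smooth $3$-manifold with boundary, possibly noncompact, whose boundary carries the Stokes orientation (outward normal first). Let $\partial M=N_0\sqcup N_1$ with $N_0,N_1$ closed, let $K\subset M$ be compact, and fix a homeomorphism $M\setminus K\cong U\times[0,1]$ such that $U\times\{0\}$ is a subset of $N_0$ and $U\times\{1\}$ is a subset of $N_1$. A *cobordism* is a smooth map $\phi=(x,n)\colon M\to\mathsf U\mathbf H^{2,1}_+$ which is constant in the second factor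 of $U\times[0,1]$ and whose restriction to $\partial M$ is a holonomic surface, i.e. $\langle n,\mathrm D_Vx\rangle=\langle x,\mathrm D_Vn\rangle=0$ for $V$ tangent to $\partial M$, such that $\sigma=\frac{\sqrt2}{2}(x+n)$ is an immersion of $\partial M$ transverse to the line spanned by $\sigma$. Its first fundamental form at infinity is the Lorentz metric $g(U,V)=\langle \mathrm D_U\sigma,\mathrm D_V\sigma\rangle$ on $\partial M$; its curvature $2$-form is $F_g=K(g)\,\omega_g$, where $K(g)$ is the sectional curvature and $\omega_g$ is the volume form of $g$ for the orientation of the holonomic surface in which $(U,V)$ is positive when $\det(x,n,\mathrm D_U\sigma,\mathrm D_V\sigma)>0$. Its $\mathcal W$-volume is $$\mathcal W(M,\phi)=\int_M\phi^*\omega-\int_{\partial M}\phi^*\alpha ,$$ where $\phi^*\omega$ vanishes outside $K$ and the second integral is taken over $\partial M\cap K$ (the contributions of $U\times\{0\}$ and $U\times\{1\}$ cancel). **Theorem (Variational formula).** Let $(\phi_t)_{t\in\mathbb R}$ be a family of maps from $M$ to $W\times W$, smooth in $(t,p)\in\mathbb R\times M$, such that for all $t$ close to $0$ the map $\phi_t$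 is a cobordism (with the same data $N_0,N_1,K,U\times[0,1]$) and $\phi_t=\phi_0$ on $M\setminus K$. Let $g_t$ be the first fundamental form at infinity of $\phi_t$ on $\partial M$, and suppose that $u$ is a function on $\partial M$ (necessarily smooth and supported in $K$) with $$\left.\frac{\mathrm d}{\mathrm dt}\right|_{t=0}g_t=2u\,g_0 .$$ Then $t\mapsto\mathcal W(M,\phi_t)$ is differentiable at $t=0$ and $$\left.\frac{\mathrm d}{\mathrm dt}\right|_{t=0}\mathcal W(M,\phi_t)=-\frac12\int_{\partial M}u\,F_{g_0}.$$ -/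

import Mathlib

open Set Filter Topology MeasureTheory
open scoped Manifold ContDiff

noncomputable section

namespace AdS

/-! ### The quadratic space of signature (2,2) and the unit tangent bundle -/

/-- The model four-dimensional vector space `W = ℝ^{2,2}`. -/
abbrev W : Type := Fin 4 → ℝ

/-- The polar form `⟨v, w⟩` of the quadratic form of signature (2,2) on `W`. -/
def form (v w : W) : ℝ := v 0 * w 0 + v 1 * w 1 - v 2 * w 2 - v 3 * w 3

/-- The determinant of four vectors of `W`. -/
def det4 (a b c d : W) : ℝ := Matrix.det (Matrix.of ![a, b, c, d])

/-- The (spacelike) unit tangent bundle of `{x ∈ W | ⟨x, x⟩ = -1}`, the double cover of the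
anti-de Sitter space: pairs `(x, n)` with `⟨x, x⟩ = -1`, `⟨n, n⟩ = 1` and `⟨x, n⟩ = 0`. -/
def unitTangent : Set (W × W) :=
  {p | form p.1 p.1 = -1 ∧ form p.2 p.2 = 1 ∧ form p.1 p.2 = 0}

/-- The 3-form `ω` at `p = (x, n)`, the pull-back of the volume form of the base:
`ω(u, v, w) = det (x, u₁, v₁, w₁)`. -/
def omega (p u v w : W × W) : ℝ := det4 p.1 u.1 v.1 w.1

/-- The 2-form `α` at `p = (x, n)`:
`α(u, v) = (det (x, n, u₂, v₁) + det (x, n, u₁, v₂)) / 4`. -/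
def alpha (p u v : W × W) : ℝ :=
  (1 / 4) * (det4 p.1 p.2 u.2 v.1 + det4 p.1 p.2 u.1 v.2)

/-! ### Local Lorentzian geometry of surfaces -/

/-- The coordinate plane of a surface. -/
abbrev E2 : Type := EuclideanSpace ℝ (Fin 2)

/-- The coordinate space of a 3-manifold. -/
abbrev E3 : Type := EuclideanSpace ℝ (Fin 3)

/-- The partial derivative `∂ᵢ h` at a point of the coordinate plane. -/
def pd {F : Type*} [NormedAddCommGroup F] [NormedSpace ℝ F] (i : Fin 2) (h : E2 → F) (s : E2) : F :=
  fderiv ℝ h s (EuclideanSpace.single i 1)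

/-- The Christoffel symbol `Γᵏᵢⱼ` of the Levi-Civita connection of the metric with coefficient
matrix `g`. -/
def christoffel (g : E2 → Matrix (Fin 2) (Fin 2) ℝ) (k i j : Fin 2) (s : E2) : ℝ :=
  (1 / 2) * ∑ l, (g s)⁻¹ k l *
    (pd i (fun r => g r j l) s + pd j (fun r => g r i l) s - pd l (fun r => g r i j) s)

/-- The component along `∂ₗ` of `R(∂ᵢ, ∂ⱼ) ∂ₖ`, where `R(X, Y) = [∇_X, ∇_Y] - ∇_[X, Y]`. -/
def riemann (g : E2 → Matrix (Fin 2) (Fin 2) ℝ) (l i j k : Fin 2) (s : E2) : ℝ :=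
  pd i (christoffel g l j k) s - pd j (christoffel g l i k) s
    + ∑ m, (christoffel g l i m s * christoffel g m j k s
      - christoffel g l j m s * christoffel g m i k s)

/-- The sectional curvature `K(g) = g(R(∂₁, ∂₂) ∂₂, ∂₁) / (g₁₁ g₂₂ - g₁₂²)`. It is equivalently
characterised by `R = -K(g) ω_g ⊗ I`, where `I` is the involution of the split structure. -/
def sectionalCurvature (g : E2 → Matrix (Fin 2) (Fin 2) ℝ) (s : E2) : ℝ :=
  (∑ l, g s l 0 * riemann g l 0 1 1 s) / (g s).det

/-- The map `σ = (√2 / 2) (x + n)` attached to `f = (x, n)`. -/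
def sigma (f : E2 → W × W) (s : E2) : W := (Real.sqrt 2 / 2) • ((f s).1 + (f s).2)

/-- The parametrised surface `f = (x, n)` satisfies the holonomy condition at `s`, that is, it is
tangent to the contact distribution: `⟨n, ∂ᵢ x⟩ = 0` and `⟨x, ∂ᵢ n⟩ = 0`. -/
def IsHolonomicAt (f : E2 → W × W) (s : E2) : Prop :=
  ∀ i : Fin 2, form (f s).2 (pd i f s).1 = 0 ∧ form (f s).1 (pd i f s).2 = 0

/-- The map `σ` is, at `s`, an immersion transverse to the line spanned by `σ` (the isotropic
surface condition). For a holonomic surface this says that the first fundamental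
form at infinity is nondegenerate. -/
def IsIsotropicImmersionAt (f : E2 → W × W) (s : E2) : Prop :=
  LinearIndependent ℝ ![sigma f s, pd 0 (sigma f) s, pd 1 (sigma f) s]

/-- The coefficients `⟨∂ᵢ σ, ∂ⱼ σ⟩` of the first fundamental form at infinity. -/
def firstForm (f : E2 → W × W) (s : E2) : Matrix (Fin 2) (Fin 2) ℝ :=
  Matrix.of fun i j => form (pd i (sigma f) s) (pd j (sigma f) s)

/-- The coefficient on `(∂₁, ∂₂)` of the volume form `ω_g` of the first fundamental form at
infinity `g`. The orientation of the surface is the one for which `(U, V)` is positive when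
`det (x, n, D_U σ, D_V σ) > 0`. -/
def areaForm (f : E2 → W × W) (s : E2) : ℝ :=
  Real.sign (det4 (f s).1 (f s).2 (pd 0 (sigma f) s) (pd 1 (sigma f) s))
    * Real.sqrt |(firstForm f s).det|

/-- The coefficient on `(∂₁, ∂₂)` of the curvature 2-form `F_g = K(g) ω_g` of the first
fundamental form at infinity `g`. -/
def curvatureForm (f : E2 → W × W) (s : E2) : ℝ :=
  sectionalCurvature (firstForm f) s * areaForm f s

/-! ### Integration on oriented 3-manifolds with boundary

The charts are the preferred charts `extChartAt (𝓡∂ 3) c`, `c : M`, with values in the half-space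
`{y | 0 ≤ y 0}`. A form of top degree on `M` (on `∂M`) is given by its coefficient in each of these
charts (in their restrictions to the boundary). -/

section Manifold

/-- The inclusion of the coordinate plane as the boundary of the half-space. -/
def bdryEmb (s : E2) : E3 := WithLp.toLp 2 ![0, s 0, s 1]

variable {M : Type*} [TopologicalSpace M] [ChartedSpace (EuclideanHalfSpace 3) M]

/-- The preferred charts form an oriented atlas: their transition maps have positive Jacobian. -/
def IsOrientedAtlas (M : Type*) [TopologicalSpace M] [ChartedSpace (EuclideanHalfSpace 3) M] :
    Prop :=
  ∀ c c' : M, ∀ y ∈ (extChartAt (𝓡∂ 3) c).target,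
    (extChartAt (𝓡∂ 3) c).symm y ∈ (extChartAt (𝓡∂ 3) c').source →
      0 < (fderivWithin ℝ (extChartAt (𝓡∂ 3) c' ∘ (extChartAt (𝓡∂ 3) c).symm)
        (range (𝓡∂ 3)) y).det

/-- The domain in the coordinate plane of the boundary chart induced by the chart at `c`. -/
def bdryDomain (c : M) : Set E2 := bdryEmb ⁻¹' (extChartAt (𝓡∂ 3) c).target

/-- The boundary point with given coordinates in the boundary chart induced by the chart
at `c`. -/
def bdryPoint (c : M) (s : E2) : M := (extChartAt (𝓡∂ 3) c).symm (bdryEmb s)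

/-- A smooth partition of unity on `M` subordinate to the preferred charts. -/
def pou (M : Type*) [TopologicalSpace M] [ChartedSpace (EuclideanHalfSpace 3) M]
    [IsManifold (𝓡∂ 3) ∞ M] [T2Space M] [SigmaCompactSpace M] :
    SmoothPartitionOfUnity M (𝓡∂ 3) M univ :=
  (SmoothPartitionOfUnity.exists_isSubordinate_chartAt_source (𝓡∂ 3) M).choose

variable [IsManifold (𝓡∂ 3) ∞ M] [T2Space M] [SigmaCompactSpace M]

/-- The integral over `M` of the (compactly supported) 3-form with coefficient `η c` in the chart
at `c`. -/
def mfdIntegral (η : M → E3 → ℝ) : ℝ :=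
  ∑ᶠ c : M, ∫ y in (extChartAt (𝓡∂ 3) c).target,
    pou M c ((extChartAt (𝓡∂ 3) c).symm y) * η c y

/-- The integral over `∂M ∩ A` of the 2-form on `∂M` with coefficient `η c` in the boundary chart
induced by the chart at `c`. The boundary carries the Stokes orientation (outward normal first);
since the outward normal of the half-space `{0 ≤ y 0}` is `-∂₀`, this is the opposite of the
orientation by the coordinates `(y 1, y 2)`, whence the sign. -/
def bdryIntegral (A : Set M) (η : M → E2 → ℝ) : ℝ :=
  -∑ᶠ c : M, ∫ s in bdryDomain c ∩ bdryPoint c ⁻¹' A, pou M c (bdryPoint c s) * η c s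

/-! ### Cobordisms constant at infinity and the W-volume -/

/-- The data of a decomposition `∂M = N₀ ⊔ N₁` and of a product structure at infinity: a compact
set `K` and a homeomorphism of its complement with `U × [0, 1]`, where `U × {0}` is the subset `U`
of `N₀` and `U × {1}` is a subset of `N₁`. -/
structure EndStructure (M : Type*) [TopologicalSpace M]
    [ChartedSpace (EuclideanHalfSpace 3) M] where
  /-- The incoming part of the boundary. -/
  N₀ : Set M
  /-- The outgoing part of the boundary. -/
  N₁ : Set M
  isClosed_N₀ : IsClosed N₀
  isClosed_N₁ : IsClosed N₁
  disjoint : Disjoint N₀ N₁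
  union_eq : N₀ ∪ N₁ = (𝓡∂ 3).boundary M
  /-- The compact set. -/
  K : Set M
  isCompact_K : IsCompact K
  /-- The base of the product structure at infinity. -/
  U : Set M
  U_subset : U ⊆ N₀
  /-- The product structure at infinity. -/
  e : U × unitInterval ≃ₜ (Kᶜ : Set M)
  e_zero : ∀ u : U, (e (u, 0) : M) = u
  e_one : ∀ u : U, (e (u, 1) : M) ∈ N₁

/-- The restriction of `φ` to `∂M`, read in the boundary chart induced by the chart at `c`. -/
def bdryMap (φ : M → W × W) (c : M) (s : E2) : W × W := φ (bdryPoint c s)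

/-- `(M, φ)` is a cobordism constant at infinity (with the product structure at infinity `E`)
between holonomic surfaces: `φ` is a smooth map to the unit tangent bundle, its restriction to `∂M`
is a holonomic surface (with nondegenerate first fundamental form at infinity), and `φ` is constant
in the second factor of `Kᶜ ≃ U × [0, 1]`. -/
structure IsCobordism (E : EndStructure M) (φ : M → W × W) : Prop where
  smooth : ContMDiff (𝓡∂ 3) 𝓘(ℝ, W × W) ∞ φ
  mem_unitTangent : ∀ p, φ p ∈ unitTangent
  holonomic : ∀ c : M, ∀ s ∈ bdryDomain c, IsHolonomicAt (bdryMap φ c) s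
  isotropic : ∀ c : M, ∀ s ∈ bdryDomain c, IsIsotropicImmersionAt (bdryMap φ c) s
  constant_at_infinity : ∀ (u : E.U) (r r' : unitInterval), φ (E.e (u, r)) = φ (E.e (u, r'))

/-- The coefficient of the 3-form `φ^* ω` in the chart at `c`. -/
def pullbackOmega (φ : M → W × W) (c : M) (y : E3) : ℝ :=
  let f : E3 → W × W := φ ∘ (extChartAt (𝓡∂ 3) c).symm
  let d : Fin 3 → W × W := fun i =>
    fderivWithin ℝ f (range (𝓡∂ 3)) y (EuclideanSpace.single i 1)
  omega (f y) (d 0) (d 1) (d 2)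

/-- The coefficient of the 2-form `φ^* α` in the boundary chart induced by the chart at `c`. -/
def pullbackAlpha (φ : M → W × W) (c : M) (s : E2) : ℝ :=
  alpha (bdryMap φ c s) (pd 0 (bdryMap φ c) s) (pd 1 (bdryMap φ c) s)

/-- The W-volume `∫_M φ^* ω - ∫_{∂M} φ^* α` of a cobordism constant at infinity. The form `φ^* ω`
vanishes outside `K`. The integral over `∂M` is understood as the integral over `∂M ∩ K`: the
contributions of `U × {0}` and `U × {1}`, where `φ` takes the same values and the boundary
orientations are opposite, cancel each other. -/
def WVolume (E : EndStructure M) (φ : M → W × W) : ℝ :=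
  mfdIntegral (pullbackOmega φ) - bdryIntegral E.K (pullbackAlpha φ)

end Manifold

end AdS

end

open AdS

/-!
The form `ω` is closed, so the variation of `∫ φ^* ω` is a boundary integral: if `ẋ` is the
variation of the base point, the time derivative of `φ^* ω` is the exterior derivative of
`det (x, ẋ, dx, dx)`, because the remaining term `det (ẋ, dx, dx, dx)` has four arguments
orthogonal to `x` (`deriv_pullbackOmega`). Stokes' theorem (`mfdIntegral_jac`) moves it to the
boundary, and it remains to prove a pointwise identity there, up to exact forms
(`boundary_variation`).

On the boundary put `a = x + n` and `b = x - n`. The holonomy condition says that `a` and `b` are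
null vectors with `⟨a, b⟩ = -2`, both orthogonal to the derivatives of `a` and of `b`, so that
`a, b, ∂₁a, ∂₂a` is a moving frame adapted to the surface (`IsNullFrame`). In this frame the Gauss
equation becomes `F_g (∂₁, ∂₂) = (det (a, b, ∂₁b, ∂₂a) + det (a, b, ∂₁a, ∂₂b)) / 4`
(`curvatureForm_eq`): up to a factor, the curvature is the mixed discriminant of `da` and `db`, that
is, the trace of the shape operator that expresses `db` in terms of `da`. This operator is
self-adjoint for `g`. A conformal variation `ġ = 2 u g` of the metric means that the `g`-symmetric
part of the operator expressing `dȧ` is `u` times the identity, so that its mixed discriminant with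
the shape operator is `u` times the trace of the latter (`mixed_discriminant`). It follows that
`det (x, ẋ, dx, dx)` minus the variation of `α` is `-u F_g / 2` up to the exterior derivative of
`det (a, b, ȧ, db) / 8 + det (a, b, ȧ, da) / 16 - det (a, b, ḃ, db) / 16`
(`variation_identity`). This primitive vanishes outside `K`, and the integral of its exterior
derivative over the boundary is zero (`bdryIntegral_jac`).

The variation is a derivative of integrals over the compact set `K`. This is how the boundary term
is defined; for the interior term, `φ^* ω` has to vanish outside `K`. Outside `K` the map `φ` takes
only values that it takes on the boundary, so its image there has measure zero in every projection
to a space of dimension three, whereas the inverse function theorem would give a projection with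
nonempty interior at a point where `φ^* ω` does not vanish
(`IsCobordism.pullbackOmega_eq_zero`).

Integration on `M` and on `∂M` is treated at once by means of families of charts whose transition
maps have positive Jacobian (`ChartSystem`). All forms to which Stokes' theorem is applied are sums
of forms `A dB ∧ dC` and `dA ∧ dB ∧ dC`, whose coefficients in a chart are Jacobian determinants
(`ChartSystem.jac`).
-/


namespace AdS

/-! ### Linear algebra of the quadratic space -/

theorem det4_eq (a b c d : W) : det4 a b c d =
    a 0 * (b 1 * (c 2 * d 3 - c 3 * d 2) - b 2 * (c 1 * d 3 - c 3 * d 1)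
        + b 3 * (c 1 * d 2 - c 2 * d 1))
      - a 1 * (b 0 * (c 2 * d 3 - c 3 * d 2) - b 2 * (c 0 * d 3 - c 3 * d 0)
        + b 3 * (c 0 * d 2 - c 2 * d 0))
      + a 2 * (b 0 * (c 1 * d 3 - c 3 * d 1) - b 1 * (c 0 * d 3 - c 3 * d 0)
        + b 3 * (c 0 * d 1 - c 1 * d 0))
      - a 3 * (b 0 * (c 1 * d 2 - c 2 * d 1) - b 1 * (c 0 * d 2 - c 2 * d 0)
        + b 2 * (c 0 * d 1 - c 1 * d 0)) := by
  simp [det4, Matrix.det_succ_row_zero, Fin.sum_univ_succ, Fin.succAbove]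
  ring

theorem form_comm (v w : W) : form v w = form w v := by
  simp only [form]; ring

/-- The vector with given coefficients with respect to four vectors. -/
def comb (a b c d k : W) : W := k 0 • a + k 1 • b + k 2 • c + k 3 • d

theorem comb_add (a b c d k l : W) : comb a b c d k + comb a b c d l = comb a b c d (k + l) := by
  simp only [comb, Pi.add_apply, add_smul]; abel

theorem det4_comb (a b c d k l m n : W) :
    det4 (comb a b c d k) (comb a b c d l) (comb a b c d m) (comb a b c d n)
      = det4 k l m n * det4 a b c d := by
  have h : (Matrix.of ![comb a b c d k, comb a b c d l, comb a b c d m, comb a b c d n])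
      = (Matrix.of ![k, l, m, n]) * (Matrix.of ![a, b, c, d]) := by
    ext i j
    fin_cases i <;> simp [comb, Matrix.mul_apply, Fin.sum_univ_succ] <;> ring
  rw [det4, h, Matrix.det_mul]; rfl

theorem exists_eq_comb {a b c d : W} (h : det4 a b c d ≠ 0) (v : W) :
    ∃ k, v = comb a b c d k := by
  set A : Matrix (Fin 4) (Fin 4) ℝ := Matrix.of ![a, b, c, d] with hA
  have hu : IsUnit A.det := isUnit_iff_ne_zero.2 h
  refine ⟨Matrix.vecMul v A⁻¹, ?_⟩
  have h1 : Matrix.vecMul (Matrix.vecMul v A⁻¹) A = v := by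
    rw [Matrix.vecMul_vecMul, Matrix.nonsing_inv_mul _ hu, Matrix.vecMul_one]
  conv_lhs => rw [← h1]
  ext j
  simp only [Matrix.vecMul, dotProduct, comb, Pi.add_apply, Pi.smul_apply, smul_eq_mul,
    Fin.sum_univ_four, hA, Matrix.of_apply]
  rfl

/-- The Gram determinant of four vectors of `W` is the square of their determinant, the quadratic
form having determinant one. -/
theorem det4_sq (a b c d : W) : det4 a b c d ^ 2 =
    Matrix.det (Matrix.of fun i j : Fin 4 => form (![a, b, c, d] i) (![a, b, c, d] j)) := by
  have h : (Matrix.of fun i j : Fin 4 => form (![a, b, c, d] i) (![a, b, c, d] j))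
      = (Matrix.of ![a, b, c, d]) * Matrix.diagonal ![1, 1, -1, -1]
        * (Matrix.of ![a, b, c, d]).transpose := by
    ext i j
    simp only [Matrix.mul_apply, Matrix.of_apply, Matrix.transpose_apply,
      Fin.sum_univ_four, form]
    simp
    ring
  rw [h, Matrix.det_mul, Matrix.det_mul, Matrix.det_transpose, Matrix.det_diagonal]
  simp [Fin.prod_univ_four, det4]
  ring

/-- The algebraic relations between a null pair `a, b` with `⟨a, b⟩ = -2` and two further vectors
orthogonal to both: these are the relations between `x + n`, `x - n` and the partial derivatives of
`x + n` along a holonomic surface. -/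
structure IsNullFrame (a b c d : W) : Prop where
  aa : form a a = 0
  bb : form b b = 0
  ab : form a b = -2
  ac : form a c = 0
  ad : form a d = 0
  bc : form b c = 0
  bd : form b d = 0

theorem IsNullFrame.det4_sq {a b c d : W} (h : IsNullFrame a b c d) :
    det4 a b c d ^ 2 = -4 * (form c c * form d d - form c d ^ 2) := by
  rw [AdS.det4_sq]
  simp [Matrix.det_succ_row_zero, Fin.sum_univ_succ, Fin.succAbove, h.aa, h.bb, h.ab, h.ac, h.ad,
    h.bc, h.bd, form_comm b a, form_comm c a, form_comm c b, form_comm d a, form_comm d b,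
    form_comm d c]
  ring

theorem IsNullFrame.form_comb {a b c d : W} (h : IsNullFrame a b c d) (k l : W) :
    form (comb a b c d k) (comb a b c d l) = -2 * (k 0 * l 1 + k 1 * l 0) + k 2 * l 2 * form c c
      + (k 2 * l 3 + k 3 * l 2) * form c d + k 3 * l 3 * form d d := by
  have hexp : form (comb a b c d k) (comb a b c d l)
      = k 0 * l 0 * form a a + k 1 * l 1 * form b b + (k 0 * l 1 + k 1 * l 0) * form a b
        + (k 0 * l 2 + k 2 * l 0) * form a c + (k 0 * l 3 + k 3 * l 0) * form a d
        + (k 1 * l 2 + k 2 * l 1) * form b c + (k 1 * l 3 + k 3 * l 1) * form b d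
        + k 2 * l 2 * form c c + (k 2 * l 3 + k 3 * l 2) * form c d + k 3 * l 3 * form d d := by
    simp only [form, comb, Pi.add_apply, Pi.smul_apply, smul_eq_mul]; ring
  rw [hexp, h.aa, h.bb, h.ab, h.ac, h.ad, h.bc, h.bd]; ring

/-- If `S` is symmetric for the nondegenerate form `g` and `R - u` is antisymmetric, then
`tr R tr S - tr (R S) = u tr S`. -/
theorem mixed_discriminant {g11 g12 g22 u R11 R12 R21 R22 S11 S12 S21 S22 : ℝ}
    (hg : g11 * g22 - g12 ^ 2 ≠ 0)
    (h11 : R11 * g11 + R12 * g12 = u * g11) (h22 : R21 * g12 + R22 * g22 = u * g22)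
    (h12 : R11 * g12 + R12 * g22 + R21 * g11 + R22 * g12 = 2 * u * g12)
    (hS : S11 * g12 + S12 * g22 = S21 * g11 + S22 * g12) :
    R11 * S22 + R22 * S11 - R12 * S21 - R21 * S12 = u * (S11 + S22) := by
  grind

/-- The pointwise form of the variational formula for a holonomic surface, in terms of `a = x + n`,
`b = x - n`, their partial derivatives (`a1`, `a2`, ...), their time derivatives (`a'`, `b'`) and
the mixed derivatives (`a1'`, ...). The right-hand side is the coefficient of the exterior
derivative of `det (a, b, a', db) / 8 + det (a, b, a', da) / 16 - det (a, b, b', db) / 16`. -/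
theorem variation_identity {a b a1 a2 b1 b2 a' b' a1' a2' b1' b2' : W} {u : ℝ}
    (h : IsNullFrame a b a1 a2) (hΔ : det4 a b a1 a2 ≠ 0)
    (hab1 : form a b1 = 0) (hab2 : form a b2 = 0) (hbb1 : form b b1 = 0) (hbb2 : form b b2 = 0)
    (haa' : form a a' = 0) (hbb' : form b b' = 0) (hab' : form a' b + form a b' = 0)
    (hsymm : form b1 a2 = form b2 a1)
    (h11 : form a1' a1 + form a1 a1' = 2 * u * form a1 a1)
    (h12 : form a1' a2 + form a1 a2' = 2 * u * form a1 a2)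
    (h22 : form a2' a2 + form a2 a2' = 2 * u * form a2 a2) :
    det4 (a + b) (a' + b') (a1 + b1) (a2 + b2)
      + (det4 a' b a1 a2 + det4 a b' a1 a2 + det4 a b a1' a2 + det4 a b a1 a2'
        - (det4 a' b b1 b2 + det4 a b' b1 b2 + det4 a b b1' b2 + det4 a b b1 b2'))
      + 2 * u * (det4 a b b1 a2 + det4 a b a1 b2)
    = 2 * (det4 a1 b a' b2 + det4 a b1 a' b2 + det4 a b a1' b2
          - (det4 a2 b a' b1 + det4 a b2 a' b1 + det4 a b a2' b1))
      + (det4 a1 b a' a2 + det4 a b1 a' a2 + det4 a b a1' a2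
          - (det4 a2 b a' a1 + det4 a b2 a' a1 + det4 a b a2' a1))
      - (det4 a1 b b' b2 + det4 a b1 b' b2 + det4 a b b1' b2
          - (det4 a2 b b' b1 + det4 a b2 b' b1 + det4 a b b2' b1)) := by
  have hg : form a1 a1 * form a2 a2 - form a1 a2 ^ 2 ≠ 0 := by
    intro h0
    have := h.det4_sq
    rw [h0, mul_zero] at this
    exact hΔ (pow_eq_zero_iff two_ne_zero |>.1 this)
  have ea : a = comb a b a1 a2 ![1, 0, 0, 0] := by simp [comb]
  have eb : b = comb a b a1 a2 ![0, 1, 0, 0] := by simp [comb]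
  have e1 : a1 = comb a b a1 a2 ![0, 0, 1, 0] := by simp [comb]
  have e2 : a2 = comb a b a1 a2 ![0, 0, 0, 1] := by simp [comb]
  obtain ⟨B1, eB1⟩ := exists_eq_comb hΔ b1
  obtain ⟨B2, eB2⟩ := exists_eq_comb hΔ b2
  obtain ⟨V, eV⟩ := exists_eq_comb hΔ a'
  obtain ⟨Z, eZ⟩ := exists_eq_comb hΔ b'
  obtain ⟨R1, eR1⟩ := exists_eq_comb hΔ a1'
  obtain ⟨R2, eR2⟩ := exists_eq_comb hΔ a2'
  obtain ⟨S1, eS1⟩ := exists_eq_comb hΔ b1'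
  obtain ⟨S2, eS2⟩ := exists_eq_comb hΔ b2'
  have fa : ∀ k, form a (comb a b a1 a2 k) = -2 * k 1 := fun k => by
    conv_lhs => arg 1; rw [ea]
    rw [h.form_comb]; simp
  have fb : ∀ k, form b (comb a b a1 a2 k) = -2 * k 0 := fun k => by
    conv_lhs => arg 1; rw [eb]
    rw [h.form_comb]; simp
  have f1 : ∀ k, form a1 (comb a b a1 a2 k) = k 2 * form a1 a1 + k 3 * form a1 a2 := fun k => by
    conv_lhs => arg 1; rw [e1]
    rw [h.form_comb]; simp
  have f2 : ∀ k, form a2 (comb a b a1 a2 k) = k 2 * form a1 a2 + k 3 * form a2 a2 := fun k => by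
    conv_lhs => arg 1; rw [e2]
    rw [h.form_comb]; simp
  rw [eB1, fa] at hab1
  rw [eB2, fa] at hab2
  rw [eB1, fb] at hbb1
  rw [eB2, fb] at hbb2
  rw [eV, fa] at haa'
  rw [eZ, fb] at hbb'
  rw [form_comm a' b, eV, eZ, fa, fb] at hab'
  rw [form_comm b1 a2, form_comm b2 a1, eB1, eB2, f1, f2] at hsymm
  rw [form_comm a1' a1, eR1, f1] at h11
  rw [form_comm a1' a2, eR1, eR2, f1, f2] at h12
  rw [form_comm a2' a2, eR2, f2] at h22
  have key := mixed_discriminant (u := u) (R11 := R1 2) (R12 := R1 3) (R21 := R2 2) (R22 := R2 3)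
    (S11 := B1 2) (S12 := B1 3) (S21 := B2 2) (S22 := B2 3) hg (by linarith) (by linarith)
    (by linarith) (by linarith)
  have hB10 : B1 0 = 0 := by linarith
  have hB11 : B1 1 = 0 := by linarith
  have hB20 : B2 0 = 0 := by linarith
  have hB21 : B2 1 = 0 := by linarith
  have hV1 : V 1 = 0 := by linarith
  have hZ0 : Z 0 = 0 := by linarith
  have hZ1 : Z 1 = - V 0 := by linarith
  have gen : ∀ k l m n, det4 (comb a b a1 a2 k) (comb a b a1 a2 l) (comb a b a1 a2 m)
      (comb a b a1 a2 n) = det4 k l m n * det4 a b a1 a2 := det4_comb a b a1 a2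
  generalize det4 a b a1 a2 = Δ at gen
  generalize hL : comb a b a1 a2 = L at *
  rw [eB1, eB2, eV, eZ, eR1, eR2, eS1, eS2, ea, eb, e1, e2]
  have hadd : ∀ k l, L k + L l = L (k + l) := fun k l => by rw [← hL, comb_add]
  simp only [hadd, gen]
  simp only [det4_eq]
  simp [hB10, hB11, hB20, hB21, hV1, hZ0, hZ1]
  linear_combination (-2 * Δ) * key
end AdS

namespace AdS

/-! ### Calculus of the polar form, the determinant and partial derivatives -/

section Calculus

variable {F : Type*} [NormedAddCommGroup F] [NormedSpace ℝ F]

theorem _root_.HasDerivAt.form {v w : ℝ → W} {v' w' : W} {t : ℝ} (hv : HasDerivAt v v' t)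
    (hw : HasDerivAt w w' t) :
    HasDerivAt (fun r => form (v r) (w r)) (form v' (w t) + form (v t) w') t := by
  have hv := hasDerivAt_pi.1 hv
  have hw := hasDerivAt_pi.1 hw
  refine (((((hv 0).mul (hw 0)).add ((hv 1).mul (hw 1))).sub ((hv 2).mul (hw 2))).sub
    ((hv 3).mul (hw 3))).congr_deriv ?_
  simp only [AdS.form]; ring

theorem _root_.HasDerivAt.det4 {a b c d : ℝ → W} {a' b' c' d' : W} {t : ℝ}
    (ha : HasDerivAt a a' t) (hb : HasDerivAt b b' t) (hc : HasDerivAt c c' t)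
    (hd : HasDerivAt d d' t) :
    HasDerivAt (fun r => det4 (a r) (b r) (c r) (d r))
      (det4 a' (b t) (c t) (d t) + det4 (a t) b' (c t) (d t) + det4 (a t) (b t) c' (d t)
        + det4 (a t) (b t) (c t) d') t := by
  have ha := hasDerivAt_pi.1 ha
  have hb := hasDerivAt_pi.1 hb
  have hc := hasDerivAt_pi.1 hc
  have hd := hasDerivAt_pi.1 hd
  have m2 := fun i j => ((hc i).mul (hd j)).sub ((hc j).mul (hd i))
  have m3 := fun i j k => (((hb i).mul (m2 j k)).sub ((hb j).mul (m2 i k))).add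
    ((hb k).mul (m2 i j))
  simp only [det4_eq]
  refine (((((ha 0).mul (m3 1 2 3)).sub ((ha 1).mul (m3 0 2 3))).add
    ((ha 2).mul (m3 0 1 3))).sub ((ha 3).mul (m3 0 1 2))).congr_deriv ?_
  simp only [Pi.mul_apply, Pi.sub_apply, Pi.add_apply]
  ring

theorem contDiff_form : ContDiff ℝ ∞ (fun p : W × W => form p.1 p.2) := by
  unfold form; fun_prop

theorem _root_.ContDiffWithinAt.form {E : Type*} [NormedAddCommGroup E] [NormedSpace ℝ E]
    {v w : E → W} {s : Set E} {x : E} (hv : ContDiffWithinAt ℝ ∞ v s x)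
    (hw : ContDiffWithinAt ℝ ∞ w s x) :
    ContDiffWithinAt ℝ ∞ (fun r => form (v r) (w r)) s x :=
  contDiff_form.contDiffAt.comp_contDiffWithinAt x (hv.prodMk hw)

theorem _root_.ContDiffWithinAt.det4 {E : Type*} [NormedAddCommGroup E] [NormedSpace ℝ E]
    {a b c d : E → W} {s : Set E} {x : E} (ha : ContDiffWithinAt ℝ ∞ a s x)
    (hb : ContDiffWithinAt ℝ ∞ b s x) (hc : ContDiffWithinAt ℝ ∞ c s x)
    (hd : ContDiffWithinAt ℝ ∞ d s x) :
    ContDiffWithinAt ℝ ∞ (fun r => det4 (a r) (b r) (c r) (d r)) s x := by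
  have ha := contDiffWithinAt_pi.1 ha
  have hb := contDiffWithinAt_pi.1 hb
  have hc := contDiffWithinAt_pi.1 hc
  have hd := contDiffWithinAt_pi.1 hd
  have m2 := fun i j => ((hc i).mul (hd j)).sub ((hc j).mul (hd i))
  have m3 := fun i j k => (((hb i).mul (m2 j k)).sub ((hb j).mul (m2 i k))).add
    ((hb k).mul (m2 i j))
  simp only [det4_eq]
  exact ((((ha 0).mul (m3 1 2 3)).sub ((ha 1).mul (m3 0 2 3))).add
    ((ha 2).mul (m3 0 1 3))).sub ((ha 3).mul (m3 0 1 2))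

theorem hasLineDerivAt_pd {h : E2 → F} {s : E2} (hh : DifferentiableAt ℝ h s) (i : Fin 2) :
    HasDerivAt (fun t : ℝ => h (s + t • EuclideanSpace.single i 1)) (pd i h s) 0 :=
  hh.hasFDerivAt.hasLineDerivAt _

theorem pd_eq_of_hasDerivAt {h : E2 → F} {s : E2} (hh : DifferentiableAt ℝ h s) {i : Fin 2} {h' : F}
    (h1 : HasDerivAt (fun t : ℝ => h (s + t • EuclideanSpace.single i 1)) h' 0) : pd i h s = h' :=
  (hasLineDerivAt_pd hh i).unique h1

theorem pd_congr {h k : E2 → F} {s : E2} (hh : h =ᶠ[𝓝 s] k) (i : Fin 2) : pd i h s = pd i k s := by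
  rw [pd, hh.fderiv_eq, pd]

theorem pd_form {v w : E2 → W} {s : E2} (hv : ContDiffAt ℝ ∞ v s) (hw : ContDiffAt ℝ ∞ w s)
    (i : Fin 2) :
    pd i (fun r => form (v r) (w r)) s = form (pd i v s) (w s) + form (v s) (pd i w s) := by
  refine pd_eq_of_hasDerivAt ((ContDiffWithinAt.form (s := univ) hv hw).contDiffAt
    univ_mem |>.differentiableAt (by simp)) ?_
  simpa using (hasLineDerivAt_pd (hv.differentiableAt (by simp)) i).form
    (hasLineDerivAt_pd (hw.differentiableAt (by simp)) i)

theorem pd_mul {v w : E2 → ℝ} {s : E2} (hv : DifferentiableAt ℝ v s) (hw : DifferentiableAt ℝ w s)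
    (i : Fin 2) : pd i (fun r => v r * w r) s = pd i v s * w s + v s * pd i w s := by
  refine pd_eq_of_hasDerivAt (hv.mul hw) ?_
  exact ((hasLineDerivAt_pd hv i).mul (hasLineDerivAt_pd hw i)).congr_deriv (by simp)

theorem pd_add {v w : E2 → F} {s : E2} (hv : DifferentiableAt ℝ v s) (hw : DifferentiableAt ℝ w s)
    (i : Fin 2) : pd i (fun r => v r + w r) s = pd i v s + pd i w s := by
  simp [pd, fderiv_fun_add hv hw]

theorem pd_const_smul {v : E2 → F} {s : E2} (hv : DifferentiableAt ℝ v s) (c : ℝ)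
    (i : Fin 2) : pd i (fun r => c • v r) s = c • pd i v s := by
  simp [pd, fderiv_fun_const_smul hv]

theorem pd_const (c : F) (s : E2) (i : Fin 2) : pd i (fun _ => c) s = 0 := by
  simp [pd]

theorem contDiffOn_pd {h : E2 → F} {O : Set E2} (hO : IsOpen O) (hh : ContDiffOn ℝ ∞ h O)
    (i : Fin 2) : ContDiffOn ℝ ∞ (pd i h) O :=
  (hh.fderiv_of_isOpen hO (by simp)).clm_apply contDiffOn_const

theorem pd_comm {h : E2 → F} {s : E2} (hh : ContDiffAt ℝ ∞ h s) (i j : Fin 2) :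
    pd i (pd j h) s = pd j (pd i h) s := by
  have hd : DifferentiableAt ℝ (fderiv ℝ h) s :=
    (hh.fderiv_right (m := 1) (by norm_cast)).differentiableAt (by simp)
  have key : ∀ i j : Fin 2, pd i (pd j h) s
      = fderiv ℝ (fderiv ℝ h) s (EuclideanSpace.single i 1) (EuclideanSpace.single j 1) := by
    intro i j
    unfold pd
    rw [fderiv_clm_apply hd (differentiableAt_const _)]
    simp
  rw [key, key]
  exact hh.isSymmSndFDerivAt (by
    simp only [minSmoothness_of_isRCLikeNormedField]; exact ENat.LEInfty.out) _ _

end Calculus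

/-! ### Holonomic surfaces and the Gauss equation -/

section Gauss

variable {f : E2 → W × W} {O : Set E2}

/-- The vector `x + n`, a multiple of `σ`. -/
def nullPlus (p : W × W) : W := p.1 + p.2

/-- The vector `x - n`. -/
def nullMinus (p : W × W) : W := p.1 - p.2

theorem contDiff_nullPlus : ContDiff ℝ ∞ nullPlus := contDiff_fst.add contDiff_snd

theorem contDiff_nullMinus : ContDiff ℝ ∞ nullMinus := contDiff_fst.sub contDiff_snd

theorem form_nullPlus_self {p : W × W} (hp : p ∈ unitTangent) :
    form (nullPlus p) (nullPlus p) = 0 := by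
  obtain ⟨h1, h2, h3⟩ := hp
  simp only [form, nullPlus, Pi.add_apply] at *; linear_combination h1 + h2 + 2 * h3

theorem form_nullMinus_self {p : W × W} (hp : p ∈ unitTangent) :
    form (nullMinus p) (nullMinus p) = 0 := by
  obtain ⟨h1, h2, h3⟩ := hp
  simp only [form, nullMinus, Pi.sub_apply] at *; linear_combination h1 + h2 - 2 * h3

theorem form_nullPlus_nullMinus {p : W × W} (hp : p ∈ unitTangent) :
    form (nullPlus p) (nullMinus p) = -2 := by
  obtain ⟨h1, h2, h3⟩ := hp
  simp only [form, nullPlus, nullMinus, Pi.sub_apply, Pi.add_apply] at *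
  linear_combination h1 - h2

theorem pd_nullPlus {s : E2} (hf : ContDiffAt ℝ ∞ f s) (i : Fin 2) :
    pd i (fun r => nullPlus (f r)) s = nullPlus (pd i f s) := by
  have hd := hf.differentiableAt (by simp)
  have h := hd.hasFDerivAt
  have h' : HasFDerivAt (fun r => nullPlus (f r)) _ s := h.fst.add h.snd
  rw [pd, h'.fderiv]; rfl

theorem pd_nullMinus {s : E2} (hf : ContDiffAt ℝ ∞ f s) (i : Fin 2) :
    pd i (fun r => nullMinus (f r)) s = nullMinus (pd i f s) := by
  have hd := hf.differentiableAt (by simp)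
  have h := hd.hasFDerivAt
  have h' : HasFDerivAt (fun r => nullMinus (f r)) _ s := h.fst.sub h.snd
  rw [pd, h'.fderiv]; rfl

theorem pd_fst {s : E2} (hf : ContDiffAt ℝ ∞ f s) (i : Fin 2) :
    pd i (fun r => (f r).1) s = (pd i f s).1 := by
  have h := (hf.differentiableAt (by simp)).hasFDerivAt
  rw [pd, h.fst.fderiv]; rfl

theorem pd_snd {s : E2} (hf : ContDiffAt ℝ ∞ f s) (i : Fin 2) :
    pd i (fun r => (f r).2) s = (pd i f s).2 := by
  have h := (hf.differentiableAt (by simp)).hasFDerivAt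
  rw [pd, h.snd.fderiv]; rfl

/-- The surface `f` is, on `O`, a smooth holonomic surface in the unit tangent bundle with
nondegenerate first fundamental form at infinity. -/
structure IsHolonomicSurfaceOn (f : E2 → W × W) (O : Set E2) : Prop where
  isOpen : IsOpen O
  smooth : ContDiffOn ℝ ∞ f O
  mem_unitTangent : ∀ s ∈ O, f s ∈ unitTangent
  holonomic : ∀ s ∈ O, IsHolonomicAt f s
  isotropic : ∀ s ∈ O, IsIsotropicImmersionAt f s

/-- The algebraic content of the Gauss equation, for a null frame `a, b, c, d` where `c, d` are the
partial derivatives of `a`, for the partial derivatives `b0, b1` of `b`, the second partial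
derivatives `T00, T01, T11` of `a` and the Christoffel symbols `G0, G1` (for `01`) and `H0, H1`
(for `11`). -/
theorem gauss_algebra {a b c d b0 b1 T00 T01 T11 : W} {G0 G1 H0 H1 : ℝ}
    (h : IsNullFrame a b c d) (hΔ : det4 a b c d ≠ 0)
    (hg : form c c * form d d - form c d ^ 2 ≠ 0)
    (hsymm : form b0 d = form b1 c)
    (a00 : form a T00 = -form c c) (a01 : form a T01 = -form c d) (a11 : form a T11 = -form d d)
    (b00 : form b T00 = -form b0 c) (b01 : form b T01 = -form b0 d) (b11 : form b T11 = -form b1 d)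
    (l0 : form c c * G0 + form c d * G1 = form c T01)
    (l1 : form c d * G0 + form d d * G1 = form d T01)
    (m0 : form c c * H0 + form c d * H1 = form c T11)
    (m1 : form c d * H0 + form d d * H1 = form d T11) :
    (form T00 T11 - form T01 T01
      - ((form c T00 * H0 - form c T01 * G0) + (form d T00 * H1 - form d T01 * G1)))
        * det4 a b c d
    = - (det4 a b b0 d + det4 a b c b1) * (1 / 2 * (form c c * form d d - form c d ^ 2)) := by
  have ea : a = comb a b c d ![1, 0, 0, 0] := by simp [comb]
  have eb : b = comb a b c d ![0, 1, 0, 0] := by simp [comb]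
  have e1 : c = comb a b c d ![0, 0, 1, 0] := by simp [comb]
  have e2 : d = comb a b c d ![0, 0, 0, 1] := by simp [comb]
  obtain ⟨B0, eB0⟩ := exists_eq_comb hΔ b0
  obtain ⟨B1, eB1⟩ := exists_eq_comb hΔ b1
  obtain ⟨t00, e00⟩ := exists_eq_comb hΔ T00
  obtain ⟨t01, e01⟩ := exists_eq_comb hΔ T01
  obtain ⟨t11, e11⟩ := exists_eq_comb hΔ T11
  have fa : ∀ k, form a (comb a b c d k) = -2 * k 1 := fun k => by
    conv_lhs => arg 1; rw [ea]
    rw [h.form_comb]; simp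
  have fb : ∀ k, form b (comb a b c d k) = -2 * k 0 := fun k => by
    conv_lhs => arg 1; rw [eb]
    rw [h.form_comb]; simp
  have f1 : ∀ k, form c (comb a b c d k) = k 2 * form c c + k 3 * form c d := fun k => by
    conv_lhs => arg 1; rw [e1]
    rw [h.form_comb]; simp
  have f2 : ∀ k, form d (comb a b c d k) = k 2 * form c d + k 3 * form d d := fun k => by
    conv_lhs => arg 1; rw [e2]
    rw [h.form_comb]; simp
  have gen : ∀ k l, det4 a b (comb a b c d k) (comb a b c d l)
      = (k 2 * l 3 - k 3 * l 2) * det4 a b c d := fun k l => by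
    conv_lhs => arg 1; rw [ea]
    conv_lhs => arg 2; rw [eb]
    rw [det4_comb, det4_eq]; simp
  have gen1 : det4 a b b0 d = B0 2 * det4 a b c d := by
    conv_lhs => arg 4; rw [e2]
    rw [eB0, gen]; simp
  have gen2 : det4 a b c b1 = B1 3 * det4 a b c d := by
    conv_lhs => arg 3; rw [e1]
    rw [eB1, gen]; simp
  have ff := h.form_comb
  rw [form_comm b0 c, eB0, f1] at b00
  rw [form_comm b0 d, eB0, f2] at b01
  rw [form_comm b1 d, eB1, f2] at b11
  rw [form_comm b0 d, form_comm b1 c, eB0, eB1, f1, f2] at hsymm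
  rw [gen1, gen2]
  rw [e00, fa] at a00
  rw [e01, fa] at a01
  rw [e11, fa] at a11
  rw [e00, fb] at b00
  rw [e01, fb] at b01
  rw [e11, fb] at b11
  rw [e01, f1] at l0
  rw [e01, f2] at l1
  rw [e11, f1] at m0
  rw [e11, f2] at m1
  have hG0 : G0 = t01 2 := by
    apply mul_left_cancel₀ hg; linear_combination form d d * l0 - form c d * l1
  have hG1 : G1 = t01 3 := by
    apply mul_left_cancel₀ hg; linear_combination form c c * l1 - form c d * l0
  have hH0 : H0 = t11 2 := by
    apply mul_left_cancel₀ hg; linear_combination form d d * m0 - form c d * m1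
  have hH1 : H1 = t11 3 := by
    apply mul_left_cancel₀ hg; linear_combination form c c * m1 - form c d * m0
  have n00 : t00 1 = form c c / 2 := by linarith
  have n01 : t01 1 = form c d / 2 := by linarith
  have n11 : t11 1 = form d d / 2 := by linarith
  rw [e00, e01, e11]
  simp only [ff, f1, f2, hG0, hG1, hH0, hH1, n00, n01, n11]
  have k00 : t00 0 = (B0 2 * form c c + B0 3 * form c d) / 2 := by linarith
  have k01 : t01 0 = (B0 2 * form c d + B0 3 * form d d) / 2 := by linarith
  have k11 : t11 0 = (B1 2 * form c d + B1 3 * form d d) / 2 := by linarith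
  rw [k00, k01, k11]
  linear_combination (form c d / 2 * det4 a b c d) * hsymm

namespace IsHolonomicSurfaceOn

variable (h : IsHolonomicSurfaceOn f O) {s : E2} (hs : s ∈ O)

include h

theorem smooth_plus : ContDiffOn ℝ ∞ (fun r => nullPlus (f r)) O :=
  contDiff_nullPlus.comp_contDiffOn h.smooth

theorem smooth_minus : ContDiffOn ℝ ∞ (fun r => nullMinus (f r)) O :=
  contDiff_nullMinus.comp_contDiffOn h.smooth

include hs

theorem contDiffAt : ContDiffAt ℝ ∞ f s := h.smooth.contDiffAt (h.isOpen.mem_nhds hs)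

theorem contDiffAt_of {F : Type*} [NormedAddCommGroup F] [NormedSpace ℝ F] {k : E2 → F}
    (hk : ContDiffOn ℝ ∞ k O) : ContDiffAt ℝ ∞ k s := hk.contDiffAt (h.isOpen.mem_nhds hs)

/-- Differentiating an equation `⟨v, w⟩ = c` valid along the surface. -/
theorem form_pd_add {v w : E2 → W} (hv : ContDiffOn ℝ ∞ v O) (hw : ContDiffOn ℝ ∞ w O) {c : ℝ}
    (hc : ∀ r ∈ O, form (v r) (w r) = c) (i : Fin 2) :
    form (pd i v s) (w s) + form (v s) (pd i w s) = 0 := by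
  rw [← pd_form (h.contDiffAt_of hs hv) (h.contDiffAt_of hs hw),
    pd_congr (k := fun _ => c) (by filter_upwards [h.isOpen.mem_nhds hs] using hc), pd_const]

theorem form_plus_pd_plus (i : Fin 2) :
    form (nullPlus (f s)) (pd i (fun r => nullPlus (f r)) s) = 0 := by
  have := h.form_pd_add hs h.smooth_plus h.smooth_plus
    (fun r hr => form_nullPlus_self (h.mem_unitTangent r hr)) i
  rw [form_comm] at this; linarith

theorem form_minus_pd_minus (i : Fin 2) :
    form (nullMinus (f s)) (pd i (fun r => nullMinus (f r)) s) = 0 := by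
  have := h.form_pd_add hs h.smooth_minus h.smooth_minus
    (fun r hr => form_nullMinus_self (h.mem_unitTangent r hr)) i
  rw [form_comm] at this; linarith

theorem form_x_pd_x (i : Fin 2) : form (f s).1 (pd i f s).1 = 0 := by
  have := h.form_pd_add hs h.smooth.fst h.smooth.fst
    (fun r hr => (h.mem_unitTangent r hr).1) i
  rw [pd_fst (h.contDiffAt hs), form_comm] at this; linarith

theorem form_n_pd_n (i : Fin 2) : form (f s).2 (pd i f s).2 = 0 := by
  have := h.form_pd_add hs h.smooth.snd h.smooth.snd
    (fun r hr => (h.mem_unitTangent r hr).2.1) i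
  rw [pd_snd (h.contDiffAt hs), form_comm] at this; linarith

theorem form_minus_pd_plus (i : Fin 2) :
    form (nullMinus (f s)) (pd i (fun r => nullPlus (f r)) s) = 0 := by
  have h1 := h.form_x_pd_x hs i
  have h2 := h.form_n_pd_n hs i
  obtain ⟨h3, h4⟩ := h.holonomic s hs i
  rw [pd_nullPlus (h.contDiffAt hs)]
  simp only [form, nullPlus, nullMinus, Pi.sub_apply, Pi.add_apply] at *
  linear_combination h1 - h2 - h3 + h4

theorem form_plus_pd_minus (i : Fin 2) :
    form (nullPlus (f s)) (pd i (fun r => nullMinus (f r)) s) = 0 := by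
  have h1 := h.form_x_pd_x hs i
  have h2 := h.form_n_pd_n hs i
  obtain ⟨h3, h4⟩ := h.holonomic s hs i
  rw [pd_nullMinus (h.contDiffAt hs)]
  simp only [form, nullPlus, nullMinus, Pi.sub_apply, Pi.add_apply] at *
  linear_combination h1 - h2 + h3 - h4

theorem isNullFrame : IsNullFrame (nullPlus (f s)) (nullMinus (f s))
    (pd 0 (fun r => nullPlus (f r)) s) (pd 1 (fun r => nullPlus (f r)) s) where
  aa := form_nullPlus_self (h.mem_unitTangent s hs)
  bb := form_nullMinus_self (h.mem_unitTangent s hs)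
  ab := form_nullPlus_nullMinus (h.mem_unitTangent s hs)
  ac := h.form_plus_pd_plus hs 0
  ad := h.form_plus_pd_plus hs 1
  bc := h.form_minus_pd_plus hs 0
  bd := h.form_minus_pd_plus hs 1

theorem pd_sigma (i : Fin 2) :
    pd i (sigma f) s = (√2 / 2) • pd i (fun r => nullPlus (f r)) s :=
  pd_const_smul ((h.contDiffAt_of hs h.smooth_plus).differentiableAt (by simp)) _ i

theorem firstForm_apply (i j : Fin 2) : firstForm f s i j =
    1 / 2 * form (pd i (fun r => nullPlus (f r)) s) (pd j (fun r => nullPlus (f r)) s) := by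
  have h2 : √2 * √2 = 2 := Real.mul_self_sqrt (by norm_num)
  simp only [firstForm, Matrix.of_apply, h.pd_sigma hs, form, Pi.smul_apply, smul_eq_mul]
  linear_combination (1 / 4 * (
    pd i (fun r => nullPlus (f r)) s 0 * pd j (fun r => nullPlus (f r)) s 0
    + pd i (fun r => nullPlus (f r)) s 1 * pd j (fun r => nullPlus (f r)) s 1
    - pd i (fun r => nullPlus (f r)) s 2 * pd j (fun r => nullPlus (f r)) s 2
    - pd i (fun r => nullPlus (f r)) s 3 * pd j (fun r => nullPlus (f r)) s 3)) * h2

/-- The vector `x - n` is transverse to the span of `x + n` and its derivatives, so that the four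
vectors form a basis. -/
theorem det4_ne_zero : det4 (nullPlus (f s)) (nullMinus (f s))
    (pd 0 (fun r => nullPlus (f r)) s) (pd 1 (fun r => nullPlus (f r)) s) ≠ 0 := by
  have hli := h.isotropic s hs
  have hfr := h.isNullFrame hs
  rw [IsIsotropicImmersionAt, h.pd_sigma hs, h.pd_sigma hs] at hli
  have h2 : (√2 / 2 : ℝ) ≠ 0 := by positivity
  rw [Fintype.linearIndependent_iff] at hli
  have hli4 : LinearIndependent ℝ (Matrix.of ![nullPlus (f s), nullMinus (f s),
      pd 0 (fun r => nullPlus (f r)) s, pd 1 (fun r => nullPlus (f r)) s]).row := by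
    rw [Fintype.linearIndependent_iff]
    intro g hg
    have hg' : g 0 • nullPlus (f s) + g 1 • nullMinus (f s)
        + g 2 • pd 0 (fun r => nullPlus (f r)) s + g 3 • pd 1 (fun r => nullPlus (f r)) s = 0 := by
      rw [← hg, Fin.sum_univ_four]; rfl
    have hg1 : g 1 = 0 := by
      have e : form (comb (nullPlus (f s)) (nullMinus (f s)) (pd 0 (fun r => nullPlus (f r)) s)
          (pd 1 (fun r => nullPlus (f r)) s) ![1, 0, 0, 0]) (comb (nullPlus (f s))
          (nullMinus (f s)) (pd 0 (fun r => nullPlus (f r)) s)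
          (pd 1 (fun r => nullPlus (f r)) s) g) = 0 := by
        rw [comb.eq_1 _ _ _ _ g, hg']; simp [form]
      rw [hfr.form_comb] at e
      simpa using e
    have := hli ![g 0, g 2, g 3] (by
      rw [hg1, zero_smul, add_zero] at hg'
      have e := congrArg (fun v => (√2 / 2 : ℝ) • v) hg'
      simp only [smul_zero] at e
      rw [← e]
      simp only [Fin.sum_univ_three, sigma, nullPlus, Matrix.cons_val_zero, Matrix.cons_val_one,
        Matrix.cons_val]
      module)
    intro i
    fin_cases i
    · exact this 0
    · exact hg1
    · exact this 1
    · exact this 2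
  have := (Matrix.linearIndependent_rows_iff_isUnit.1 hli4)
  exact ((Matrix.isUnit_iff_isUnit_det _).1 this).ne_zero

theorem det_firstForm : (firstForm f s).det = -(1 / 16) * det4 (nullPlus (f s)) (nullMinus (f s))
    (pd 0 (fun r => nullPlus (f r)) s) (pd 1 (fun r => nullPlus (f r)) s) ^ 2 := by
  rw [(h.isNullFrame hs).det4_sq, Matrix.det_fin_two]
  simp only [h.firstForm_apply hs]
  rw [form_comm (pd 1 _ s) (pd 0 _ s)]
  ring

theorem det_firstForm_ne_zero : (firstForm f s).det ≠ 0 := by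
  rw [h.det_firstForm hs]
  exact mul_ne_zero (by norm_num) (pow_ne_zero 2 (h.det4_ne_zero hs))

/-- The volume form of the first fundamental form at infinity is `det (x, n, ∂₁σ, ∂₂σ)`. -/
theorem areaForm_eq : areaForm f s = -(1 / 4) * det4 (nullPlus (f s)) (nullMinus (f s))
    (pd 0 (fun r => nullPlus (f r)) s) (pd 1 (fun r => nullPlus (f r)) s) := by
  have e : det4 (f s).1 (f s).2 (pd 0 (sigma f) s) (pd 1 (sigma f) s)
      = -(1 / 4) * det4 (nullPlus (f s)) (nullMinus (f s))
    (pd 0 (fun r => nullPlus (f r)) s) (pd 1 (fun r => nullPlus (f r)) s) := by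
    have h2 : √2 * √2 = 2 := Real.mul_self_sqrt (by norm_num)
    have h3 : √2 ^ 2 = 2 := by rw [sq, h2]
    rw [h.pd_sigma hs, h.pd_sigma hs]
    simp only [det4_eq, Pi.smul_apply, smul_eq_mul, nullPlus, nullMinus, Pi.add_apply, Pi.sub_apply]
    ring_nf
    rw [h3]
    ring
  rw [areaForm, e, h.det_firstForm hs]
  set Δ := det4 (nullPlus (f s)) (nullMinus (f s))
    (pd 0 (fun r => nullPlus (f r)) s) (pd 1 (fun r => nullPlus (f r)) s)
  rw [show -(1 / 16) * Δ ^ 2 = -(-(1 / 4) * Δ) ^ 2 by ring, abs_neg, abs_of_nonneg (sq_nonneg _),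
    Real.sqrt_sq_eq_abs]
  rcases lt_trichotomy (-(1 / 4) * Δ) 0 with h' | h' | h'
  · rw [Real.sign_of_neg h', abs_of_neg h']; ring
  · rw [h']; simp
  · rw [Real.sign_of_pos h', abs_of_pos h']; ring

theorem form_pd_minus_pd_plus_symm (i j : Fin 2) :
    form (pd i (fun r => nullMinus (f r)) s) (pd j (fun r => nullPlus (f r)) s)
      = form (pd j (fun r => nullMinus (f r)) s) (pd i (fun r => nullPlus (f r)) s) := by
  have key : ∀ i j, form (pd i (fun r => nullMinus (f r)) s) (pd j (fun r => nullPlus (f r)) s)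
      = - form (nullMinus (f s)) (pd i (pd j (fun r => nullPlus (f r))) s) := fun i j => by
    have := h.form_pd_add hs h.smooth_minus (contDiffOn_pd h.isOpen h.smooth_plus j)
      (fun r hr => h.form_minus_pd_plus hr j) i
    linarith
  rw [key, key, pd_comm (h.contDiffAt_of hs h.smooth_plus)]

theorem contDiffAt_firstForm (i j : Fin 2) :
    ContDiffAt ℝ ∞ (fun r => firstForm f r i j) s := by
  have hp := fun i => h.contDiffAt_of hs (contDiffOn_pd h.isOpen h.smooth_plus i)
  refine ContDiffAt.congr_of_eventuallyEq (f := fun r => 1 / 2 *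
    form (pd i (fun r => nullPlus (f r)) r) (pd j (fun r => nullPlus (f r)) r)) ?_ ?_
  · exact contDiffAt_const.mul (ContDiffWithinAt.form (s := univ) (hp i) (hp j))
  · filter_upwards [h.isOpen.mem_nhds hs] with r hr using h.firstForm_apply hr i j

theorem pd_firstForm (i j k : Fin 2) : pd k (fun r => firstForm f r i j) s = 1 / 2 *
    (form (pd k (pd i (fun r => nullPlus (f r))) s) (pd j (fun r => nullPlus (f r)) s)
      + form (pd i (fun r => nullPlus (f r)) s) (pd k (pd j (fun r => nullPlus (f r))) s)) := by
  have hp := fun i => h.contDiffAt_of hs (contDiffOn_pd h.isOpen h.smooth_plus i)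
  rw [pd_congr (k := fun r => (1 / 2 : ℝ) •
    form (pd i (fun r => nullPlus (f r)) r) (pd j (fun r => nullPlus (f r)) r)) ?_ k]
  · rw [pd_const_smul, pd_form (hp i) (hp j), smul_eq_mul]
    exact ContDiffAt.differentiableAt (n := ∞)
      (ContDiffWithinAt.form (s := univ) (hp i) (hp j)) (by simp)
  · filter_upwards [h.isOpen.mem_nhds hs] with r hr using h.firstForm_apply hr i j

omit hs in
/-- The Christoffel symbols with the upper index lowered. -/
theorem sum_firstForm_mul_christoffel (hs : s ∈ O) (l i j : Fin 2) :
    firstForm f s l 0 * christoffel (firstForm f) 0 i j s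
      + firstForm f s l 1 * christoffel (firstForm f) 1 i j s = 1 / 2 *
    form (pd i (pd j (fun r => nullPlus (f r))) s) (pd l (fun r => nullPlus (f r)) s) := by
  have hinv : firstForm f s * (firstForm f s)⁻¹ = 1 :=
    Matrix.mul_nonsing_inv _ (isUnit_iff_ne_zero.2 (h.det_firstForm_ne_zero hs))
  have h0 := congrFun (congrFun hinv l) 0
  have h1 := congrFun (congrFun hinv l) 1
  rw [Matrix.mul_apply, Fin.sum_univ_two, Matrix.one_apply] at h0 h1
  have hc := fun i j => pd_comm (h.contDiffAt_of hs h.smooth_plus) i j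
  simp only [christoffel, Fin.sum_univ_two, h.pd_firstForm hs]
  have key : ∀ m, 1 / 2 * (form (pd i (pd j (fun r => nullPlus (f r))) s)
        (pd m (fun r => nullPlus (f r)) s)
      + form (pd j (fun r => nullPlus (f r)) s) (pd i (pd m (fun r => nullPlus (f r))) s))
      + 1 / 2 * (form (pd j (pd i (fun r => nullPlus (f r))) s) (pd m (fun r => nullPlus (f r)) s)
      + form (pd i (fun r => nullPlus (f r)) s) (pd j (pd m (fun r => nullPlus (f r))) s))
      - 1 / 2 * (form (pd m (pd i (fun r => nullPlus (f r))) s) (pd j (fun r => nullPlus (f r)) s)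
      + form (pd i (fun r => nullPlus (f r)) s) (pd m (pd j (fun r => nullPlus (f r))) s))
      = form (pd i (pd j (fun r => nullPlus (f r))) s) (pd m (fun r => nullPlus (f r)) s) := by
    intro m
    rw [hc m i, hc m j, hc j i, form_comm (pd j (fun r => nullPlus (f r)) s)]
    ring
  rw [key, key]
  fin_cases l
  · simp only [Fin.zero_eta, if_true, zero_ne_one, if_false] at h0 h1 ⊢
    linear_combination (1 / 2 * form (pd i (pd j (fun r => nullPlus (f r))) s)
      (pd 0 (fun r => nullPlus (f r)) s)) * h0 + (1 / 2 * form (pd i (pd j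
      (fun r => nullPlus (f r))) s) (pd 1 (fun r => nullPlus (f r)) s)) * h1
  · simp only [Fin.mk_one, if_true, one_ne_zero, if_false] at h0 h1 ⊢
    linear_combination (1 / 2 * form (pd i (pd j (fun r => nullPlus (f r))) s)
      (pd 0 (fun r => nullPlus (f r)) s)) * h0 + (1 / 2 * form (pd i (pd j
      (fun r => nullPlus (f r))) s) (pd 1 (fun r => nullPlus (f r)) s)) * h1

theorem differentiableAt_christoffel (k i j : Fin 2) :
    DifferentiableAt ℝ (christoffel (firstForm f) k i j) s := by
  have hg := fun i j => (h.contDiffAt_firstForm hs i j).differentiableAt (by simp)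
  have hdet : DifferentiableAt ℝ (fun r => (firstForm f r).det) s := by
    simp only [Matrix.det_fin_two]
    exact ((hg 0 0).mul (hg 1 1)).sub ((hg 0 1).mul (hg 1 0))
  have hadj : DifferentiableAt ℝ (fun r => (firstForm f r).adjugate) s := by
    simp only [Matrix.adjugate_fin_two]
    refine differentiableAt_pi.2 fun i => differentiableAt_pi.2 fun j => ?_
    fin_cases i <;> fin_cases j
    exacts [hg 1 1, (hg 0 1).neg, (hg 1 0).neg, hg 0 0]
  have hinv : ∀ k l, DifferentiableAt ℝ (fun r => (firstForm f r)⁻¹ k l) s := by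
    intro k l
    simp only [Matrix.inv_def, Ring.inverse_eq_inv', Matrix.smul_apply, smul_eq_mul]
    exact (hdet.inv (h.det_firstForm_ne_zero hs)).mul
      (differentiableAt_pi.1 (differentiableAt_pi.1 hadj k) l)
  have hpd : ∀ k i j, DifferentiableAt ℝ (pd k (fun r => firstForm f r i j)) s := by
    intro k i j
    have : ContDiffOn ℝ ∞ (fun r => firstForm f r i j) O := fun r hr =>
      (h.contDiffAt_firstForm hr i j).contDiffWithinAt
    exact (h.contDiffAt_of hs (contDiffOn_pd h.isOpen this k)).differentiableAt (by simp)
  unfold christoffel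
  refine (differentiableAt_const _).mul (DifferentiableAt.fun_sum fun l _ => (hinv k l).mul ?_)
  exact ((hpd i j l).add (hpd j i l)).sub (hpd l i j)

/-- The Gauss equation: the Riemann tensor of the first fundamental form at infinity in terms of
the second derivatives of `x + n`. -/
theorem sum_firstForm_mul_riemann :
    ∑ l, firstForm f s l 0 * riemann (firstForm f) l 0 1 1 s =
    1 / 2 * (
      form (pd 0 (pd 0 (fun r => nullPlus (f r))) s) (pd 1 (pd 1 (fun r => nullPlus (f r))) s)
      - form (pd 0 (pd 1 (fun r => nullPlus (f r))) s) (pd 0 (pd 1 (fun r => nullPlus (f r))) s))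
    - 1 / 2 * ∑ m, (
        form (pd 0 (pd 0 (fun r => nullPlus (f r))) s) (pd m (fun r => nullPlus (f r)) s)
          * christoffel (firstForm f) m 1 1 s
        - form (pd 0 (pd 1 (fun r => nullPlus (f r))) s) (pd m (fun r => nullPlus (f r)) s)
          * christoffel (firstForm f) m 0 1 s) := by
  have hp := fun i => contDiffOn_pd h.isOpen h.smooth_plus i
  have hpp := fun i j => contDiffOn_pd h.isOpen (hp j) i
  have hg := fun i j => (h.contDiffAt_firstForm hs i j).differentiableAt (by simp)
  have hG := fun k i j => h.differentiableAt_christoffel hs k i j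
  have hlow := fun l i j => h.sum_firstForm_mul_christoffel hs l i j
  have hc := fun i j => pd_comm (h.contDiffAt_of hs h.smooth_plus) i j
  -- differentiate the formula for the lowered Christoffel symbols
  have hder : ∀ k i j, (pd k (fun r => firstForm f r 0 0) s * christoffel (firstForm f) 0 i j s
        + firstForm f s 0 0 * pd k (christoffel (firstForm f) 0 i j) s)
      + (pd k (fun r => firstForm f r 0 1) s * christoffel (firstForm f) 1 i j s
        + firstForm f s 0 1 * pd k (christoffel (firstForm f) 1 i j) s)
      = 1 / 2 * (form (pd k (pd i (pd j (fun r => nullPlus (f r)))) s)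
          (pd 0 (fun r => nullPlus (f r)) s)
        + form (pd i (pd j (fun r => nullPlus (f r))) s)
          (pd k (pd 0 (fun r => nullPlus (f r))) s)) := by
    intro k i j
    have e1 : pd k (fun r => firstForm f r 0 0 * christoffel (firstForm f) 0 i j r
        + firstForm f r 0 1 * christoffel (firstForm f) 1 i j r) s
      = pd k (fun r => (1 / 2 : ℝ) • form (pd i (pd j (fun r => nullPlus (f r))) r)
          (pd 0 (fun r => nullPlus (f r)) r)) s := by
      refine pd_congr ?_ k
      filter_upwards [h.isOpen.mem_nhds hs] with r hr
      exact h.sum_firstForm_mul_christoffel hr 0 i j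
    rw [pd_add ((hg 0 0).fun_mul (hG 0 i j)) ((hg 0 1).fun_mul (hG 1 i j)),
      pd_mul (hg 0 0) (hG 0 i j), pd_mul (hg 0 1) (hG 1 i j), pd_const_smul,
      pd_form (h.contDiffAt_of hs (hpp i j)) (h.contDiffAt_of hs (hp 0)), smul_eq_mul] at e1
    · exact e1
    · exact ContDiffAt.differentiableAt (n := ∞) (ContDiffWithinAt.form (s := univ)
        (h.contDiffAt_of hs (hpp i j)) (h.contDiffAt_of hs (hp 0))) (by simp)
  have d0 := hder 0 1 1
  have d1 := hder 1 0 1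
  have h3 : pd 1 (pd 0 (pd 1 (fun r => nullPlus (f r)))) s
      = pd 0 (pd 1 (pd 1 (fun r => nullPlus (f r)))) s :=
    pd_comm (h.contDiffAt_of hs (hp 1)) 1 0
  have hsym : firstForm f s 1 0 = firstForm f s 0 1 := by
    rw [h.firstForm_apply hs, h.firstForm_apply hs, form_comm]
  simp only [h.pd_firstForm hs, h3, hc 1 0] at d0 d1
  simp only [Fin.sum_univ_two, riemann, hsym]
  have l00 := hlow 0 0 0
  have l01 := hlow 0 0 1
  have l11 := hlow 0 1 1
  have l10 := hlow 0 1 0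
  rw [hsym.symm] at *
  rw [hc 1 0] at l10
  set S0 := pd 0 (fun r => nullPlus (f r)) s
  set S1 := pd 1 (fun r => nullPlus (f r)) s
  set T00 := pd 0 (pd 0 (fun r => nullPlus (f r))) s
  set T01 := pd 0 (pd 1 (fun r => nullPlus (f r))) s
  set T11 := pd 1 (pd 1 (fun r => nullPlus (f r))) s
  rw [form_comm S0 T00, form_comm S0 T01] at d0
  rw [form_comm S0 T01, form_comm S0 T11] at d1
  rw [form_comm T00 T11]
  linear_combination d0 - d1 + (christoffel (firstForm f) 0 1 1 s) * l00
    + (christoffel (firstForm f) 1 1 1 s) * l01 - (christoffel (firstForm f) 0 0 1 s) * l10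
    - (christoffel (firstForm f) 1 0 1 s) * l11

/-- The curvature form of the first fundamental form at infinity is, up to sign, the area form times
the trace of the shape operator of the null normal field `x - n`. -/
theorem curvatureForm_eq : curvatureForm f s = 1 / 4 *
    (det4 (nullPlus (f s)) (nullMinus (f s)) (pd 0 (fun r => nullMinus (f r)) s)
        (pd 1 (fun r => nullPlus (f r)) s)
      + det4 (nullPlus (f s)) (nullMinus (f s)) (pd 0 (fun r => nullPlus (f r)) s)
        (pd 1 (fun r => nullMinus (f r)) s)) := by
  have hfr := h.isNullFrame hs
  have hΔ := h.det4_ne_zero hs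
  have hp := fun i => contDiffOn_pd h.isOpen h.smooth_plus i
  have hg := h.det_firstForm_ne_zero hs
  -- the normal components of the second derivatives
  have hnp : ∀ i j, form (nullPlus (f s)) (pd i (pd j (fun r => nullPlus (f r))) s)
      = - form (pd i (fun r => nullPlus (f r)) s) (pd j (fun r => nullPlus (f r)) s) := by
    intro i j
    have := h.form_pd_add hs h.smooth_plus (hp j) (fun r hr => h.form_plus_pd_plus hr j) i
    linarith
  have hnm : ∀ i j, form (nullMinus (f s)) (pd i (pd j (fun r => nullPlus (f r))) s)
      = - form (pd i (fun r => nullMinus (f r)) s) (pd j (fun r => nullPlus (f r)) s) := by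
    intro i j
    have := h.form_pd_add hs h.smooth_minus (hp j) (fun r hr => h.form_minus_pd_plus hr j) i
    linarith
  have hsymm := h.form_pd_minus_pd_plus_symm hs 0 1
  have hlow := fun l i j => h.sum_firstForm_mul_christoffel hs l i j
  rw [curvatureForm, sectionalCurvature, h.sum_firstForm_mul_riemann hs, h.areaForm_eq hs]
  rw [div_mul_eq_mul_div, div_eq_iff hg]
  have hg' : form (pd 0 (fun r => nullPlus (f r)) s) (pd 0 (fun r => nullPlus (f r)) s)
      * form (pd 1 (fun r => nullPlus (f r)) s) (pd 1 (fun r => nullPlus (f r)) s)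
      - form (pd 0 (fun r => nullPlus (f r)) s) (pd 1 (fun r => nullPlus (f r)) s) ^ 2 ≠ 0 := by
    intro h0
    have h1 := hfr.det4_sq
    rw [h0, mul_zero] at h1
    exact hΔ (pow_eq_zero_iff two_ne_zero |>.1 h1)
  have l0 := hlow 0 0 1
  have l1 := hlow 1 0 1
  have m0 := hlow 0 1 1
  have m1 := hlow 1 1 1
  rw [Matrix.det_fin_two]
  simp only [h.firstForm_apply hs, Fin.sum_univ_two] at l0 l1 m0 m1 ⊢
  rw [form_comm (pd 1 (fun r => nullPlus (f r)) s) (pd 0 (fun r => nullPlus (f r)) s)] at *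
  have key := gauss_algebra hfr hΔ hg' hsymm (hnp 0 0) (hnp 0 1)
    (hnp 1 1) (hnm 0 0) (hnm 0 1) (hnm 1 1)
    (G0 := christoffel (firstForm f) 0 0 1 s) (G1 := christoffel (firstForm f) 1 0 1 s)
    (H0 := christoffel (firstForm f) 0 1 1 s) (H1 := christoffel (firstForm f) 1 1 1 s)
    (by rw [form_comm _ (pd 0 (pd 1 _) s)]; linarith)
    (by rw [form_comm _ (pd 0 (pd 1 _) s)]; linarith)
    (by rw [form_comm _ (pd 1 (pd 1 _) s)]; linarith)
    (by rw [form_comm _ (pd 1 (pd 1 _) s)]; linarith)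
  rw [form_comm _ (pd 0 (pd 0 _) s), form_comm _ (pd 0 (pd 0 _) s),
    form_comm (pd 0 (fun r => nullPlus (f r)) s) (pd 0 (pd 1 _) s),
    form_comm (pd 1 (fun r => nullPlus (f r)) s) (pd 0 (pd 1 _) s)] at key
  linear_combination (-(1 / 8)) * key

end IsHolonomicSurfaceOn
end Gauss
end AdS

namespace AdS

/-! ### Integration with respect to an oriented system of charts -/

/-- A system of charts on (a subset of) a space `M` with values in `E`, indexed by the points of
`M`: the inverse chart `pt c` maps the domain `dom c ⊆ E` into `src c ⊆ M`, `co c` is the chart, and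
the transition maps `co c' ∘ pt c` are differentiable with derivative `trans' c c'` of positive
determinant. The charts of a manifold with boundary and those of its boundary are both of this
kind. -/
structure ChartSystem (M E : Type*) [TopologicalSpace M] [NormedAddCommGroup E] [NormedSpace ℝ E]
    [MeasurableSpace E] where
  /-- The domain of the inverse chart. -/
  dom : M → Set E
  /-- The inverse chart. -/
  pt : M → E → M
  /-- The open set of `M` on which the chart is defined. -/
  src : M → Set M
  /-- The chart. -/
  co : M → M → E
  /-- The derivative of the transition maps. -/
  trans' : M → M → E → E →L[ℝ] E
  measurableSet_dom : ∀ c, MeasurableSet (dom c)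
  uniqueDiffOn_dom : ∀ c, UniqueDiffOn ℝ (dom c)
  isOpen_src : ∀ c, IsOpen (src c)
  continuousOn_pt : ∀ c, ContinuousOn (pt c) (dom c)
  pt_mem : ∀ c, ∀ y ∈ dom c, pt c y ∈ src c
  co_pt : ∀ c, ∀ y ∈ dom c, co c (pt c y) = y
  co_mem : ∀ c c', ∀ y ∈ dom c, pt c y ∈ src c' → co c' (pt c y) ∈ dom c'
  pt_co : ∀ c c', ∀ y ∈ dom c, pt c y ∈ src c' → pt c' (co c' (pt c y)) = pt c y
  isCompact_preimage : ∀ c k, IsCompact k → k ⊆ src c → IsCompact (dom c ∩ pt c ⁻¹' k)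
  hasFDerivWithinAt : ∀ c c', ∀ y ∈ dom c, pt c y ∈ src c' →
    HasFDerivWithinAt (fun z => co c' (pt c z)) (trans' c c' y) (dom c ∩ pt c ⁻¹' src c') y
  det_pos : ∀ c c', ∀ y ∈ dom c, pt c y ∈ src c' → 0 < (trans' c c' y).det

namespace ChartSystem

variable {M E : Type*} [TopologicalSpace M] [NormedAddCommGroup E] [NormedSpace ℝ E]
  [MeasureSpace E] (S : ChartSystem M E) (ρ : PartitionOfUnity M M univ)

/-- The integral over the part lying in `k` of the form of top degree with coefficients `η c`, by
means of the partition of unity `ρ`. -/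
noncomputable def integral (k : Set M) (η : M → E → ℝ) : ℝ :=
  ∑ᶠ c, ∫ y in S.dom c ∩ S.pt c ⁻¹' k, ρ c (S.pt c y) * η c y

/-- The form with coefficients `η c` is continuous and vanishes outside `k`. -/
structure IsContFormOn (k : Set M) (η : M → E → ℝ) : Prop where
  continuousOn : ∀ c, ContinuousOn (η c) (S.dom c)
  eq_zero : ∀ c, ∀ y ∈ S.dom c, S.pt c y ∉ k → η c y = 0

variable {S ρ} {k : Set M} {η : M → E → ℝ}

theorem IsContFormOn.sum {ι : Type*} {s : Finset ι} {η : ι → M → E → ℝ}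
    (h : ∀ i ∈ s, S.IsContFormOn k (η i)) : S.IsContFormOn k (fun c y => ∑ i ∈ s, η i c y) where
  continuousOn c := continuousOn_finsetSum s fun i hi => (h i hi).continuousOn c
  eq_zero c y hy hk := Finset.sum_eq_zero fun i hi => (h i hi).eq_zero c y hy hk

theorem IsContFormOn.add {η' : M → E → ℝ} (h : S.IsContFormOn k η) (h' : S.IsContFormOn k η') :
    S.IsContFormOn k (fun c y => η c y + η' c y) where
  continuousOn c := (h.continuousOn c).add (h'.continuousOn c)
  eq_zero c y hy hk := by rw [h.eq_zero c y hy hk, h'.eq_zero c y hy hk, add_zero]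

theorem IsContFormOn.const_mul (h : S.IsContFormOn k η) (a : ℝ) :
    S.IsContFormOn k (fun c y => a * η c y) where
  continuousOn c := continuousOn_const.mul (h.continuousOn c)
  eq_zero c y hy hk := by rw [h.eq_zero c y hy hk, mul_zero]

theorem measurableSet_inter_preimage [OpensMeasurableSpace E] {u : Set M} (hu : IsOpen u) (c : M) :
    MeasurableSet (S.dom c ∩ S.pt c ⁻¹' u) := by
  obtain ⟨v, hv, h⟩ := continuousOn_iff'.1 (S.continuousOn_pt c) u hu
  rw [inter_comm, h]
  exact hv.measurableSet.inter (S.measurableSet_dom c)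

theorem measurableSet_inter_preimage_of_isClosed [OpensMeasurableSpace E] {u : Set M}
    (hu : IsClosed u) (c : M) : MeasurableSet (S.dom c ∩ S.pt c ⁻¹' u) := by
  have h := (S.measurableSet_dom c).diff (S.measurableSet_inter_preimage hu.isOpen_compl c)
  convert h using 1
  ext y; simp

theorem finite_inter (ρ : PartitionOfUnity M M univ) (hk : IsCompact k) :
    {c | (Function.support (ρ c) ∩ k).Nonempty}.Finite :=
  ρ.locallyFinite.finite_nonempty_inter_compact hk

/-- The finite set of indices of those functions of a partition of unity which do not vanish
identically on a compact set. -/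
noncomputable def indices (ρ : PartitionOfUnity M M univ) (hk : IsCompact k) : Finset M :=
  (finite_inter ρ hk).toFinset

theorem mem_indices {hk : IsCompact k} {c p : M} (hp : p ∈ k) (h : ρ c p ≠ 0) :
    c ∈ indices ρ hk := by
  simp only [indices, Finite.mem_toFinset, mem_ofPred_eq]
  exact ⟨p, h, hp⟩

theorem sum_indices {hk : IsCompact k} {p : M} (hp : p ∈ k) :
    ∑ c ∈ indices ρ hk, ρ c p = 1 := by
  rw [← finsum_eq_sum_of_support_subset, ρ.sum_eq_one (mem_univ p)]
  intro c hc
  exact mem_indices hp hc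

theorem integral_eq_sum (hk : IsCompact k)
    (h0 : ∀ c, ∀ y ∈ S.dom c, S.pt c y ∉ k → η c y = 0) :
    S.integral ρ univ η = ∑ c ∈ indices ρ hk, ∫ y in S.dom c, ρ c (S.pt c y) * η c y := by
  have e : S.integral ρ univ η = ∑ᶠ c, ∫ y in S.dom c, ρ c (S.pt c y) * η c y := by
    simp [integral]
  rw [e, finsum_eq_sum_of_support_subset]
  intro c hc
  by_contra hc'
  refine hc (setIntegral_eq_zero_of_forall_eq_zero fun y hy => ?_)
  by_cases hyk : S.pt c y ∈ k
  · have : ρ c (S.pt c y) = 0 := by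
      by_contra h
      exact hc' (mem_indices hyk h)
    rw [this, zero_mul]
  · rw [h0 c y hy hyk, mul_zero]

theorem integral_inter_eq_sum (hk : IsCompact k) :
    S.integral ρ k η =
      ∑ c ∈ indices ρ hk, ∫ y in S.dom c ∩ S.pt c ⁻¹' k, ρ c (S.pt c y) * η c y := by
  rw [integral, finsum_eq_sum_of_support_subset]
  intro c hc
  by_contra hc'
  refine hc (setIntegral_eq_zero_of_forall_eq_zero fun y hy => ?_)
  have : ρ c (S.pt c y) = 0 := by
    by_contra h
    exact hc' (mem_indices hy.2 h)
  rw [this, zero_mul]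

theorem integral_congr_ae {η' : M → E → ℝ} (h : ∀ c, ∀ᵐ y, y ∈ S.dom c → η c y = η' c y)
    [OpensMeasurableSpace E] : S.integral ρ univ η = S.integral ρ univ η' := by
  simp only [integral, preimage_univ, inter_univ]
  refine finsum_congr fun c => setIntegral_congr_ae (S.measurableSet_dom c) ?_
  filter_upwards [h c] with y hy hyc
  rw [hy hyc]

theorem integral_congr {η' : M → E → ℝ} (h : ∀ c, ∀ y ∈ S.dom c, η c y = η' c y)
    [OpensMeasurableSpace E] : S.integral ρ univ η = S.integral ρ univ η' :=
  integral_congr_ae fun c => Eventually.of_forall (h c)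

/-- A form vanishing almost everywhere outside `k` has the same integral over `k` as over the whole
space. -/
theorem integral_univ_eq
    (h0 : ∀ c, ∀ᵐ y, y ∈ S.dom c → S.pt c y ∉ k → η c y = 0) :
    S.integral ρ univ η = S.integral ρ k η := by
  refine finsum_congr fun c => ?_
  rw [preimage_univ, inter_univ]
  refine setIntegral_eq_of_subset_of_ae_sdiff_eq_zero
    (S.measurableSet_dom c).nullMeasurableSet inter_subset_left ?_
  filter_upwards [h0 c] with y hy hyd
  rw [hy hyd.1 fun h => hyd.2 ⟨hyd.1, h⟩, mul_zero]

section Compact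

variable [BorelSpace E] [(volume : Measure E).IsAddHaarMeasure]
  (hρ : ρ.IsSubordinate S.src)

include hρ

omit [BorelSpace E] [(volume : Measure E).IsAddHaarMeasure] in
theorem isCompact_inter_preimage (hk : IsCompact k) (c : M) :
    IsCompact (S.dom c ∩ S.pt c ⁻¹' (k ∩ tsupport (ρ c))) :=
  S.isCompact_preimage c _ (hk.inter_right (isClosed_tsupport _)) (inter_subset_right.trans (hρ c))

theorem integrableOn (hk : IsCompact k) (h : S.IsContFormOn k η) (c : M) :
    IntegrableOn (fun y => ρ c (S.pt c y) * η c y) (S.dom c) := by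
  have hc : ContinuousOn (fun y => ρ c (S.pt c y) * η c y) (S.dom c) :=
    ((ρ c).continuous.comp_continuousOn (S.continuousOn_pt c)).mul (h.continuousOn c)
  refine IntegrableOn.of_forall_sdiff_eq_zero (s := S.dom c ∩ S.pt c ⁻¹' (k ∩ tsupport (ρ c)))
    ((hc.mono inter_subset_left).integrableOn_compact (isCompact_inter_preimage hρ hk c))
    (S.measurableSet_dom c) fun y hy => ?_
  by_cases hyk : S.pt c y ∈ k
  · rw [image_eq_zero_of_notMem_tsupport fun h' => hy.2 ⟨hy.1, hyk, h'⟩, zero_mul]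
  · rw [h.eq_zero c y hy.1 hyk, mul_zero]

theorem integral_finset_sum {ι : Type*} (s : Finset ι) {η : ι → M → E → ℝ} (hk : IsCompact k)
    (h : ∀ i ∈ s, S.IsContFormOn k (η i)) :
    S.integral ρ univ (fun c y => ∑ i ∈ s, η i c y) = ∑ i ∈ s, S.integral ρ univ (η i) := by
  rw [integral_eq_sum hk fun c y hy hyk =>
    Finset.sum_eq_zero fun i hi => (h i hi).eq_zero c y hy hyk]
  rw [Finset.sum_congr rfl fun i hi => integral_eq_sum hk (h i hi).eq_zero,
    Finset.sum_comm]
  refine Finset.sum_congr rfl fun c _ => ?_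
  simp only [Finset.mul_sum]
  exact integral_finsetSum s fun i hi => integrableOn hρ hk (h i hi) c

theorem integral_add {η' : M → E → ℝ} (hk : IsCompact k)
    (h : S.IsContFormOn k η) (h' : S.IsContFormOn k η') :
    S.integral ρ univ (fun c y => η c y + η' c y)
      = S.integral ρ univ η + S.integral ρ univ η' := by
  have := integral_finset_sum hρ Finset.univ (η := ![η, η']) hk
    (fun i _ => by fin_cases i <;> assumption)
  simpa using this

omit hρ [BorelSpace E] [(volume : Measure E).IsAddHaarMeasure] in
theorem integral_const_mul (a : ℝ) :
    S.integral ρ univ (fun c y => a * η c y) = a * S.integral ρ univ η := by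
  simp only [integral, mul_left_comm _ a, MeasureTheory.integral_const_mul]
  exact (smul_finsum a _).symm

/-- The integral of a form with support in a single chart can be computed in this chart. -/
theorem integral_eq_setIntegral [FiniteDimensional ℝ E] {c₀ : M} (hk : IsCompact k)
    (hk₀ : k ⊆ S.src c₀) (h : S.IsContFormOn k η)
    (htrans : ∀ c, ∀ y ∈ S.dom c, S.pt c y ∈ S.src c₀ →
      η c y = (S.trans' c c₀ y).det * η c₀ (S.co c₀ (S.pt c y))) :
    S.integral ρ univ η = ∫ y in S.dom c₀, η c₀ y := by
  have hchart : ∀ c, ∫ y in S.dom c, ρ c (S.pt c y) * η c y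
      = ∫ z in S.dom c₀, ρ c (S.pt c₀ z) * η c₀ z := by
    intro c
    set A := S.dom c ∩ S.pt c ⁻¹' S.src c₀ with hA
    set B := S.dom c₀ ∩ S.pt c₀ ⁻¹' S.src c with hB
    have e1 : ∫ y in S.dom c, ρ c (S.pt c y) * η c y = ∫ y in A, ρ c (S.pt c y) * η c y :=
      setIntegral_eq_of_subset_of_forall_sdiff_eq_zero (S.measurableSet_dom c) inter_subset_left
        fun y hy => by
          rw [h.eq_zero c y hy.1 fun hyk => hy.2 ⟨hy.1, hk₀ hyk⟩, mul_zero]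
    have e2 : ∫ z in S.dom c₀, ρ c (S.pt c₀ z) * η c₀ z = ∫ z in B, ρ c (S.pt c₀ z) * η c₀ z :=
      setIntegral_eq_of_subset_of_forall_sdiff_eq_zero (S.measurableSet_dom c₀) inter_subset_left
        fun z hz => by
          rw [image_eq_zero_of_notMem_tsupport fun h' => hz.2 ⟨hz.1, hρ c h'⟩, zero_mul]
    have himg : (fun y => S.co c₀ (S.pt c y)) '' A = B := by
      ext z
      constructor
      · rintro ⟨y, ⟨hy, hyc⟩, rfl⟩
        refine ⟨S.co_mem c c₀ y hy hyc, ?_⟩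
        rw [mem_preimage, S.pt_co c c₀ y hy hyc]
        exact S.pt_mem c y hy
      · rintro ⟨hz, hzc⟩
        refine ⟨S.co c (S.pt c₀ z), ⟨S.co_mem c₀ c z hz hzc, ?_⟩, ?_⟩
        · rw [mem_preimage, S.pt_co c₀ c z hz hzc]
          exact S.pt_mem c₀ z hz
        · simp only
          rw [S.pt_co c₀ c z hz hzc, S.co_pt c₀ z hz]
    have hinj : InjOn (fun y => S.co c₀ (S.pt c y)) A := by
      rintro y ⟨hy, hyc⟩ y' ⟨hy', hyc'⟩ hyy'
      have := congrArg (S.pt c₀) hyy'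
      simp only [S.pt_co c c₀ y hy hyc, S.pt_co c c₀ y' hy' hyc'] at this
      rw [← S.co_pt c y hy, this, S.co_pt c y' hy']
    rw [e1, e2, ← himg, integral_image_eq_integral_abs_det_fderiv_smul volume
      (S.measurableSet_inter_preimage (S.isOpen_src c₀) c)
      (fun y hy => S.hasFDerivWithinAt c c₀ y hy.1 hy.2) hinj]
    refine setIntegral_congr_fun (S.measurableSet_inter_preimage (S.isOpen_src c₀) c) fun y hy => ?_
    simp only [smul_eq_mul]
    rw [abs_of_pos (S.det_pos c c₀ y hy.1 hy.2), S.pt_co c c₀ y hy.1 hy.2, htrans c y hy.1 hy.2]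
    ring
  rw [integral_eq_sum hk h.eq_zero, Finset.sum_congr rfl fun c _ => hchart c]
  have hint : ∀ c, IntegrableOn (fun z => ρ c (S.pt c₀ z) * η c₀ z) (S.dom c₀) := by
    intro c
    have hc : ContinuousOn (fun y => ρ c (S.pt c₀ y) * η c₀ y) (S.dom c₀) :=
      ((ρ c).continuous.comp_continuousOn (S.continuousOn_pt c₀)).mul (h.continuousOn c₀)
    refine IntegrableOn.of_forall_sdiff_eq_zero (s := S.dom c₀ ∩ S.pt c₀ ⁻¹' k)
      ((hc.mono inter_subset_left).integrableOn_compact (S.isCompact_preimage c₀ k hk hk₀))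
      (S.measurableSet_dom c₀) fun y hy => ?_
    rw [h.eq_zero c₀ y hy.1 fun h' => hy.2 ⟨hy.1, h'⟩, mul_zero]
  rw [← integral_finsetSum _ fun c _ => hint c]
  refine setIntegral_congr_fun (S.measurableSet_dom c₀) fun y hy => ?_
  simp only [← Finset.sum_mul]
  by_cases hyk : S.pt c₀ y ∈ k
  · rw [sum_indices hyk, one_mul]
  · rw [h.eq_zero c₀ y hy hyk, mul_zero]

/-- Differentiation under the integral sign over a compact part. -/
theorem hasDerivAt_integral [T2Space M] {η : ℝ → M → E → ℝ} (hk : IsCompact k)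
    (h : ∀ c, ContDiffOn ℝ ∞ (fun q : ℝ × E => η q.1 c q.2) (univ ×ˢ S.dom c)) :
    HasDerivAt (fun t => S.integral ρ k (η t))
      (S.integral ρ k (fun c y => deriv (fun t => η t c y) 0)) 0 := by
  simp only [integral_inter_eq_sum hk]
  refine HasDerivAt.fun_sum fun c _ => ?_
  set A := S.dom c ∩ S.pt c ⁻¹' (k ∩ tsupport (ρ c)) with hA
  have hAc : IsCompact A := isCompact_inter_preimage hρ hk c
  have hset : ∀ g : E → ℝ, ∫ y in S.dom c ∩ S.pt c ⁻¹' k, ρ c (S.pt c y) * g y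
      = ∫ y in A, ρ c (S.pt c y) * g y := fun g =>
    setIntegral_eq_of_subset_of_forall_sdiff_eq_zero
      (S.measurableSet_inter_preimage_of_isClosed hk.isClosed c)
      (inter_subset_inter_right _ (preimage_mono inter_subset_left)) fun y hy => by
        rw [image_eq_zero_of_notMem_tsupport fun h' => hy.2 ⟨hy.1.1, hy.1.2, h'⟩, zero_mul]
  simp only [hset]
  have hU : UniqueDiffOn ℝ (univ ×ˢ S.dom c : Set (ℝ × E)) :=
    uniqueDiffOn_univ.prod (S.uniqueDiffOn_dom c)
  have hderiv : ∀ t, ∀ y ∈ S.dom c, HasDerivAt (fun t => η t c y)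
      (fderivWithin ℝ (fun q : ℝ × E => η q.1 c q.2) (univ ×ˢ S.dom c) (t, y) (1, 0)) t := by
    intro t y hy
    have h1 := ((h c).differentiableOn (by simp) (t, y) ⟨mem_univ _, hy⟩).hasFDerivWithinAt
    have h2 : HasDerivWithinAt (fun t : ℝ => (t, y)) ((1 : ℝ), (0 : E)) univ t :=
      (hasDerivAt_id t).hasDerivWithinAt.prodMk (hasDerivWithinAt_const _ _ _)
    have hm : MapsTo (fun t : ℝ => (t, y)) univ (univ ×ˢ S.dom c : Set (ℝ × E)) :=
      fun r _ => ⟨mem_univ _, hy⟩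
    exact (h1.comp_hasDerivWithinAt t h2 hm).hasDerivAt univ_mem
  have hcont : ContinuousOn (fun q : ℝ × E =>
      fderivWithin ℝ (fun q : ℝ × E => η q.1 c q.2) (univ ×ˢ S.dom c) q (1, 0))
      (univ ×ˢ S.dom c) :=
    ((h c).continuousOn_fderivWithin hU (by simp)).clm_apply continuousOn_const
  have hw : ContinuousOn (fun y => ρ c (S.pt c y)) (S.dom c) :=
    (ρ c).continuous.comp_continuousOn (S.continuousOn_pt c)
  have hcont' : ContinuousOn (fun q : ℝ × E => ρ c (S.pt c q.2) *
      fderivWithin ℝ (fun q : ℝ × E => η q.1 c q.2) (univ ×ˢ S.dom c) q (1, 0))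
      (univ ×ˢ S.dom c) := by
    refine ContinuousOn.mul ?_ hcont
    exact ContinuousOn.comp (g := fun y => ρ c (S.pt c y)) hw continuousOn_snd fun q hq => hq.2
  obtain ⟨C, hC⟩ := ((isCompact_Icc (a := (-1 : ℝ)) (b := 1)).prod hAc).exists_bound_of_continuousOn
    (hcont'.mono (prod_mono (subset_univ _) inter_subset_left))
  have hslice : ∀ t : ℝ, ContinuousOn (fun y : E => (t, y)) (S.dom c) := fun t => by fun_prop
  have key := hasDerivAt_integral_of_dominated_loc_of_deriv_le (μ := volume.restrict A)
    (F := fun t y => ρ c (S.pt c y) * η t c y)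
    (F' := fun t y => ρ c (S.pt c y) *
      fderivWithin ℝ (fun q : ℝ × E => η q.1 c q.2) (univ ×ˢ S.dom c) (t, y) (1, 0))
    (x₀ := 0) (s := Icc (-1) 1) (bound := fun _ => C) (Icc_mem_nhds (by norm_num) (by norm_num))
    ?_ ?_ ?_ ?_ ?_ ?_
  · refine key.2.congr_deriv (setIntegral_congr_fun hAc.measurableSet fun y hy => ?_)
    simp only [(hderiv 0 y hy.1).deriv]
  · refine Eventually.of_forall fun t => ContinuousOn.aestronglyMeasurable ?_ hAc.measurableSet
    exact (hw.mul ((h c).continuousOn.comp (hslice t) fun y hy => ⟨mem_univ _, hy⟩)).mono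
      inter_subset_left
  · exact ((hw.mul ((h c).continuousOn.comp (hslice 0) fun y hy => ⟨mem_univ _, hy⟩)).mono
      inter_subset_left).integrableOn_compact hAc
  · exact ContinuousOn.aestronglyMeasurable ((hcont'.comp (hslice 0) fun y hy =>
      ⟨mem_univ _, hy⟩).mono inter_subset_left) hAc.measurableSet
  · refine (ae_restrict_iff' hAc.measurableSet).2 (Eventually.of_forall fun y hy t ht => ?_)
    exact hC (t, y) ⟨ht, hy⟩
  · exact integrableOn_const hAc.measure_lt_top.ne
  · refine (ae_restrict_iff' hAc.measurableSet).2 (Eventually.of_forall fun y hy t _ => ?_)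
    exact (hderiv t y hy.1).const_mul _

end Compact
end ChartSystem
end AdS

namespace AdS

/-! ### Jacobians in a system of charts -/

theorem det_eq_det_single {n : ℕ}
    (A : EuclideanSpace ℝ (Fin n) →L[ℝ] EuclideanSpace ℝ (Fin n)) :
    A.det = Matrix.det (Matrix.of fun i j => A (EuclideanSpace.single j 1) i) := by
  rw [ContinuousLinearMap.det,
    ← LinearMap.det_toMatrix (EuclideanSpace.basisFun (Fin n) ℝ).toBasis]
  congr 1

namespace ChartSystem

variable {M : Type*} [TopologicalSpace M] {n : ℕ} {S : ChartSystem M (EuclideanSpace ℝ (Fin n))}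

/-- The coefficient in the chart at `c` of the form `dh₁ ∧ ... ∧ dhₙ`. -/
noncomputable def jac (S : ChartSystem M (EuclideanSpace ℝ (Fin n))) (h : Fin n → M → ℝ) (c : M)
    (y : EuclideanSpace ℝ (Fin n)) : ℝ :=
  Matrix.det (Matrix.of fun i j =>
    fderivWithin ℝ (fun z => h i (S.pt c z)) (S.dom c) y (EuclideanSpace.single j 1))

/-- The function `h` is smooth in the charts of the system. -/
def IsSmooth {F : Type*} [NormedAddCommGroup F] [NormedSpace ℝ F]
    (S : ChartSystem M (EuclideanSpace ℝ (Fin n))) (h : M → F) : Prop :=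
  ∀ c, ContDiffOn ℝ ∞ (fun z => h (S.pt c z)) (S.dom c)

theorem jac_trans {h : Fin n → M → ℝ} (hh : ∀ i, S.IsSmooth (h i)) {c c₀ : M}
    {y : EuclideanSpace ℝ (Fin n)} (hy : y ∈ S.dom c) (hyc : S.pt c y ∈ S.src c₀) :
    S.jac h c y = (S.trans' c c₀ y).det * S.jac h c₀ (S.co c₀ (S.pt c y)) := by
  have hnhds : S.dom c ∩ S.pt c ⁻¹' S.src c₀ ∈ 𝓝[S.dom c] y :=
    inter_mem self_mem_nhdsWithin
      ((S.continuousOn_pt c) y hy ((S.isOpen_src c₀).mem_nhds hyc))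
  have hd : ∀ i, fderivWithin ℝ (fun z => h i (S.pt c z)) (S.dom c) y
      = (fderivWithin ℝ (fun z => h i (S.pt c₀ z)) (S.dom c₀) (S.co c₀ (S.pt c y))).comp
        (S.trans' c c₀ y) := by
    intro i
    have h1 := ((hh i c₀).differentiableOn (by simp) _ (S.co_mem c c₀ y hy hyc)).hasFDerivWithinAt
    have h2 := h1.comp y (S.hasFDerivWithinAt c c₀ y hy hyc)
      fun z hz => S.co_mem c c₀ z hz.1 hz.2
    have h3 := h2.congr (f₁ := fun z => h i (S.pt c z))
      (fun z hz => by simp [S.pt_co c c₀ z hz.1 hz.2]) (by simp [S.pt_co c c₀ y hy hyc])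
    exact (h3.mono_of_mem_nhdsWithin hnhds).fderivWithin (S.uniqueDiffOn_dom c y hy)
  rw [det_eq_det_single, mul_comm, jac, jac, ← Matrix.det_mul]
  congr 1
  ext i j
  simp only [Matrix.of_apply, hd, ContinuousLinearMap.comp_apply, Matrix.mul_apply]
  set L := fderivWithin ℝ (fun z => h i (S.pt c₀ z)) (S.dom c₀) (S.co c₀ (S.pt c y))
  set v := S.trans' c c₀ y (EuclideanSpace.single j 1)
  have hv : v = ∑ k, v k • EuclideanSpace.single k (1 : ℝ) := by
    have := (EuclideanSpace.basisFun (Fin n) ℝ).sum_repr v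
    simpa using this.symm
  conv_lhs => rw [hv]
  simp [mul_comm]

theorem IsSmooth.continuousOn_fderivWithin {h : M → ℝ} (hh : S.IsSmooth h) (c : M)
    (v : EuclideanSpace ℝ (Fin n)) :
    ContinuousOn (fun y => fderivWithin ℝ (fun z => h (S.pt c z)) (S.dom c) y v) (S.dom c) :=
  ((hh c).continuousOn_fderivWithin (S.uniqueDiffOn_dom c) (by simp)).clm_apply continuousOn_const

theorem continuousOn_jac {h : Fin n → M → ℝ} (hh : ∀ i, S.IsSmooth (h i)) (c : M) :
    ContinuousOn (S.jac h c) (S.dom c) := by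
  unfold jac
  simp only [Matrix.det_apply]
  refine continuousOn_finsetSum _ fun σ _ => ContinuousOn.const_smul ?_ _
  exact continuousOn_finsetProd _ fun i _ => (hh _).continuousOn_fderivWithin c _

/-- The form `dh₁ ∧ ... ∧ dhₙ` vanishes outside the support of each of the `hᵢ`. -/
theorem jac_eq_zero {h : Fin n → M → ℝ} {k : Set M} (hk : IsClosed k) {i : Fin n}
    (hi : ∀ p ∉ k, h i p = 0) {c : M} {y : EuclideanSpace ℝ (Fin n)} (hy : y ∈ S.dom c)
    (hyk : S.pt c y ∉ k) : S.jac h c y = 0 := by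
  have hev : (fun z => h i (S.pt c z)) =ᶠ[𝓝[S.dom c] y] fun _ => 0 := by
    filter_upwards [(S.continuousOn_pt c) y hy (hk.isOpen_compl.mem_nhds hyk)] with z hz
    exact hi _ hz
  refine Matrix.det_eq_zero_of_row_eq_zero i fun j => ?_
  rw [Matrix.of_apply, hev.fderivWithin_eq (by simp [hi _ hyk])]
  simp

end ChartSystem

/-! ### The charts of a manifold with boundary and of its boundary -/

section Charts

variable {M : Type*} [TopologicalSpace M] [ChartedSpace (EuclideanHalfSpace 3) M]

theorem extChartAt_target_eq (c : M) : (extChartAt (𝓡∂ 3) c).target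
    = ((𝓡∂ 3).symm ⁻¹' (chartAt (EuclideanHalfSpace 3) c).target) ∩ {y | 0 ≤ y 0} := by
  rw [extChartAt_target, range_modelWithCornersEuclideanHalfSpace]

theorem extChartAt_apply_zero_nonneg (c p : M) : 0 ≤ extChartAt (𝓡∂ 3) c p 0 := by
  have : extChartAt (𝓡∂ 3) c p ∈ range (𝓡∂ 3) := ⟨chartAt _ c p, rfl⟩
  rwa [range_modelWithCornersEuclideanHalfSpace] at this

theorem isOpen_preimage_chartAt_target (c : M) :
    IsOpen ((𝓡∂ 3).symm ⁻¹' (chartAt (EuclideanHalfSpace 3) c).target) :=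
  (chartAt (EuclideanHalfSpace 3) c).open_target.preimage (𝓡∂ 3).continuous_symm

theorem extChartAt_target_mem_nhdsWithin_range {c : M} {y : E3}
    (hy : y ∈ (extChartAt (𝓡∂ 3) c).target) :
    (extChartAt (𝓡∂ 3) c).target ∈ 𝓝[range (𝓡∂ 3)] y := by
  rw [extChartAt_target] at hy ⊢
  exact inter_mem (mem_nhdsWithin_of_mem_nhds ((isOpen_preimage_chartAt_target c).mem_nhds hy.1))
    self_mem_nhdsWithin

theorem extChartAt_target_mem_nhds_of_pos {c : M} {y : E3}
    (hy : y ∈ (extChartAt (𝓡∂ 3) c).target) (h0 : 0 < y 0) :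
    (extChartAt (𝓡∂ 3) c).target ∈ 𝓝 y := by
  rw [extChartAt_target_eq] at hy ⊢
  refine inter_mem ((isOpen_preimage_chartAt_target c).mem_nhds hy.1) ?_
  have : IsOpen {y : E3 | 0 < y 0} := isOpen_lt continuous_const (by fun_prop)
  exact mem_of_superset (this.mem_nhds h0) fun z (hz : 0 < z 0) => (show 0 ≤ z 0 from hz.le)

theorem fderivWithin_target {F : Type*} [NormedAddCommGroup F] [NormedSpace ℝ F] {c : M} {y : E3}
    (hy : y ∈ (extChartAt (𝓡∂ 3) c).target) (h : E3 → F) :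
    fderivWithin ℝ h (extChartAt (𝓡∂ 3) c).target y = fderivWithin ℝ h (range (𝓡∂ 3)) y :=
  fderivWithin_congr_set (eventuallyEq_set.2 (by
    have h1 := extChartAt_target_mem_nhdsWithin_range hy
    rw [mem_nhdsWithin_iff_eventually] at h1
    filter_upwards [h1] with z hz
    exact ⟨fun h => extChartAt_target_subset_range c h, hz⟩))

/-- The inclusion of the coordinate plane in the boundary of the half-space, as a linear map. -/
noncomputable def bdryEmbL : E2 →L[ℝ] E3 := LinearMap.toContinuousLinearMap
  { toFun := bdryEmb
    map_add' := fun s r => by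
      ext i; fin_cases i <;> simp [bdryEmb]
    map_smul' := fun a s => by
      ext i; fin_cases i <;> simp [bdryEmb] }

theorem bdryEmbL_apply (s : E2) : bdryEmbL s = bdryEmb s := rfl

/-- The projection of the half-space to the coordinate plane, as a linear map. -/
noncomputable def bdryProjL : E3 →L[ℝ] E2 := LinearMap.toContinuousLinearMap
  { toFun := fun y => WithLp.toLp 2 ![y 1, y 2]
    map_add' := fun s r => by
      ext i; fin_cases i <;> simp
    map_smul' := fun a s => by
      ext i; fin_cases i <;> simp }

theorem bdryProjL_apply (y : E3) : bdryProjL y = WithLp.toLp 2 ![y 1, y 2] := rfl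

theorem bdryProjL_bdryEmb (s : E2) : bdryProjL (bdryEmb s) = s := by
  ext i; fin_cases i <;> simp [bdryProjL_apply, bdryEmb]

theorem bdryEmb_bdryProjL {y : E3} (h : y 0 = 0) : bdryEmb (bdryProjL y) = y := by
  ext i; fin_cases i <;> simp [bdryProjL_apply, bdryEmb, h]

theorem bdryEmb_apply_zero (s : E2) : bdryEmb s 0 = 0 := by simp [bdryEmb]

theorem contDiff_bdryEmb : ContDiff ℝ ∞ bdryEmb := bdryEmbL.contDiff

theorem bdryEmb_single_zero : bdryEmb (EuclideanSpace.single 0 1) = EuclideanSpace.single 1 1 := by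
  ext i; fin_cases i <;> simp [bdryEmb]

theorem bdryEmb_single_one : bdryEmb (EuclideanSpace.single 1 1) = EuclideanSpace.single 2 1 := by
  ext i; fin_cases i <;> simp [bdryEmb]

theorem bdryEmb_mem_range (s : E2) : bdryEmb s ∈ range (𝓡∂ 3) := by
  rw [range_modelWithCornersEuclideanHalfSpace]
  simp [bdryEmb]

theorem isOpen_bdryDomain (c : M) : IsOpen (bdryDomain c) := by
  have : bdryDomain c =
      bdryEmb ⁻¹' ((𝓡∂ 3).symm ⁻¹' (chartAt (EuclideanHalfSpace 3) c).target) := by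
    ext s
    simp only [bdryDomain, extChartAt_target, mem_preimage, mem_inter_iff, bdryEmb_mem_range,
      and_true]
  rw [this]
  exact (isOpen_preimage_chartAt_target c).preimage contDiff_bdryEmb.continuous

theorem extChartAt_bdryPoint {c : M} {s : E2} (hs : s ∈ bdryDomain c) :
    extChartAt (𝓡∂ 3) c (bdryPoint c s) = bdryEmb s :=
  (extChartAt (𝓡∂ 3) c).right_inv hs

theorem bdryPoint_mem_source {c : M} {s : E2} (hs : s ∈ bdryDomain c) :
    bdryPoint c s ∈ (extChartAt (𝓡∂ 3) c).source :=
  (extChartAt (𝓡∂ 3) c).map_target hs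

variable [IsManifold (𝓡∂ 3) ∞ M]

/-- A point of the boundary has coordinates in the boundary of the half-space, in all charts. -/
theorem extChartAt_bdryPoint_zero {c c' : M} {s : E2} (hs : s ∈ bdryDomain c)
    (hc' : bdryPoint c s ∈ (extChartAt (𝓡∂ 3) c').source) :
    extChartAt (𝓡∂ 3) c' (bdryPoint c s) 0 = 0 := by
  by_contra hne
  have hpos : 0 < extChartAt (𝓡∂ 3) c' (bdryPoint c s) 0 :=
    lt_of_le_of_ne (extChartAt_apply_zero_nonneg _ _) (Ne.symm hne)
  have h1 := bdryPoint_mem_source hs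
  have key := (𝓡∂ 3).mem_interior_range_iff_of_mem_atlas (n := ∞) (by simp)
    (chart_mem_atlas (EuclideanHalfSpace 3) c) (chart_mem_atlas (EuclideanHalfSpace 3) c')
    (x := bdryPoint c s) (by rwa [extChartAt_source] at h1) (by rwa [extChartAt_source] at hc')
  have h2 : extChartAt (𝓡∂ 3) c' (bdryPoint c s) ∈ interior (extChartAt (𝓡∂ 3) c').target :=
    mem_interior_iff_mem_nhds.2 (extChartAt_target_mem_nhds_of_pos
      ((extChartAt (𝓡∂ 3) c').map_source hc') hpos)
  have h3 : extChartAt (𝓡∂ 3) c (bdryPoint c s) ∈ interior (extChartAt (𝓡∂ 3) c).target :=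
    key.2 h2
  have h4 := interior_mono (extChartAt_target_subset_range c) h3
  rw [interior_range_modelWithCornersEuclideanHalfSpace, extChartAt_bdryPoint hs] at h4
  simp [bdryEmb] at h4

/-- The preferred charts of an oriented manifold with boundary. -/
noncomputable def chartSystem (hM : IsOrientedAtlas M) : ChartSystem M E3 where
  dom c := (extChartAt (𝓡∂ 3) c).target
  pt c := (extChartAt (𝓡∂ 3) c).symm
  src c := (extChartAt (𝓡∂ 3) c).source
  co c := extChartAt (𝓡∂ 3) c
  trans' c c' y := fderivWithin ℝ (extChartAt (𝓡∂ 3) c' ∘ (extChartAt (𝓡∂ 3) c).symm)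
    (range (𝓡∂ 3)) y
  measurableSet_dom c := by
    rw [extChartAt_target]
    exact (isOpen_preimage_chartAt_target c).measurableSet.inter
      (𝓡∂ 3).isClosed_range.measurableSet
  uniqueDiffOn_dom c := uniqueDiffOn_extChartAt_target c
  isOpen_src c := isOpen_extChartAt_source c
  continuousOn_pt c := continuousOn_extChartAt_symm c
  pt_mem c y hy := (extChartAt (𝓡∂ 3) c).map_target hy
  co_pt c y hy := (extChartAt (𝓡∂ 3) c).right_inv hy
  co_mem c c' y _ hyc := (extChartAt (𝓡∂ 3) c').map_source hyc
  pt_co c c' y _ hyc := (extChartAt (𝓡∂ 3) c').left_inv hyc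
  isCompact_preimage c k hk hkc := by
    have : (extChartAt (𝓡∂ 3) c).target ∩ (extChartAt (𝓡∂ 3) c).symm ⁻¹' k
        = extChartAt (𝓡∂ 3) c '' k :=
      ((extChartAt (𝓡∂ 3) c).image_eq_target_inter_inv_preimage hkc).symm
    rw [this]
    exact hk.image_of_continuousOn ((continuousOn_extChartAt c).mono hkc)
  hasFDerivWithinAt c c' y hy hyc := by
    have h := contDiffWithinAt_ext_coord_change (I := 𝓡∂ 3) (n := ∞) c' c (y := y)
      (by simp only [PartialEquiv.trans_source, PartialEquiv.symm_source]; exact ⟨hy, hyc⟩)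
    exact (h.differentiableWithinAt (by simp)).hasFDerivWithinAt.mono
      (inter_subset_left.trans (extChartAt_target_subset_range c))
  det_pos c c' y hy hyc := hM c c' y hy hyc

/-- The transition maps between boundary charts have positive Jacobian. -/
theorem det_fderiv_bdry_pos (hM : IsOrientedAtlas M) {c c' : M} {s : E2} (hs : s ∈ bdryDomain c)
    (hc' : bdryPoint c s ∈ (extChartAt (𝓡∂ 3) c').source) :
    HasFDerivAt (fun r => bdryProjL (extChartAt (𝓡∂ 3) c' (bdryPoint c r)))
      (fderiv ℝ (fun r => bdryProjL (extChartAt (𝓡∂ 3) c' (bdryPoint c r))) s) s ∧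
    0 < (fderiv ℝ (fun r => bdryProjL (extChartAt (𝓡∂ 3) c' (bdryPoint c r))) s).det := by
  set ψ := extChartAt (𝓡∂ 3) c' ∘ (extChartAt (𝓡∂ 3) c).symm with hψ
  set D := fderivWithin ℝ ψ (range (𝓡∂ 3)) (bdryEmb s) with hD
  have hψd : HasFDerivWithinAt ψ D (range (𝓡∂ 3)) (bdryEmb s) :=
    ((contDiffWithinAt_ext_coord_change (I := 𝓡∂ 3) (n := ∞) c' c (y := bdryEmb s)
      (by simp only [PartialEquiv.trans_source, PartialEquiv.symm_source]
          exact ⟨hs, hc'⟩)).differentiableWithinAt (by simp)).hasFDerivWithinAt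
  have hcomp : HasFDerivAt (fun r => ψ (bdryEmb r)) (D.comp bdryEmbL) s := by
    have h2 : HasFDerivWithinAt bdryEmb bdryEmbL univ s := bdryEmbL.hasFDerivAt.hasFDerivWithinAt
    exact (hψd.comp s h2 fun r _ => bdryEmb_mem_range r).hasFDerivAt univ_mem
  have hθ : HasFDerivAt (fun r => bdryProjL (extChartAt (𝓡∂ 3) c' (bdryPoint c r)))
      (bdryProjL.comp (D.comp bdryEmbL)) s := bdryProjL.hasFDerivAt.comp s hcomp
  refine ⟨hθ.differentiableAt.hasFDerivAt, ?_⟩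
  rw [hθ.fderiv]
  have hdet : 0 < D.det := hM c c' (bdryEmb s) hs hc'
  have hval : ψ (bdryEmb s) 0 = 0 := extChartAt_bdryPoint_zero hs hc'
  -- the zeroth coordinate vanishes along the boundary
  have hz : ∀ v : E2, D (bdryEmb v) 0 = 0 := by
    intro v
    have h1 : HasFDerivAt (fun r => ψ (bdryEmb r) 0)
        ((EuclideanSpace.proj (0 : Fin 3)).comp (D.comp bdryEmbL)) s :=
      (EuclideanSpace.proj (𝕜 := ℝ) (0 : Fin 3)).hasFDerivAt.comp s hcomp
    have h2 : HasFDerivAt (fun r => ψ (bdryEmb r) 0) (0 : E2 →L[ℝ] ℝ) s := by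
      refine (hasFDerivAt_const (0 : ℝ) s).congr_of_eventuallyEq ?_
      have hcont : ContinuousAt (fun r => bdryPoint c r) s :=
        ((continuousOn_extChartAt_symm c).comp contDiff_bdryEmb.continuous.continuousOn
          fun r hr => hr).continuousAt ((isOpen_bdryDomain c).mem_nhds hs)
      filter_upwards [(isOpen_bdryDomain c).mem_nhds hs,
        hcont ((isOpen_extChartAt_source c').mem_nhds hc')] with r hr hrc
      exact extChartAt_bdryPoint_zero hr hrc
    have := congrArg (fun L : E2 →L[ℝ] ℝ => L v) (h1.unique h2)
    simpa [bdryEmbL_apply] using this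
  -- and it increases towards the interior
  have hnn : 0 ≤ D (EuclideanSpace.single 0 1) 0 := by
    have h1 : HasFDerivWithinAt (fun y => ψ y 0) ((EuclideanSpace.proj (0 : Fin 3)).comp D)
        (range (𝓡∂ 3)) (bdryEmb s) :=
      (EuclideanSpace.proj (𝕜 := ℝ) (0 : Fin 3)).hasFDerivAt.comp_hasFDerivWithinAt _ hψd
    have hmin : IsLocalMinOn (fun y => ψ y 0) (range (𝓡∂ 3)) (bdryEmb s) := by
      refine Eventually.of_forall fun y => ?_
      change ψ (bdryEmb s) 0 ≤ ψ y 0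
      rw [hval]
      exact extChartAt_apply_zero_nonneg _ _
    refine hmin.hasFDerivWithinAt_nonneg h1 (mem_posTangentConeAt_of_segment_subset ?_)
    intro y hy
    rw [segment_eq_image'] at hy
    obtain ⟨t, ht, rfl⟩ := hy
    rw [range_modelWithCornersEuclideanHalfSpace]
    simp [bdryEmb, ht.1]
  rw [det_eq_det_single, Matrix.det_fin_two]
  rw [det_eq_det_single, Matrix.det_fin_three] at hdet
  have h0 := hz (EuclideanSpace.single 0 1)
  have h1 := hz (EuclideanSpace.single 1 1)
  rw [bdryEmb_single_zero] at h0
  rw [bdryEmb_single_one] at h1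
  simp only [Matrix.of_apply, h0, h1, ContinuousLinearMap.comp_apply, bdryEmbL_apply,
    bdryEmb_single_zero, bdryEmb_single_one, bdryProjL_apply] at hdet ⊢
  simp only [Matrix.cons_val_zero, Matrix.cons_val_one]
  refine pos_of_mul_pos_right ?_ hnn
  linarith

/-- The charts of the boundary induced by the preferred charts. -/
noncomputable def bdryChartSystem (hM : IsOrientedAtlas M) : ChartSystem M E2 where
  dom := bdryDomain
  pt := bdryPoint
  src c := (extChartAt (𝓡∂ 3) c).source
  co c p := bdryProjL (extChartAt (𝓡∂ 3) c p)
  trans' c c' s := fderiv ℝ (fun r => bdryProjL (extChartAt (𝓡∂ 3) c' (bdryPoint c r))) s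
  measurableSet_dom c := (isOpen_bdryDomain c).measurableSet
  uniqueDiffOn_dom c := (isOpen_bdryDomain c).uniqueDiffOn
  isOpen_src c := isOpen_extChartAt_source c
  continuousOn_pt c := (continuousOn_extChartAt_symm c).comp
    contDiff_bdryEmb.continuous.continuousOn fun _ hr => hr
  pt_mem c s hs := bdryPoint_mem_source hs
  co_pt c s hs := by rw [extChartAt_bdryPoint hs, bdryProjL_bdryEmb]
  co_mem c c' s hs hc' := by
    rw [bdryDomain, mem_preimage, bdryEmb_bdryProjL (extChartAt_bdryPoint_zero hs hc')]
    exact (extChartAt (𝓡∂ 3) c').map_source hc'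
  pt_co c c' s hs hc' := by
    rw [bdryPoint.eq_1 c', bdryEmb_bdryProjL (extChartAt_bdryPoint_zero hs hc')]
    exact (extChartAt (𝓡∂ 3) c').left_inv hc'
  isCompact_preimage c k hk hkc := by
    have h1 : IsCompact ((extChartAt (𝓡∂ 3) c).target ∩ (extChartAt (𝓡∂ 3) c).symm ⁻¹' k) := by
      rw [← (extChartAt (𝓡∂ 3) c).image_eq_target_inter_inv_preimage hkc]
      exact hk.image_of_continuousOn ((continuousOn_extChartAt c).mono hkc)
    have h2 : Topology.IsClosedEmbedding bdryEmb :=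
      (Topology.IsClosedEmbedding.of_continuous_injective_isClosedMap contDiff_bdryEmb.continuous
        (Function.LeftInverse.injective bdryProjL_bdryEmb)
        (by
          intro A hA
          have : bdryEmb '' A = {y | y 0 = 0} ∩ bdryProjL ⁻¹' A := by
            ext y
            constructor
            · rintro ⟨s, hs, rfl⟩
              exact ⟨bdryEmb_apply_zero s, by rwa [mem_preimage, bdryProjL_bdryEmb]⟩
            · rintro ⟨h0, hy⟩
              exact ⟨_, hy, bdryEmb_bdryProjL h0⟩
          rw [this]
          exact (isClosed_eq (by fun_prop) continuous_const).inter
            (hA.preimage bdryProjL.continuous)))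
    exact h2.isCompact_preimage h1
  hasFDerivWithinAt c c' s hs hc' := (det_fderiv_bdry_pos hM hs hc').1.hasFDerivWithinAt
  det_pos c c' s hs hc' := (det_fderiv_bdry_pos hM hs hc').2

end Charts
end AdS

namespace AdS

/-! ### Stokes' theorem in the half-space -/

/-- The divergence theorem in the half-space, for a compactly supported vector field. -/
theorem integral_halfSpace_divergence {F : Fin 3 → E3 → ℝ} {G : E3 → ℝ} {R : ℝ} (hR : 0 < R)
    (hF : ∀ i, ContinuousOn (F i) {y | 0 ≤ y 0}) (hG : ContinuousOn G {y | 0 ≤ y 0})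
    (hF0 : ∀ i y, (∃ j, R ≤ |y j|) → F i y = 0) (hG0 : ∀ y, (∃ j, R ≤ |y j|) → G y = 0)
    (hd : ∀ i y, 0 < y 0 → DifferentiableAt ℝ (F i) y)
    (hdiv : ∀ y, 0 < y 0 → ∑ i, fderiv ℝ (F i) y (EuclideanSpace.single i 1) = G y) :
    ∫ y in {y : E3 | 0 ≤ y 0}, G y = - ∫ s, F 0 (bdryEmb s) := by
  have hle : (![0, -R, -R] : Fin 3 → ℝ) ≤ ![R, R, R] := by
    intro i; fin_cases i <;> simp [hR.le]
  set T : (Fin 3 → ℝ) →L[ℝ] E3 :=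
    (EuclideanSpace.equiv (Fin 3) ℝ).symm.toContinuousLinearMap with hT
  have hTa : ∀ x i, T x i = x i := fun x i => rfl
  have hTto : ∀ x, T x = WithLp.toLp 2 x := fun x => rfl
  have hTs : ∀ i, T (Pi.single i 1) = EuclideanSpace.single i 1 := fun i => by
    ext j; rw [hTa]; simp [Pi.single_apply]
  have hIcc : ∀ x ∈ Icc (![0, -R, -R] : Fin 3 → ℝ) ![R, R, R], T x ∈ {y : E3 | 0 ≤ y 0} :=
    fun x hx => hx.1 0
  have hmeas : MeasurableSet {y : E3 | 0 ≤ y 0} :=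
    (isClosed_le continuous_const (by fun_prop)).measurableSet
  have hae : ∀ᵐ x : Fin 3 → ℝ, x ∈ Icc (![0, -R, -R] : Fin 3 → ℝ) ![R, R, R] →
      ∑ i, (fderiv ℝ (F i) (T x)).comp T (Pi.single i 1) = G (T x) := by
    have h0 : ∀ᵐ x : Fin 3 → ℝ, x 0 ≠ 0 := by
      rw [volume_pi]
      exact Measure.ae_eval_ne (μ := fun _ : Fin 3 => (volume : Measure ℝ)) 0 0
    filter_upwards [h0] with x hx0 hx
    have hpos : 0 < T x 0 := lt_of_le_of_ne (hIcc x hx) (Ne.symm hx0)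
    rw [← hdiv _ hpos]
    simp only [ContinuousLinearMap.comp_apply, hTs]
  have hGint : IntegrableOn (fun x => G (T x)) (Icc (![0, -R, -R] : Fin 3 → ℝ) ![R, R, R]) :=
    (hG.comp T.continuous.continuousOn hIcc).integrableOn_compact isCompact_Icc
  have key := integral_divergence_of_hasFDerivAt_off_countable' (![0, -R, -R] : Fin 3 → ℝ)
    ![R, R, R] hle (fun i x => F i (T x)) (fun i x => (fderiv ℝ (F i) (T x)).comp T) ∅
    countable_empty (fun i => (hF i).comp T.continuous.continuousOn hIcc) (by
      rintro x ⟨hx, -⟩ i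
      have hx0 : 0 < T x 0 := (hx 0 (mem_univ _)).1
      exact (hd i _ hx0).hasFDerivAt.comp x T.hasFDerivAt)
    (hGint.congr_fun_ae (((ae_restrict_iff' measurableSet_Icc).2 hae).mono fun x hx => hx.symm))
  -- the left-hand side
  have hL : ∫ x in Icc (![0, -R, -R] : Fin 3 → ℝ) ![R, R, R],
      ∑ i, (fderiv ℝ (F i) (T x)).comp T (Pi.single i 1) = ∫ y in {y : E3 | 0 ≤ y 0}, G y := by
    rw [setIntegral_congr_ae measurableSet_Icc hae]
    have h1 := (PiLp.volume_preserving_toLp (Fin 3)).setIntegral_preimage_emb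
      (MeasurableEquiv.toLp 2 (Fin 3 → ℝ)).measurableEmbedding G {y : E3 | 0 ≤ y 0}
    rw [← h1]
    refine (setIntegral_eq_of_subset_of_forall_sdiff_eq_zero
      ((MeasurableEquiv.toLp 2 (Fin 3 → ℝ)).measurable hmeas) hIcc fun x hx => hG0 _ ?_).symm
    by_contra hcon
    push Not at hcon
    refine hx.2 ⟨fun i => ?_, fun i => ?_⟩
    · have hi := (abs_lt.1 (hcon i)).1
      fin_cases i
      · exact hx.1
      · exact hi.le
      · exact hi.le
    · have hi := (abs_lt.1 (hcon i)).2
      fin_cases i <;> exact hi.le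
  rw [hL] at key
  rw [key]
  have hfront : ∀ (i : Fin 3) (x : Fin 2 → ℝ),
      F i (T (i.insertNth ((![R, R, R] : Fin 3 → ℝ) i) x)) = 0 := by
    intro i x
    refine hF0 _ _ ⟨i, ?_⟩
    rw [hTa, Fin.insertNth_apply_same]
    fin_cases i <;> simp [abs_of_pos hR]
  have hback : ∀ (i : Fin 3) (x : Fin 2 → ℝ), i ≠ 0 →
      F i (T (i.insertNth ((![0, -R, -R] : Fin 3 → ℝ) i) x)) = 0 := by
    intro i x hi
    refine hF0 _ _ ⟨i, ?_⟩
    rw [hTa, Fin.insertNth_apply_same]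
    fin_cases i
    · exact absurd rfl hi
    · simp [abs_of_pos hR]
    · simp [abs_of_pos hR]
  simp only [hfront, integral_zero, zero_sub]
  rw [Fin.sum_univ_three]
  simp only [hback 1 _ (by decide), hback 2 _ (by decide), integral_zero, neg_zero, add_zero]
  congr 1
  rw [← (PiLp.volume_preserving_toLp (Fin 2)).integral_comp
    (MeasurableEquiv.toLp 2 (Fin 2 → ℝ)).measurableEmbedding]
  have hface : ∀ x : Fin 2 → ℝ,
      T ((0 : Fin 3).insertNth ((![0, -R, -R] : Fin 3 → ℝ) 0) x) = bdryEmb (WithLp.toLp 2 x) := by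
    intro x
    ext j
    rw [hTa]
    fin_cases j
    · simp [bdryEmb]
    · simp [bdryEmb]
    · simp [bdryEmb]; rfl
  simp only [hface]
  refine setIntegral_eq_integral_of_forall_compl_eq_zero fun x hx => hF0 _ _ ?_
  by_contra hcon
  push Not at hcon
  refine hx ⟨fun i => ?_, fun i => ?_⟩
  · fin_cases i
    · exact (abs_lt.1 (hcon 1)).1.le
    · exact (abs_lt.1 (hcon 2)).1.le
  · fin_cases i
    · exact (abs_lt.1 (hcon 1)).2.le
    · exact (abs_lt.1 (hcon 2)).2.le

/-- The `i`-th component of the vector field whose divergence is the Jacobian of `a, b, c`, namely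
`a` times a minor of the derivatives of `b, c`. -/
noncomputable def minorField (T : Set E3) (a b c : E3 → ℝ) (i : Fin 3) (y : E3) : ℝ :=
  a y * (fderivWithin ℝ b T y (EuclideanSpace.single (i + 1) 1)
      * fderivWithin ℝ c T y (EuclideanSpace.single (i + 2) 1)
    - fderivWithin ℝ b T y (EuclideanSpace.single (i + 2) 1)
      * fderivWithin ℝ c T y (EuclideanSpace.single (i + 1) 1))

theorem sum_fderiv_minorField {T : Set E3} {a b c : E3 → ℝ} {y : E3} (hT : T ∈ 𝓝 y)
    (ha : ContDiffAt ℝ ∞ a y) (hb : ContDiffAt ℝ ∞ b y) (hc : ContDiffAt ℝ ∞ c y) :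
    (∀ i, DifferentiableAt ℝ (minorField T a b c i) y) ∧
    ∑ i, fderiv ℝ (minorField T a b c i) y (EuclideanSpace.single i 1) =
      Matrix.det (Matrix.of fun i j : Fin 3 =>
        fderivWithin ℝ (![a, b, c] i) T y (EuclideanSpace.single j 1)) := by
  have hev : ∀ i, minorField T a b c i =ᶠ[𝓝 y] fun z =>
      a z * (fderiv ℝ b z (EuclideanSpace.single (i + 1) 1)
        * fderiv ℝ c z (EuclideanSpace.single (i + 2) 1)
      - fderiv ℝ b z (EuclideanSpace.single (i + 2) 1)
        * fderiv ℝ c z (EuclideanSpace.single (i + 1) 1)) := by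
    intro i
    filter_upwards [eventually_mem_nhds_iff.2 hT] with z hz
    simp only [minorField, fderivWithin_of_mem_nhds hz]
  have hd : ∀ {h : E3 → ℝ}, ContDiffAt ℝ ∞ h y → ∀ j, HasFDerivAt
      (fun z => fderiv ℝ h z (EuclideanSpace.single j 1))
      ((fderiv ℝ (fderiv ℝ h) y).flip (EuclideanSpace.single j 1)) y := by
    intro h hh j
    have h1 : HasFDerivAt (fderiv ℝ h) (fderiv ℝ (fderiv ℝ h) y) y :=
      ((hh.fderiv_right (m := 1) (by norm_cast)).differentiableAt (by simp)).hasFDerivAt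
    have h2 := h1.clm_apply (hasFDerivAt_const (EuclideanSpace.single j (1 : ℝ)) y)
    refine h2.congr_fderiv ?_
    ext v; simp
  have hs : ∀ {h : E3 → ℝ}, ContDiffAt ℝ ∞ h y → ∀ v w,
      fderiv ℝ (fderiv ℝ h) y v w = fderiv ℝ (fderiv ℝ h) y w v := fun hh v w =>
    hh.isSymmSndFDerivAt (by
      simp only [minSmoothness_of_isRCLikeNormedField]; exact ENat.LEInfty.out) v w
  have hda := (ha.differentiableAt (by simp)).hasFDerivAt
  have hm := fun i : Fin 3 => (hda.mul (((hd hb (i + 1)).mul (hd hc (i + 2))).sub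
    ((hd hb (i + 2)).mul (hd hc (i + 1))))).congr_of_eventuallyEq (hev i)
  refine ⟨fun i => (hm i).differentiableAt, ?_⟩
  simp only [fun i => (hm i).fderiv]
  rw [Fin.sum_univ_three, Matrix.det_fin_three]
  simp only [Matrix.of_apply, fderivWithin_of_mem_nhds hT, Matrix.cons_val_zero,
    Matrix.cons_val_one, Matrix.cons_val, add_apply,
    sub_apply, smul_apply, ContinuousLinearMap.flip_apply,
    smul_eq_mul, zero_add, show (1 : Fin 3) + 1 = 2 from rfl, show (1 : Fin 3) + 2 = 0 from rfl,
    show (2 : Fin 3) + 1 = 0 from rfl, show (2 : Fin 3) + 2 = 1 from rfl, Pi.mul_apply,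
    Pi.sub_apply]
  rw [hs hb (EuclideanSpace.single 1 1) (EuclideanSpace.single 0 1),
    hs hb (EuclideanSpace.single 2 1) (EuclideanSpace.single 0 1),
    hs hb (EuclideanSpace.single 2 1) (EuclideanSpace.single 1 1),
    hs hc (EuclideanSpace.single 1 1) (EuclideanSpace.single 0 1),
    hs hc (EuclideanSpace.single 2 1) (EuclideanSpace.single 0 1),
    hs hc (EuclideanSpace.single 2 1) (EuclideanSpace.single 1 1)]
  ring

/-- Stokes' theorem for `a db ∧ dc` in the half-space. -/
theorem integral_halfSpace_jac {T V k : Set E3} (hV : IsOpen V) (hT : T = V ∩ {y | 0 ≤ y 0})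
    {a b c : E3 → ℝ} (ha : ContDiffOn ℝ ∞ a T) (hb : ContDiffOn ℝ ∞ b T) (hc : ContDiffOn ℝ ∞ c T)
    (hU : UniqueDiffOn ℝ T) (hk : IsCompact k) (hkT : k ⊆ T) (hak : ∀ y ∈ T, y ∉ k → a y = 0) :
    ∫ y in T, Matrix.det (Matrix.of fun i j : Fin 3 =>
        fderivWithin ℝ (![a, b, c] i) T y (EuclideanSpace.single j 1))
      = - ∫ s in bdryEmb ⁻¹' T, minorField T a b c 0 (bdryEmb s) := by
  classical
  set J : E3 → ℝ := fun y => Matrix.det (Matrix.of fun i j : Fin 3 =>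
        fderivWithin ℝ (![a, b, c] i) T y (EuclideanSpace.single j 1)) with hJ
  have hTn : ∀ y ∈ T, T ∈ 𝓝[{y | 0 ≤ y 0}] y := fun y hy => by
    rw [hT] at hy ⊢
    exact inter_mem (mem_nhdsWithin_of_mem_nhds (hV.mem_nhds hy.1)) self_mem_nhdsWithin
  have hTsub : T ⊆ {y | 0 ≤ y 0} := by rw [hT]; exact inter_subset_right
  have hTpos : ∀ y ∈ T, 0 < y 0 → T ∈ 𝓝 y := fun y hy h0 => by
    rw [hT] at hy ⊢
    refine inter_mem (hV.mem_nhds hy.1) ?_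
    have : IsOpen {y : E3 | 0 < y 0} := isOpen_lt continuous_const (by fun_prop)
    exact mem_of_superset (this.mem_nhds h0) fun z (hz : 0 < z 0) => (show 0 ≤ z 0 from hz.le)
  have hder : ∀ {h : E3 → ℝ}, ContDiffOn ℝ ∞ h T → ∀ v,
      ContinuousOn (fun y => fderivWithin ℝ h T y v) T := fun hh v =>
    (hh.continuousOn_fderivWithin hU (by simp)).clm_apply continuousOn_const
  have hmc : ∀ i, ContinuousOn (minorField T a b c i) T := fun i =>
    ha.continuousOn.mul (((hder hb _).mul (hder hc _)).sub ((hder hb _).mul (hder hc _)))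
  have hJc : ContinuousOn J T := by
    simp only [hJ, Matrix.det_fin_three, Matrix.of_apply, Matrix.cons_val_zero,
      Matrix.cons_val_one, Matrix.cons_val]
    have h1 := fun j : Fin 3 => hder ha (EuclideanSpace.single j 1)
    have h2 := fun j : Fin 3 => hder hb (EuclideanSpace.single j 1)
    have h3 := fun j : Fin 3 => hder hc (EuclideanSpace.single j 1)
    exact ((((((h1 0).mul (h2 1)).mul (h3 2)).sub (((h1 0).mul (h2 2)).mul (h3 1))).sub
      (((h1 1).mul (h2 0)).mul (h3 2))).add (((h1 1).mul (h2 2)).mul (h3 0))).add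
      (((h1 2).mul (h2 0)).mul (h3 1)) |>.sub (((h1 2).mul (h2 1)).mul (h3 0))
  have hJ0 : ∀ y ∈ T, y ∉ k → J y = 0 := by
    intro y hy hyk
    refine Matrix.det_eq_zero_of_row_eq_zero 0 fun j => ?_
    have hev : a =ᶠ[𝓝[T] y] fun _ => 0 := by
      filter_upwards [self_mem_nhdsWithin,
        mem_nhdsWithin_of_mem_nhds (hk.isClosed.isOpen_compl.mem_nhds hyk)] with z hz hzk
      exact hak z hz hzk
    simp only [Matrix.of_apply, Matrix.cons_val_zero]
    rw [hev.fderivWithin_eq (hak y hy hyk)]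
    simp
  have hm0 : ∀ i, ∀ y ∈ T, y ∉ k → minorField T a b c i y = 0 := fun i y hy hyk => by
    rw [minorField, hak y hy hyk, zero_mul]
  -- extension by zero
  have hext : ∀ {h : E3 → ℝ}, ContinuousOn h T → (∀ y ∈ T, y ∉ k → h y = 0) →
      ContinuousOn (T.indicator h) {y | 0 ≤ y 0} := by
    intro h hh h0 y hy
    by_cases hyT : y ∈ T
    · refine ((hh y hyT).mono_of_mem_nhdsWithin (hTn y hyT)).congr_of_eventuallyEq ?_
        (indicator_of_mem hyT h)
      filter_upwards [hTn y hyT] with z hz using indicator_of_mem hz h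
    · have hyk : y ∉ k := fun h' => hyT (hkT h')
      refine continuousWithinAt_const (b := (0 : ℝ)) |>.congr_of_eventuallyEq ?_
        (indicator_of_notMem hyT h)
      filter_upwards [mem_nhdsWithin_of_mem_nhds (hk.isClosed.isOpen_compl.mem_nhds hyk)] with z hz
      by_cases hzT : z ∈ T
      · rw [indicator_of_mem hzT, h0 z hzT hz]
      · exact indicator_of_notMem hzT h
  obtain ⟨R, hRpos, hR⟩ : ∃ R, 0 < R ∧ ∀ y ∈ k, ∀ j, |y j| < R := by
    obtain ⟨R, hR⟩ := hk.isBounded.exists_norm_le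
    refine ⟨|R| + 1, by positivity, fun y hy j => ?_⟩
    have h1 : ‖y j‖ ≤ ‖y‖ := PiLp.norm_apply_le y j
    have h2 := hR y hy
    rw [Real.norm_eq_abs] at h1
    have := le_abs_self R
    linarith
  have hout : ∀ {h : E3 → ℝ}, (∀ y ∈ T, y ∉ k → h y = 0) → ∀ y, (∃ j, R ≤ |y j|) →
      T.indicator h y = 0 := by
    rintro h h0 y ⟨j, hj⟩
    by_cases hyT : y ∈ T
    · rw [indicator_of_mem hyT]
      exact h0 y hyT fun hyk => absurd (hR y hyk j) (not_lt.2 hj)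
    · exact indicator_of_notMem hyT h
  have hzero : ∀ {h : E3 → ℝ}, (∀ y ∈ T, y ∉ k → h y = 0) → ∀ y ∉ T,
      T.indicator h =ᶠ[𝓝 y] fun _ => 0 := by
    intro h h0 y hyT
    have hyk : y ∉ k := fun h' => hyT (hkT h')
    filter_upwards [hk.isClosed.isOpen_compl.mem_nhds hyk] with z hz
    by_cases hzT : z ∈ T
    · rw [indicator_of_mem hzT, h0 z hzT hz]
    · exact indicator_of_notMem hzT h
  have hin : ∀ {h : E3 → ℝ} {y : E3}, y ∈ T → 0 < y 0 → T.indicator h =ᶠ[𝓝 y] h := by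
    intro h y hy h0
    filter_upwards [hTpos y hy h0] with z hz using indicator_of_mem hz h
  have key := integral_halfSpace_divergence (F := fun i => T.indicator (minorField T a b c i))
    (G := T.indicator J) hRpos (fun i => hext (hmc i) (hm0 i)) (hext hJc hJ0)
    (fun i => hout (hm0 i)) (hout hJ0) ?_ ?_
  · have hmeasT : MeasurableSet T := by
      rw [hT]
      exact hV.measurableSet.inter (isClosed_le continuous_const (by fun_prop)).measurableSet
    rw [setIntegral_indicator hmeasT, inter_eq_self_of_subset_right hTsub] at key
    rw [key, ← integral_indicator (contDiff_bdryEmb.continuous.measurable hmeasT)]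
    rfl
  · intro i y h0
    by_cases hyT : y ∈ T
    · have hn := hTpos y hyT h0
      exact ((sum_fderiv_minorField hn (ha.contDiffAt hn) (hb.contDiffAt hn)
        (hc.contDiffAt hn)).1 i).congr_of_eventuallyEq (hin hyT h0)
    · exact (differentiableAt_const (0 : ℝ)).congr_of_eventuallyEq (hzero (hm0 i) y hyT)
  · intro y h0
    by_cases hyT : y ∈ T
    · have hn := hTpos y hyT h0
      rw [indicator_of_mem hyT]
      simp only [hJ]
      rw [← (sum_fderiv_minorField hn (ha.contDiffAt hn) (hb.contDiffAt hn)
        (hc.contDiffAt hn)).2]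
      simp only [(hin hyT h0).fderiv_eq]
    · rw [indicator_of_notMem hyT]
      refine Finset.sum_eq_zero fun i _ => ?_
      rw [(hzero (hm0 i) y hyT).fderiv_eq]
      simp

end AdS

namespace AdS

/-! ### Stokes' theorem on a manifold with boundary -/

section Stokes

variable {M : Type*} [TopologicalSpace M] [ChartedSpace (EuclideanHalfSpace 3) M]
  [IsManifold (𝓡∂ 3) ∞ M]

theorem contDiffOn_comp_extChartAt_symm {F : Type*} [NormedAddCommGroup F] [NormedSpace ℝ F]
    {h : M → F} (hh : ContMDiff (𝓡∂ 3) 𝓘(ℝ, F) ∞ h) (c : M) :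
    ContDiffOn ℝ ∞ (fun y => h ((extChartAt (𝓡∂ 3) c).symm y)) (extChartAt (𝓡∂ 3) c).target :=
  contMDiffOn_iff_contDiffOn.1 (hh.comp_contMDiffOn (contMDiffOn_extChartAt_symm c))

theorem contDiffOn_comp_bdryPoint {F : Type*} [NormedAddCommGroup F] [NormedSpace ℝ F]
    {h : M → F} (hh : ContMDiff (𝓡∂ 3) 𝓘(ℝ, F) ∞ h) (c : M) :
    ContDiffOn ℝ ∞ (fun s => h (bdryPoint c s)) (bdryDomain c) :=
  (contDiffOn_comp_extChartAt_symm hh c).comp contDiff_bdryEmb.contDiffOn fun _ hs => hs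

variable (hM : IsOrientedAtlas M)

theorem isSmooth_chartSystem {F : Type*} [NormedAddCommGroup F] [NormedSpace ℝ F]
    {h : M → F} (hh : ContMDiff (𝓡∂ 3) 𝓘(ℝ, F) ∞ h) : (chartSystem hM).IsSmooth h :=
  contDiffOn_comp_extChartAt_symm hh

theorem isSmooth_bdryChartSystem {F : Type*} [NormedAddCommGroup F] [NormedSpace ℝ F]
    {h : M → F} (hh : ContMDiff (𝓡∂ 3) 𝓘(ℝ, F) ∞ h) : (bdryChartSystem hM).IsSmooth h :=
  contDiffOn_comp_bdryPoint hh

theorem jac_bdryChartSystem (B C : M → ℝ) {c : M} {s : E2} (hs : s ∈ bdryDomain c) :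
    (bdryChartSystem hM).jac ![B, C] c s
      = pd 0 (fun r => B (bdryPoint c r)) s * pd 1 (fun r => C (bdryPoint c r)) s
        - pd 1 (fun r => B (bdryPoint c r)) s * pd 0 (fun r => C (bdryPoint c r)) s := by
  have hn : bdryDomain c ∈ 𝓝 s := (isOpen_bdryDomain c).mem_nhds hs
  simp only [ChartSystem.jac, bdryChartSystem, Matrix.det_fin_two, Matrix.of_apply,
    Matrix.cons_val_zero, Matrix.cons_val_one, fderivWithin_of_mem_nhds hn, pd]

theorem pd_comp_bdryPoint {F : Type*} [NormedAddCommGroup F] [NormedSpace ℝ F]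
    {h : M → F} (hh : ContMDiff (𝓡∂ 3) 𝓘(ℝ, F) ∞ h) {c : M} {s : E2} (hs : s ∈ bdryDomain c)
    (i : Fin 2) : pd i (fun r => h (bdryPoint c r)) s
      = fderivWithin ℝ (fun y => h ((extChartAt (𝓡∂ 3) c).symm y)) (extChartAt (𝓡∂ 3) c).target
        (bdryEmb s) (bdryEmb (EuclideanSpace.single i 1)) := by
  have h1 := ((contDiffOn_comp_extChartAt_symm hh c).differentiableOn (by simp)
    (bdryEmb s) hs).hasFDerivWithinAt
  have h2 : HasFDerivWithinAt bdryEmb bdryEmbL (bdryDomain c) s :=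
    bdryEmbL.hasFDerivAt.hasFDerivWithinAt
  have h3 := (h1.comp s h2 fun r hr => hr).hasFDerivAt ((isOpen_bdryDomain c).mem_nhds hs)
  have h4 : HasFDerivAt (fun r => h (bdryPoint c r)) _ s := h3
  rw [pd, h4.fderiv]
  rfl

theorem isContFormOn_mul_jac {k : Set M} {A B C : M → ℝ}
    (hA : ContMDiff (𝓡∂ 3) 𝓘(ℝ) ∞ A) (hB : ContMDiff (𝓡∂ 3) 𝓘(ℝ) ∞ B)
    (hC : ContMDiff (𝓡∂ 3) 𝓘(ℝ) ∞ C) (hA0 : ∀ p ∉ k, A p = 0) :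
    (bdryChartSystem hM).IsContFormOn k
      (fun c s => A (bdryPoint c s) * (bdryChartSystem hM).jac ![B, C] c s) where
  continuousOn c := ((isSmooth_bdryChartSystem hM hA) c).continuousOn.mul
    (ChartSystem.continuousOn_jac (fun i => by
      fin_cases i
      exacts [isSmooth_bdryChartSystem hM hB, isSmooth_bdryChartSystem hM hC]) c)
  eq_zero c s hs hk := by
    have : A (bdryPoint c s) = 0 := hA0 _ hk
    rw [this, zero_mul]

/-- Stokes' theorem for `A dB ∧ dC`, where the support of `A` lies in a single chart. -/
theorem integral_jac_of_tsupport_subset [T2Space M] {ρ : PartitionOfUnity M M univ}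
    (hρ : ρ.IsSubordinate fun c => (extChartAt (𝓡∂ 3) c).source) {A B C : M → ℝ}
    (hA : ContMDiff (𝓡∂ 3) 𝓘(ℝ) ∞ A) (hB : ContMDiff (𝓡∂ 3) 𝓘(ℝ) ∞ B)
    (hC : ContMDiff (𝓡∂ 3) 𝓘(ℝ) ∞ C) (hAc : HasCompactSupport A) {c₀ : M}
    (hAs : tsupport A ⊆ (extChartAt (𝓡∂ 3) c₀).source) :
    (chartSystem hM).integral ρ univ ((chartSystem hM).jac ![A, B, C])
      = - (bdryChartSystem hM).integral ρ univ
        (fun c s => A (bdryPoint c s) * (bdryChartSystem hM).jac ![B, C] c s) := by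
  have hA0 : ∀ p ∉ tsupport A, A p = 0 := fun p hp => image_eq_zero_of_notMem_tsupport hp
  have hsm : ∀ i, (chartSystem hM).IsSmooth ((![A, B, C] : Fin 3 → M → ℝ) i) := fun i => by
    fin_cases i
    exacts [isSmooth_chartSystem hM hA, isSmooth_chartSystem hM hB, isSmooth_chartSystem hM hC]
  have hsm' : ∀ i, (bdryChartSystem hM).IsSmooth ((![B, C] : Fin 2 → M → ℝ) i) := fun i => by
    fin_cases i
    exacts [isSmooth_bdryChartSystem hM hB, isSmooth_bdryChartSystem hM hC]
  rw [ChartSystem.integral_eq_setIntegral (c₀ := c₀) hρ hAc hAs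
    ⟨fun c => ChartSystem.continuousOn_jac hsm c, fun c y hy hyk =>
      ChartSystem.jac_eq_zero (isClosed_tsupport A) (i := 0) hA0 hy hyk⟩
    (fun c y hy hyc => ChartSystem.jac_trans hsm hy hyc),
    ChartSystem.integral_eq_setIntegral (c₀ := c₀) hρ hAc hAs
    (isContFormOn_mul_jac hM hA hB hC hA0)
    (fun c y hy hyc => by
      rw [ChartSystem.jac_trans hsm' hy hyc]
      have : bdryPoint c₀ ((bdryChartSystem hM).co c₀ ((bdryChartSystem hM).pt c y))
        = bdryPoint c y := (bdryChartSystem hM).pt_co c c₀ y hy hyc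
      rw [this]
      ring)]
  have key := integral_halfSpace_jac (isOpen_preimage_chartAt_target c₀) (extChartAt_target_eq c₀)
    (isSmooth_chartSystem hM hA c₀) (isSmooth_chartSystem hM hB c₀)
    (isSmooth_chartSystem hM hC c₀) (uniqueDiffOn_extChartAt_target c₀)
    ((chartSystem hM).isCompact_preimage c₀ _ hAc hAs) inter_subset_left
    (fun y hy hyk => hA0 _ fun h => hyk ⟨hy, h⟩)
  have e1 : ∫ y in (chartSystem hM).dom c₀, (chartSystem hM).jac ![A, B, C] c₀ y
      = - ∫ s in bdryEmb ⁻¹' (extChartAt (𝓡∂ 3) c₀).target,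
        minorField (extChartAt (𝓡∂ 3) c₀).target (fun z => A ((extChartAt (𝓡∂ 3) c₀).symm z))
          (fun z => B ((extChartAt (𝓡∂ 3) c₀).symm z)) (fun z => C ((extChartAt (𝓡∂ 3) c₀).symm z))
          0 (bdryEmb s) := by
    refine Eq.trans ?_ key
    refine setIntegral_congr_fun ((chartSystem hM).measurableSet_dom c₀) fun y _ => ?_
    simp only [ChartSystem.jac]
    congr 1
    ext i j
    fin_cases i <;> rfl
  rw [e1]
  congr 1
  refine setIntegral_congr_fun (isOpen_bdryDomain c₀).measurableSet fun s hs => ?_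
  simp only [minorField]
  rw [jac_bdryChartSystem hM B C hs, pd_comp_bdryPoint hB hs, pd_comp_bdryPoint hC hs,
    pd_comp_bdryPoint hB hs, pd_comp_bdryPoint hC hs, bdryEmb_single_zero, bdryEmb_single_one]
  rfl

/-- Stokes' theorem for `A dB ∧ dC`, where `A` has compact support: the partition of unity reduces
it to the case of a support in a single chart. -/
theorem integral_jac [T2Space M] {ρ : PartitionOfUnity M M univ}
    (hρ : ρ.IsSubordinate fun c => (extChartAt (𝓡∂ 3) c).source)
    (hρs : ∀ c, ContMDiff (𝓡∂ 3) 𝓘(ℝ) ∞ (ρ c)) {A B C : M → ℝ}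
    (hA : ContMDiff (𝓡∂ 3) 𝓘(ℝ) ∞ A) (hB : ContMDiff (𝓡∂ 3) 𝓘(ℝ) ∞ B)
    (hC : ContMDiff (𝓡∂ 3) 𝓘(ℝ) ∞ C) (hAc : HasCompactSupport A) :
    (chartSystem hM).integral ρ univ ((chartSystem hM).jac ![A, B, C])
      = - (bdryChartSystem hM).integral ρ univ
        (fun c s => A (bdryPoint c s) * (bdryChartSystem hM).jac ![B, C] c s) := by
  have hk : IsCompact (tsupport A) := hAc
  have hρA : ∀ c, ContMDiff (𝓡∂ 3) 𝓘(ℝ) ∞ (fun p => ρ c p * A p) := fun c => (hρs c).mul hA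
  have hA0 : ∀ p ∉ tsupport A, A p = 0 := fun p hp => image_eq_zero_of_notMem_tsupport hp
  have hρA0 : ∀ c, ∀ p ∉ tsupport A, ρ c p * A p = 0 := fun c p hp => by rw [hA0 p hp, mul_zero]
  have hsum : ∀ p, A p = ∑ c ∈ ChartSystem.indices ρ hk, ρ c p * A p := by
    intro p
    rw [← Finset.sum_mul]
    by_cases hp : p ∈ tsupport A
    · rw [ChartSystem.sum_indices hp, one_mul]
    · rw [hA0 p hp, mul_zero]
  have hsm : ∀ c i, (chartSystem hM).IsSmooth ((![fun p => ρ c p * A p, B, C] : Fin 3 → M → ℝ) i) :=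
    fun c i => by
      fin_cases i
      exacts [isSmooth_chartSystem hM (hρA c), isSmooth_chartSystem hM hB,
        isSmooth_chartSystem hM hC]
  have hL : (chartSystem hM).integral ρ univ ((chartSystem hM).jac ![A, B, C])
      = ∑ c' ∈ ChartSystem.indices ρ hk, (chartSystem hM).integral ρ univ
        ((chartSystem hM).jac ![fun p => ρ c' p * A p, B, C]) := by
    rw [← ChartSystem.integral_finset_sum hρ _ hk fun c' _ =>
      ⟨fun c => ChartSystem.continuousOn_jac (hsm c') c, fun c y hy hyk =>
        ChartSystem.jac_eq_zero hk.isClosed (i := 0) (hρA0 c') hy hyk⟩]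
    refine ChartSystem.integral_congr fun c y hy => ?_
    have hd : ∀ c', DifferentiableWithinAt ℝ (fun z => ρ c' ((chartSystem hM).pt c z)
        * A ((chartSystem hM).pt c z)) ((chartSystem hM).dom c) y := fun c' =>
      (isSmooth_chartSystem hM (hρA c') c).differentiableOn (by simp) y hy
    have e : fderivWithin ℝ (fun z => A ((chartSystem hM).pt c z)) ((chartSystem hM).dom c) y
        = ∑ c' ∈ ChartSystem.indices ρ hk, fderivWithin ℝ (fun z => ρ c' ((chartSystem hM).pt c z)
          * A ((chartSystem hM).pt c z)) ((chartSystem hM).dom c) y := by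
      rw [← fderivWithin_fun_sum ((chartSystem hM).uniqueDiffOn_dom c y hy) fun c' _ => hd c']
      congr 1
      funext z
      exact hsum _
    simp only [ChartSystem.jac, Matrix.det_fin_three, Matrix.of_apply, Matrix.cons_val_zero,
      Matrix.cons_val_one, Matrix.cons_val, e, sum_apply, Finset.sum_mul,
      Finset.sum_add_distrib, Finset.sum_sub_distrib]
  have hR : (bdryChartSystem hM).integral ρ univ
        (fun c s => A (bdryPoint c s) * (bdryChartSystem hM).jac ![B, C] c s)
      = ∑ c' ∈ ChartSystem.indices ρ hk, (bdryChartSystem hM).integral ρ univ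
        (fun c s => (ρ c' (bdryPoint c s) * A (bdryPoint c s))
          * (bdryChartSystem hM).jac ![B, C] c s) := by
    rw [← ChartSystem.integral_finset_sum hρ _ hk fun c' _ =>
      isContFormOn_mul_jac hM (hρA c') hB hC (hρA0 c')]
    refine ChartSystem.integral_congr fun c y hy => ?_
    rw [← Finset.sum_mul, ← hsum]
  rw [hL, hR, ← Finset.sum_neg_distrib]
  refine Finset.sum_congr rfl fun c' _ => ?_
  refine integral_jac_of_tsupport_subset hM hρ (hρA c') hB hC ?_ (c₀ := c') ?_
  · exact hAc.mul_left
  · exact (tsupport_mul_subset_left (f := ρ c') (g := A)).trans (hρ c')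

variable [T2Space M] [SigmaCompactSpace M]

theorem isSubordinate_pou : (pou M).toPartitionOfUnity.IsSubordinate
    fun c => (extChartAt (𝓡∂ 3) c).source := by
  intro c
  simp only [extChartAt_source]
  exact (SmoothPartitionOfUnity.exists_isSubordinate_chartAt_source (𝓡∂ 3) M).choose_spec c

theorem mfdIntegral_eq (η : M → E3 → ℝ) :
    mfdIntegral η = (chartSystem hM).integral (pou M).toPartitionOfUnity univ η := by
  simp only [ChartSystem.integral, preimage_univ, inter_univ]
  rfl

theorem bdryIntegral_eq (k : Set M) (η : M → E2 → ℝ) :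
    bdryIntegral k η = - (bdryChartSystem hM).integral (pou M).toPartitionOfUnity k η := rfl

/-- Stokes' theorem for `A dB ∧ dC`, where `A` has compact support. -/
theorem mfdIntegral_jac {A B C : M → ℝ} (hA : ContMDiff (𝓡∂ 3) 𝓘(ℝ) ∞ A)
    (hB : ContMDiff (𝓡∂ 3) 𝓘(ℝ) ∞ B) (hC : ContMDiff (𝓡∂ 3) 𝓘(ℝ) ∞ C)
    (hAc : HasCompactSupport A) :
    mfdIntegral ((chartSystem hM).jac ![A, B, C]) = bdryIntegral univ
      (fun c s => A (bdryPoint c s) * (bdryChartSystem hM).jac ![B, C] c s) := by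
  rw [mfdIntegral_eq hM, bdryIntegral_eq hM]
  exact integral_jac hM isSubordinate_pou (fun c => (pou M c).contMDiff) hA hB hC hAc

/-- The integral over the boundary of the exact form `d(A dB)` vanishes when `A` has compact
support. This is Stokes' theorem for `χ dA ∧ dB`, where `χ` is a cut-off function equal to one near
the support of `A`: the form `dχ ∧ dA ∧ dB` vanishes. -/
theorem bdryIntegral_jac {A B : M → ℝ} (hA : ContMDiff (𝓡∂ 3) 𝓘(ℝ) ∞ A)
    (hB : ContMDiff (𝓡∂ 3) 𝓘(ℝ) ∞ B) (hAc : HasCompactSupport A) :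
    bdryIntegral univ ((bdryChartSystem hM).jac ![A, B]) = 0 := by
  have : LocallyCompactSpace M := Manifold.locallyCompact_of_finiteDimensional (𝓡∂ 3)
  obtain ⟨t, htc, ht⟩ := exists_compact_superset (K := tsupport A) hAc
  obtain ⟨χ, hχ1, hχ0, -⟩ := exists_contMDiffMap_one_nhds_of_subset_interior (𝓡∂ 3) (n := ⊤)
    (isClosed_tsupport A) ht
  have hχc : HasCompactSupport χ := HasCompactSupport.intro htc fun p hp => hχ0 p hp
  have key := mfdIntegral_jac hM χ.contMDiff hA hB hχc
  have e1 : mfdIntegral ((chartSystem hM).jac ![χ, A, B]) = 0 := by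
    rw [mfdIntegral_eq hM, ChartSystem.integral_congr (η' := fun _ _ => 0)]
    · simp [ChartSystem.integral]
    · intro c y hy
      by_cases hp : (chartSystem hM).pt c y ∈ tsupport A
      · have hev : (fun z => χ ((chartSystem hM).pt c z)) =ᶠ[𝓝[(chartSystem hM).dom c] y]
            fun _ => 1 :=
          ((chartSystem hM).continuousOn_pt c y hy).eventually
            (hχ1.filter_mono (nhds_le_nhdsSet hp))
        refine Matrix.det_eq_zero_of_row_eq_zero 0 fun j => ?_
        simp only [Matrix.of_apply, Matrix.cons_val_zero]
        rw [hev.fderivWithin_eq_of_mem hy]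
        simp
      · exact ChartSystem.jac_eq_zero (isClosed_tsupport A) (i := 1)
          (fun p hp => image_eq_zero_of_notMem_tsupport hp) hy hp
  rw [e1] at key
  rw [key, bdryIntegral_eq hM, bdryIntegral_eq hM]
  congr 1
  refine ChartSystem.integral_congr fun c s hs => ?_
  by_cases hp : bdryPoint c s ∈ tsupport A
  · rw [show χ (bdryPoint c s) = 1 from (hχ1.filter_mono (nhds_le_nhdsSet hp)).self_of_nhds,
      one_mul]
  · rw [ChartSystem.jac_eq_zero (isClosed_tsupport A) (i := 0)
      (fun p hp => image_eq_zero_of_notMem_tsupport hp) hs hp, mul_zero]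

end Stokes
end AdS

namespace AdS

/-! ### Calculus of one-parameter families -/

section Families

variable {E G : Type*} [NormedAddCommGroup E] [NormedSpace ℝ E] [NormedAddCommGroup G]
  [NormedSpace ℝ G] {F : ℝ × E → G} {T : Set E}

theorem hasDerivAt_slice (hF : ContDiffOn ℝ ∞ F (univ ×ˢ T)) (t : ℝ) {y : E} (hy : y ∈ T) :
    HasDerivAt (fun r => F (r, y)) (fderivWithin ℝ F (univ ×ˢ T) (t, y) (1, 0)) t := by
  have h1 := (hF.differentiableOn (by simp) (t, y) ⟨mem_univ _, hy⟩).hasFDerivWithinAt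
  have h2 : HasDerivWithinAt (fun r : ℝ => (r, y)) ((1 : ℝ), (0 : E)) univ t :=
    (hasDerivAt_id t).hasDerivWithinAt.prodMk (hasDerivWithinAt_const _ _ _)
  have hm : MapsTo (fun r : ℝ => (r, y)) univ (univ ×ˢ T : Set (ℝ × E)) :=
    fun r _ => ⟨mem_univ _, hy⟩
  exact (h1.comp_hasDerivWithinAt t h2 hm).hasDerivAt univ_mem

theorem hasFDerivWithinAt_slice (hF : ContDiffOn ℝ ∞ F (univ ×ˢ T)) (t : ℝ) {y : E} (hy : y ∈ T) :
    HasFDerivWithinAt (fun z => F (t, z))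
      ((fderivWithin ℝ F (univ ×ˢ T) (t, y)).comp (ContinuousLinearMap.inr ℝ ℝ E)) T y := by
  have h1 := (hF.differentiableOn (by simp) (t, y) ⟨mem_univ _, hy⟩).hasFDerivWithinAt
  have h2 : HasFDerivWithinAt (fun z : E => (t, z)) (ContinuousLinearMap.inr ℝ ℝ E) T y :=
    (hasFDerivAt_prodMk_right t y).hasFDerivWithinAt
  exact h1.comp y h2 fun z hz => ⟨mem_univ _, hz⟩

theorem contDiffOn_deriv_slice (hT : UniqueDiffOn ℝ T) (hF : ContDiffOn ℝ ∞ F (univ ×ˢ T))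
    (t : ℝ) : ContDiffOn ℝ ∞ (fun y => deriv (fun r => F (r, y)) t) T := by
  have h := ((hF.fderivWithin (uniqueDiffOn_univ.prod hT) (m := ∞) (by simp)).clm_apply
    (contDiffOn_const (c := ((1 : ℝ), (0 : E))))).comp
    (f := fun y : E => (t, y)) (s := T) (contDiff_prodMk_right t).contDiffOn
    (fun y hy => ⟨mem_univ _, hy⟩)
  exact h.congr fun y hy => (hasDerivAt_slice hF t hy).deriv

theorem contDiffOn_fderivWithin_slice (hT : UniqueDiffOn ℝ T) (hF : ContDiffOn ℝ ∞ F (univ ×ˢ T))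
    (v : E) : ContDiffOn ℝ ∞ (fun q : ℝ × E => fderivWithin ℝ (fun z => F (q.1, z)) T q.2 v)
      (univ ×ˢ T) := by
  have h := (hF.fderivWithin (uniqueDiffOn_univ.prod hT) (m := ∞) (by simp)).clm_apply
    (contDiffOn_const (c := ((0 : ℝ), v)))
  refine h.congr fun q hq => ?_
  rw [(hasFDerivWithinAt_slice hF q.1 hq.2).fderivWithin (hT q.2 hq.2)]
  rfl

/-- Time derivatives commute with space derivatives. -/
theorem hasDerivAt_fderiv_comm (hT : IsOpen T) (hF : ContDiffOn ℝ ∞ F (univ ×ˢ T)) (t : ℝ) {y : E}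
    (hy : y ∈ T) (v : E) :
    HasDerivAt (fun r => fderiv ℝ (fun z => F (r, z)) y v)
      (fderiv ℝ (fun z => deriv (fun r => F (r, z)) t) y v) t := by
  have hO : IsOpen (univ ×ˢ T : Set (ℝ × E)) := isOpen_univ.prod hT
  have hFt : ∀ r, ∀ z ∈ T, ContDiffAt ℝ ∞ F (r, z) := fun r z hz =>
    hF.contDiffAt (hO.mem_nhds ⟨mem_univ _, hz⟩)
  have hd : HasFDerivAt (fderiv ℝ F) (fderiv ℝ (fderiv ℝ F) (t, y)) (t, y) :=
    (((hFt t y hy).fderiv_right (m := 1) (by norm_cast)).differentiableAt (by simp)).hasFDerivAt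
  have e1 : ∀ r, fderiv ℝ (fun z => F (r, z)) y v = fderiv ℝ F (r, y) (0, v) := by
    intro r
    have := (((hFt r y hy).differentiableAt (by simp)).hasFDerivAt).comp y
      (hasFDerivAt_prodMk_right r y)
    have h' : HasFDerivAt (fun z => F (r, z)) _ y := this
    rw [h'.fderiv]; rfl
  have e2 : (fun z => deriv (fun r => F (r, z)) t) =ᶠ[𝓝 y] fun z => fderiv ℝ F (t, z) (1, 0) := by
    filter_upwards [hT.mem_nhds hy] with z hz
    rw [(hasDerivAt_slice hF t hz).deriv, fderivWithin_of_mem_nhds (hO.mem_nhds ⟨mem_univ _, hz⟩)]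
  have h1 : HasDerivAt (fun r => fderiv ℝ F (r, y) (0, v))
      (fderiv ℝ (fderiv ℝ F) (t, y) (1, 0) (0, v)) t := by
    have h2 : HasDerivAt (fun r : ℝ => (r, y)) ((1 : ℝ), (0 : E)) t :=
      (hasDerivAt_id t).prodMk (hasDerivAt_const _ _)
    have h3 : HasDerivAt (fun r : ℝ => fderiv ℝ F (r, y))
        (fderiv ℝ (fderiv ℝ F) (t, y) (1, 0)) t := hd.comp_hasDerivAt t h2
    exact (ContinuousLinearMap.apply ℝ G ((0 : ℝ), v)).hasFDerivAt.comp_hasDerivAt t h3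
  have h2 : HasFDerivAt (fun z => fderiv ℝ F (t, z) (1, 0))
      ((ContinuousLinearMap.apply ℝ G ((1 : ℝ), (0 : E))).comp
        ((fderiv ℝ (fderiv ℝ F) (t, y)).comp (ContinuousLinearMap.inr ℝ ℝ E))) y := by
    have h3 : HasFDerivAt (fun z : E => fderiv ℝ F (t, z))
        ((fderiv ℝ (fderiv ℝ F) (t, y)).comp (ContinuousLinearMap.inr ℝ ℝ E)) y :=
      hd.comp y (hasFDerivAt_prodMk_right t y)
    exact (ContinuousLinearMap.apply ℝ G ((1 : ℝ), (0 : E))).hasFDerivAt.comp y h3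
  simp only [e1]
  rw [e2.fderiv_eq, h2.fderiv]
  refine h1.congr_deriv ?_
  exact (hFt t y hy).isSymmSndFDerivAt (by
    simp only [minSmoothness_of_isRCLikeNormedField]; exact ENat.LEInfty.out) _ _

end Families

theorem hasDerivAt_fst {f : ℝ → W × W} {f' : W × W} {t : ℝ} (h : HasDerivAt f f' t) :
    HasDerivAt (fun r => (f r).1) f'.1 t :=
  (ContinuousLinearMap.fst ℝ W W).hasFDerivAt.comp_hasDerivAt t h

theorem hasDerivAt_snd {f : ℝ → W × W} {f' : W × W} {t : ℝ} (h : HasDerivAt f f' t) :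
    HasDerivAt (fun r => (f r).2) f'.2 t :=
  (ContinuousLinearMap.snd ℝ W W).hasFDerivAt.comp_hasDerivAt t h

/-! ### The integrand over the interior -/

/-- Four vectors orthogonal to a common vector are linearly dependent. -/
theorem det4_eq_zero_of_form {X a b c d : W} (hX : form X X ≠ 0) (ha : form X a = 0)
    (hb : form X b = 0) (hc : form X c = 0) (hd : form X d = 0) : det4 a b c d = 0 := by
  rw [det4, ← Matrix.exists_mulVec_eq_zero_iff]
  refine ⟨![X 0, X 1, -X 2, -X 3], ?_, ?_⟩
  · intro h0
    have h1 := congrFun h0 0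
    have h2 := congrFun h0 1
    have h3 := congrFun h0 2
    have h4 := congrFun h0 3
    simp at h1 h2 h3 h4
    apply hX
    simp [form, h1, h2, h3, h4]
  · simp only [form] at ha hb hc hd
    ext i
    fin_cases i <;> simp [Matrix.mulVec, dotProduct, Fin.sum_univ_four] <;> linarith

theorem sum_sum_det4_single (a b u v : W) :
    ∑ i, ∑ j, det4 a b (Pi.single i 1) (Pi.single j 1) * (u i * v j) = det4 a b u v := by
  simp only [Fin.sum_univ_four, det4_eq]
  simp
  ring

theorem sum_det4_single (a b c u : W) :
    ∑ i, det4 a b c (Pi.single i 1) * u i = det4 a b c u := by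
  simp only [Fin.sum_univ_four, det4_eq]
  simp
  ring

section Manifold

variable {M : Type*} [TopologicalSpace M] [ChartedSpace (EuclideanHalfSpace 3) M]

/-- The initial velocity of a family of maps. -/
noncomputable def velocity (φ : ℝ → M → W × W) (p : M) : W × W := deriv (fun t => φ t p) 0

variable [IsManifold (𝓡∂ 3) ∞ M]

theorem contMDiff_of_charts {F : Type*} [NormedAddCommGroup F] [NormedSpace ℝ F] {h : M → F}
    (hh : ∀ c, ContDiffOn ℝ ∞ (fun y => h ((extChartAt (𝓡∂ 3) c).symm y))
      (extChartAt (𝓡∂ 3) c).target) : ContMDiff (𝓡∂ 3) 𝓘(ℝ, F) ∞ h := by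
  intro p
  have h1 := (contMDiffOn_iff_contDiffOn.2 (hh p)).comp
    (contMDiffOn_extChartAt (I := 𝓡∂ 3) (n := ∞) (x := p))
    (fun q hq => (extChartAt (𝓡∂ 3) p).map_source (by rwa [extChartAt_source]))
  have h2 : ContMDiffOn (𝓡∂ 3) 𝓘(ℝ, F) ∞ h (chartAt (EuclideanHalfSpace 3) p).source :=
    h1.congr fun _ hq => by
      simp only [Function.comp_apply]
      rw [(extChartAt (𝓡∂ 3) p).left_inv (by rwa [extChartAt_source])]
  exact h2.contMDiffAt ((chartAt (EuclideanHalfSpace 3) p).open_source.mem_nhds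
    (mem_chart_source _ p))

variable {φ : ℝ → M → W × W}
  (hφ : ContMDiff (𝓘(ℝ, ℝ).prod (𝓡∂ 3)) 𝓘(ℝ, W × W) ∞ (fun q : ℝ × M => φ q.1 q.2))

include hφ

theorem contDiffOn_family (c : M) :
    ContDiffOn ℝ ∞ (fun q : ℝ × E3 => φ q.1 ((extChartAt (𝓡∂ 3) c).symm q.2))
      (univ ×ˢ (extChartAt (𝓡∂ 3) c).target) := by
  rw [← contMDiffOn_iff_contDiffOn, modelWithCornersSelf_prod, ← chartedSpaceSelf_prod]
  refine hφ.comp_contMDiffOn (contMDiffOn_fst.prodMk ?_)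
  exact (contMDiffOn_extChartAt_symm c).comp contMDiffOn_snd fun q hq => hq.2

theorem contDiffOn_family_bdry (c : M) :
    ContDiffOn ℝ ∞ (fun q : ℝ × E2 => φ q.1 (bdryPoint c q.2)) (univ ×ˢ bdryDomain c) :=
  (contDiffOn_family hφ c).comp (f := fun q : ℝ × E2 => (q.1, bdryEmb q.2))
    (contDiff_fst.prodMk (contDiff_bdryEmb.comp contDiff_snd)).contDiffOn
    fun _ hq => ⟨mem_univ _, hq.2⟩

theorem contMDiff_velocity : ContMDiff (𝓡∂ 3) 𝓘(ℝ, W × W) ∞ (velocity φ) :=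
  contMDiff_of_charts fun c =>
    contDiffOn_deriv_slice (uniqueDiffOn_extChartAt_target c) (contDiffOn_family hφ c) 0

theorem contMDiff_slice (t : ℝ) : ContMDiff (𝓡∂ 3) 𝓘(ℝ, W × W) ∞ (φ t) :=
  contMDiff_of_charts fun c => (contDiffOn_family hφ c).comp
    (f := fun y : E3 => (t, y)) (contDiff_prodMk_right t).contDiffOn
    (fun _ hy => ⟨mem_univ _, hy⟩)

theorem hasDerivAt_velocity (p : M) : HasDerivAt (fun t => φ t p) (velocity φ p) 0 := by
  have h := hasDerivAt_slice (contDiffOn_family hφ p) 0 (mem_extChartAt_target (I := 𝓡∂ 3) p)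
  have e : (extChartAt (𝓡∂ 3) p).symm (extChartAt (𝓡∂ 3) p p) = p :=
    (extChartAt (𝓡∂ 3) p).left_inv (mem_extChartAt_source p)
  simp only [e] at h
  exact h.differentiableAt.hasDerivAt

theorem contDiffOn_pullbackOmega (c : M) :
    ContDiffOn ℝ ∞ (fun q : ℝ × E3 => pullbackOmega (φ q.1) c q.2)
      (univ ×ˢ (extChartAt (𝓡∂ 3) c).target) := by
  have hF := contDiffOn_family hφ c
  have hD := fun i : Fin 3 => (contDiffOn_fderivWithin_slice (uniqueDiffOn_extChartAt_target c) hF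
    (EuclideanSpace.single i 1)).fst
  have h : ContDiffOn ℝ ∞ (fun q : ℝ × E3 => det4 (φ q.1 ((extChartAt (𝓡∂ 3) c).symm q.2)).1
      (fderivWithin ℝ (fun z => φ q.1 ((extChartAt (𝓡∂ 3) c).symm z)) (extChartAt (𝓡∂ 3) c).target
        q.2 (EuclideanSpace.single 0 1)).1
      (fderivWithin ℝ (fun z => φ q.1 ((extChartAt (𝓡∂ 3) c).symm z)) (extChartAt (𝓡∂ 3) c).target
        q.2 (EuclideanSpace.single 1 1)).1
      (fderivWithin ℝ (fun z => φ q.1 ((extChartAt (𝓡∂ 3) c).symm z)) (extChartAt (𝓡∂ 3) c).target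
        q.2 (EuclideanSpace.single 2 1)).1) (univ ×ˢ (extChartAt (𝓡∂ 3) c).target) :=
    fun q hq => ContDiffWithinAt.det4 (hF.fst q hq) (hD 0 q hq) (hD 1 q hq) (hD 2 q hq)
  refine h.congr fun q hq => ?_
  simp only [pullbackOmega, omega, fderivWithin_target hq.2]
  rfl

theorem contDiffOn_pullbackAlpha (c : M) :
    ContDiffOn ℝ ∞ (fun q : ℝ × E2 => pullbackAlpha (φ q.1) c q.2) (univ ×ˢ bdryDomain c) := by
  have hF := contDiffOn_family_bdry hφ c
  have hO := isOpen_bdryDomain c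
  have hD : ∀ i : Fin 2, ContDiffOn ℝ ∞ (fun q : ℝ × E2 => pd i (bdryMap (φ q.1) c) q.2)
      (univ ×ˢ bdryDomain c) := fun i =>
    (contDiffOn_fderivWithin_slice hO.uniqueDiffOn hF (EuclideanSpace.single i 1)).congr
      fun q hq => by rw [fderivWithin_of_mem_nhds (hO.mem_nhds hq.2)]; rfl
  have hF' : ContDiffOn ℝ ∞ (fun q : ℝ × E2 => bdryMap (φ q.1) c q.2) (univ ×ˢ bdryDomain c) := hF
  intro q hq
  exact contDiffWithinAt_const.mul
    ((ContDiffWithinAt.det4 (hF'.fst q hq) (hF'.snd q hq) ((hD 0).snd q hq) ((hD 1).fst q hq)).add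
    (ContDiffWithinAt.det4 (hF'.fst q hq) (hF'.snd q hq) ((hD 0).fst q hq) ((hD 1).snd q hq)))

/-- The coefficients `A i j` such that the `2`-form `det (x, ẋ, dx, dx)` is `∑ A i j dxᵢ ∧ dxⱼ`. -/
noncomputable def omegaCoeff (φ : ℝ → M → W × W) (i j : Fin 4) (p : M) : ℝ :=
  1 / 2 * det4 (φ 0 p).1 (velocity φ p).1 (Pi.single i 1) (Pi.single j 1)

/-- A coordinate of the base point. -/
def baseCoord (φ : M → W × W) (i : Fin 4) (p : M) : ℝ := (φ p).1 i

theorem contMDiff_of_comp {F : Type*} [NormedAddCommGroup F] [NormedSpace ℝ F]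
    {g : (W × W) × (W × W) → F} (hg : ContDiff ℝ ∞ g) :
    ContMDiff (𝓡∂ 3) 𝓘(ℝ, F) ∞ (fun p => g (φ 0 p, velocity φ p)) :=
  hg.contMDiff.comp ((contMDiff_slice hφ 0).prodMk_space (contMDiff_velocity hφ))

theorem contMDiff_omegaCoeff (i j : Fin 4) : ContMDiff (𝓡∂ 3) 𝓘(ℝ) ∞ (omegaCoeff φ i j) := by
  refine contMDiff_of_comp hφ (g := fun q => 1 / 2 * det4 q.1.1 q.2.1 (Pi.single i 1)
    (Pi.single j 1)) (contDiff_const.mul ?_)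
  refine contDiff_iff_contDiffAt.2 fun q => ContDiffWithinAt.det4 (s := univ) ?_ ?_ ?_ ?_
  exacts [contDiff_fst.fst.contDiffAt, contDiff_snd.fst.contDiffAt, contDiffAt_const,
    contDiffAt_const]

theorem contMDiff_baseCoord (i : Fin 4) : ContMDiff (𝓡∂ 3) 𝓘(ℝ) ∞ (baseCoord (φ 0) i) :=
  contMDiff_of_comp hφ (g := fun q => q.1.1 i) ((contDiff_apply ℝ ℝ i).comp contDiff_fst.fst)

omit hφ [TopologicalSpace M] [ChartedSpace (EuclideanHalfSpace 3) M]
  [IsManifold (𝓡∂ 3) ∞ M] in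
theorem form_fst_velocity {p : M} (hd : HasDerivAt (fun t => φ t p) (velocity φ p) 0)
    (hm : ∀ᶠ t in 𝓝 (0 : ℝ), φ t p ∈ unitTangent) : form (φ 0 p).1 (velocity φ p).1 = 0 := by
  have h1 := (hasDerivAt_fst hd).form (hasDerivAt_fst hd)
  have h2 : HasDerivAt (fun t => form (φ t p).1 (φ t p).1) 0 0 :=
    (hasDerivAt_const (0 : ℝ) (-1 : ℝ)).congr_of_eventuallyEq
      (by filter_upwards [hm] with t ht using ht.1)
  have h3 := h1.unique h2
  rw [form_comm (velocity φ p).1] at h3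
  linarith

/-- The time derivative of the pull-back of `ω` is the exterior derivative of
`det (x, ẋ, dx, dx)`: the form `ω` is closed, and the term `det (ẋ, dx, dx, dx)` vanishes since its
four arguments are orthogonal to `x`. -/
theorem deriv_pullbackOmega (hM : IsOrientedAtlas M)
    (hm : ∀ᶠ t in 𝓝 (0 : ℝ), ∀ p, φ t p ∈ unitTangent) {c : M} {y : E3}
    (hy : y ∈ (extChartAt (𝓡∂ 3) c).target) (h0 : 0 < y 0) :
    deriv (fun t => pullbackOmega (φ t) c y) 0 = ∑ i, ∑ j,
      (chartSystem hM).jac ![omegaCoeff φ i j, baseCoord (φ 0) i, baseCoord (φ 0) j] c y := by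
  set T := interior (extChartAt (𝓡∂ 3) c).target with hT
  have hTo : IsOpen T := isOpen_interior
  have hyT : y ∈ T := mem_interior_iff_mem_nhds.2 (extChartAt_target_mem_nhds_of_pos hy h0)
  have hyn : (extChartAt (𝓡∂ 3) c).target ∈ 𝓝 y := extChartAt_target_mem_nhds_of_pos hy h0
  have hF : ContDiffOn ℝ ∞ (fun q : ℝ × E3 => φ q.1 ((extChartAt (𝓡∂ 3) c).symm q.2))
      (univ ×ˢ T) := (contDiffOn_family hφ c).mono (prod_mono_right interior_subset)
  -- space and time derivatives of the map in the chart
  set D : ℝ → Fin 3 → W × W := fun t k =>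
    fderiv ℝ (fun z => φ t ((extChartAt (𝓡∂ 3) c).symm z)) y (EuclideanSpace.single k 1) with hD
  set D' : Fin 3 → W × W := fun k =>
    fderiv ℝ (fun z => velocity φ ((extChartAt (𝓡∂ 3) c).symm z)) y (EuclideanSpace.single k 1)
    with hD'
  set p := (extChartAt (𝓡∂ 3) c).symm y with hp
  have hDt : ∀ k, HasDerivAt (fun t => D t k) (D' k) 0 := fun k =>
    hasDerivAt_fderiv_comm hTo hF 0 hyT _
  have hv : HasDerivAt (fun t => φ t p) (velocity φ p) 0 := hasDerivAt_velocity hφ p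
  have hom : ∀ t, pullbackOmega (φ t) c y = det4 (φ t p).1 (D t 0).1 (D t 1).1 (D t 2).1 := by
    intro t
    simp only [pullbackOmega, omega, ← fderivWithin_target hy, fderivWithin_of_mem_nhds hyn]
    rfl
  have hder := (hasDerivAt_fst hv).det4 (hasDerivAt_fst (hDt 0)) (hasDerivAt_fst (hDt 1))
    (hasDerivAt_fst (hDt 2))
  simp only [hom]
  rw [hder.deriv]
  -- differentiability of the initial map and of the velocity
  have hX : HasFDerivAt (fun z => φ 0 ((extChartAt (𝓡∂ 3) c).symm z)) _ y :=
    ((contDiffOn_comp_extChartAt_symm (contMDiff_slice hφ 0) c).contDiffAt hyn |>.differentiableAt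
      (by simp)).hasFDerivAt
  have hZ : HasFDerivAt (fun z => velocity φ ((extChartAt (𝓡∂ 3) c).symm z)) _ y :=
    ((contDiffOn_comp_extChartAt_symm (contMDiff_velocity hφ) c).contDiffAt hyn |>.differentiableAt
      (by simp)).hasFDerivAt
  have lX : ∀ k : Fin 3, HasDerivAt (fun r : ℝ => φ 0 ((extChartAt (𝓡∂ 3) c).symm
      (y + r • EuclideanSpace.single k 1))) (D 0 k) 0 := fun k => hX.hasLineDerivAt _
  have lZ : ∀ k : Fin 3, HasDerivAt (fun r : ℝ => velocity φ ((extChartAt (𝓡∂ 3) c).symm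
      (y + r • EuclideanSpace.single k 1))) (D' k) 0 := fun k => hZ.hasLineDerivAt _
  have hline : ∀ {h : M → ℝ}, ContMDiff (𝓡∂ 3) 𝓘(ℝ) ∞ h → ∀ {k : Fin 3} {h' : ℝ},
      HasDerivAt (fun r : ℝ => h ((extChartAt (𝓡∂ 3) c).symm
        (y + r • EuclideanSpace.single k 1))) h' 0 →
      fderivWithin ℝ (fun z => h ((chartSystem hM).pt c z)) ((chartSystem hM).dom c) y
        (EuclideanSpace.single k 1) = h' := by
    intro h hh k h' hl
    have h1 : HasFDerivAt (fun z => h ((extChartAt (𝓡∂ 3) c).symm z)) _ y :=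
      ((contDiffOn_comp_extChartAt_symm hh c).contDiffAt hyn |>.differentiableAt
        (by simp)).hasFDerivAt
    change fderivWithin ℝ (fun z => h ((extChartAt (𝓡∂ 3) c).symm z))
      (extChartAt (𝓡∂ 3) c).target y _ = h'
    rw [fderivWithin_of_mem_nhds hyn]
    exact (h1.hasLineDerivAt (EuclideanSpace.single k 1)).unique hl
  have hA : ∀ i j k, fderivWithin ℝ (fun z => omegaCoeff φ i j ((chartSystem hM).pt c z))
      ((chartSystem hM).dom c) y (EuclideanSpace.single k 1)
      = 1 / 2 * (det4 (D 0 k).1 (velocity φ p).1 (Pi.single i 1) (Pi.single j 1)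
        + det4 (φ 0 p).1 (D' k).1 (Pi.single i 1) (Pi.single j 1)) := by
    intro i j k
    refine hline (contMDiff_omegaCoeff hφ i j) ?_
    have h1 := ((hasDerivAt_fst (lX k)).det4 (hasDerivAt_fst (lZ k))
      (hasDerivAt_const 0 (Pi.single i (1 : ℝ)))
      (hasDerivAt_const 0 (Pi.single j (1 : ℝ)))).const_mul (1 / 2)
    refine h1.congr_deriv ?_
    simp only [zero_smul, add_zero, ← hp]
    simp [det4_eq]
  have hB : ∀ i k, fderivWithin ℝ (fun z => baseCoord (φ 0) i ((chartSystem hM).pt c z))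
      ((chartSystem hM).dom c) y (EuclideanSpace.single k 1) = (D 0 k).1 i := fun i k =>
    hline (contMDiff_baseCoord hφ i) (hasDerivAt_pi.1 (hasDerivAt_fst (lX k)) i)
  -- orthogonality to the base point
  have hXX : ∀ q, form (φ 0 q).1 (φ 0 q).1 = -1 := fun q => (hm.self_of_nhds q).1
  have hperp : ∀ k, form (φ 0 p).1 (D 0 k).1 = 0 := by
    intro k
    have h1 := (hasDerivAt_fst (lX k)).form (hasDerivAt_fst (lX k))
    simp only [hXX, zero_smul, add_zero, ← hp] at h1
    have h2 := h1.unique (hasDerivAt_const 0 (-1 : ℝ))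
    rw [form_comm (D 0 k).1] at h2
    linarith
  have hZp : form (φ 0 p).1 (velocity φ p).1 = 0 :=
    form_fst_velocity hv (hm.mono fun t ht => ht p)
  have hz : det4 (velocity φ p).1 (D 0 0).1 (D 0 1).1 (D 0 2).1 = 0 :=
    det4_eq_zero_of_form (X := (φ 0 p).1) (by rw [hXX]; norm_num) hZp (hperp 0) (hperp 1) (hperp 2)
  have hjac : ∀ i j, (chartSystem hM).jac
      ![omegaCoeff φ i j, baseCoord (φ 0) i, baseCoord (φ 0) j] c y = 1 / 2 * (
      (det4 (D 0 0).1 (velocity φ p).1 (Pi.single i 1) (Pi.single j 1)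
        * ((D 0 1).1 i * (D 0 2).1 j)
      - det4 (D 0 0).1 (velocity φ p).1 (Pi.single i 1) (Pi.single j 1)
        * ((D 0 2).1 i * (D 0 1).1 j)
      + det4 (φ 0 p).1 (D' 0).1 (Pi.single i 1) (Pi.single j 1)
        * ((D 0 1).1 i * (D 0 2).1 j)
      - det4 (φ 0 p).1 (D' 0).1 (Pi.single i 1) (Pi.single j 1)
        * ((D 0 2).1 i * (D 0 1).1 j))
      - (det4 (D 0 1).1 (velocity φ p).1 (Pi.single i 1) (Pi.single j 1)
        * ((D 0 0).1 i * (D 0 2).1 j)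
      - det4 (D 0 1).1 (velocity φ p).1 (Pi.single i 1) (Pi.single j 1)
        * ((D 0 2).1 i * (D 0 0).1 j)
      + det4 (φ 0 p).1 (D' 1).1 (Pi.single i 1) (Pi.single j 1)
        * ((D 0 0).1 i * (D 0 2).1 j)
      - det4 (φ 0 p).1 (D' 1).1 (Pi.single i 1) (Pi.single j 1)
        * ((D 0 2).1 i * (D 0 0).1 j))
      + (det4 (D 0 2).1 (velocity φ p).1 (Pi.single i 1) (Pi.single j 1)
        * ((D 0 0).1 i * (D 0 1).1 j)
      - det4 (D 0 2).1 (velocity φ p).1 (Pi.single i 1) (Pi.single j 1)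
        * ((D 0 1).1 i * (D 0 0).1 j)
      + det4 (φ 0 p).1 (D' 2).1 (Pi.single i 1) (Pi.single j 1)
        * ((D 0 0).1 i * (D 0 1).1 j)
      - det4 (φ 0 p).1 (D' 2).1 (Pi.single i 1) (Pi.single j 1)
        * ((D 0 1).1 i * (D 0 0).1 j))) := by
    intro i j
    simp only [ChartSystem.jac, Matrix.det_fin_three, Matrix.of_apply, Matrix.cons_val_zero,
      Matrix.cons_val_one, Matrix.cons_val, hA, hB]
    ring
  simp only [hjac, ← Finset.mul_sum, Finset.sum_add_distrib, Finset.sum_sub_distrib,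
    sum_sum_det4_single]
  clear_value D D' p
  generalize (φ 0 p).1 = X at *
  generalize (velocity φ p).1 = Z at *
  generalize (D 0 0).1 = X0 at *
  generalize (D 0 1).1 = X1 at *
  generalize (D 0 2).1 = X2 at *
  simp only [det4_eq] at hz ⊢
  linear_combination 4 * hz

end Manifold
end AdS

namespace AdS

/-! ### Vanishing of the integrand at infinity -/

section Infinity

theorem volume_hyperplane : volume {y : E3 | y 0 = 0} = 0 := by
  have h := Measure.addHaar_submodule (volume : Measure E3)
    (LinearMap.ker (EuclideanSpace.proj (𝕜 := ℝ) (0 : Fin 3) : E3 →L[ℝ] ℝ).toLinearMap) (by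
      intro h
      have h1 : (EuclideanSpace.single 0 1 : E3) ∈ (⊤ : Submodule ℝ E3) := trivial
      rw [← h] at h1
      simp at h1)
  exact h

theorem apply_eq_of_single {L : E3 →L[ℝ] E3} {w : ℝ}
    (h : ∀ k, L (EuclideanSpace.single k 1) = w • EuclideanSpace.single k 1) (z : E3) :
    L z = w • z := by
  have : L.toLinearMap = w • LinearMap.id :=
    (EuclideanSpace.basisFun (Fin 3) ℝ).toBasis.ext fun k => by simpa using h k
  exact LinearMap.congr_fun this z

variable {M : Type*} [TopologicalSpace M] [ChartedSpace (EuclideanHalfSpace 3) M]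
  [IsManifold (𝓡∂ 3) ∞ M]

theorem extChartAt_zero_of_mem_boundary {p c : M} (hp : p ∈ (𝓡∂ 3).boundary M)
    (hc : p ∈ (extChartAt (𝓡∂ 3) c).source) : extChartAt (𝓡∂ 3) c p 0 = 0 := by
  have h0 : extChartAt (𝓡∂ 3) p p 0 = 0 := by
    have h : extChartAt (𝓡∂ 3) p p ∈ frontier (range (𝓡∂ 3)) := hp
    rw [frontier_range_modelWithCornersEuclideanHalfSpace] at h
    exact h.symm
  have e := bdryEmb_bdryProjL h0
  have hs : bdryProjL (extChartAt (𝓡∂ 3) p p) ∈ bdryDomain p := by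
    rw [bdryDomain, mem_preimage, e]
    exact mem_extChartAt_target p
  have hb : bdryPoint p (bdryProjL (extChartAt (𝓡∂ 3) p p)) = p := by
    rw [bdryPoint, e]
    exact (extChartAt (𝓡∂ 3) p).left_inv (mem_extChartAt_source p)
  have := extChartAt_bdryPoint_zero hs (c' := c) (by rwa [hb])
  rwa [hb] at this

/-- A smooth map to a three-dimensional space maps the boundary to a set of measure zero. -/
theorem volume_image_boundary [SigmaCompactSpace M] {h : M → E3}
    (hh : ContMDiff (𝓡∂ 3) 𝓘(ℝ, E3) ∞ h) : volume (h '' (𝓡∂ 3).boundary M) = 0 := by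
  obtain ⟨s, hs, hcov⟩ := countable_cover_nhds_of_sigmaCompact
    (f := fun c : M => (extChartAt (𝓡∂ 3) c).source) fun c => extChartAt_source_mem_nhds c
  refine measure_mono_null (t := ⋃ c ∈ s, (fun y => h ((extChartAt (𝓡∂ 3) c).symm y)) ''
    ((extChartAt (𝓡∂ 3) c).target ∩ {y | y 0 = 0})) ?_ ?_
  · rintro _ ⟨p, hp, rfl⟩
    have hp' : p ∈ ⋃ x ∈ s, (extChartAt (𝓡∂ 3) x).source := by rw [hcov]; trivial
    obtain ⟨c, hcs, hc⟩ := mem_iUnion₂.1 hp'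
    refine mem_iUnion₂.2 ⟨c, hcs, extChartAt (𝓡∂ 3) c p, ⟨(extChartAt (𝓡∂ 3) c).map_source hc,
      extChartAt_zero_of_mem_boundary hp hc⟩, ?_⟩
    simp only [(extChartAt (𝓡∂ 3) c).left_inv hc]
  · refine (measure_biUnion_null_iff hs).2 fun c _ => ?_
    refine addHaar_image_eq_zero_of_differentiableOn_of_addHaar_eq_zero volume
      (((contDiffOn_comp_extChartAt_symm hh c).differentiableOn (by simp)).mono
        inter_subset_left) ?_
    exact measure_mono_null inter_subset_right volume_hyperplane

omit [IsManifold (𝓡∂ 3) ∞ M] in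
/-- At infinity `φ` takes its values in the image of the boundary. -/
theorem IsCobordism.mem_image_boundary {E : EndStructure M} {φ : M → W × W} (h : IsCobordism E φ)
    {p : M} (hp : p ∉ E.K) : φ p ∈ φ '' (𝓡∂ 3).boundary M := by
  obtain ⟨⟨u, r⟩, hur⟩ := E.e.surjective ⟨p, hp⟩
  refine ⟨u, ?_, ?_⟩
  · rw [← E.union_eq]
    exact Or.inl (E.U_subset u.2)
  · have h1 := h.constant_at_infinity u 0 r
    rw [hur, E.e_zero] at h1
    exact h1

/-- The form `φ^* ω` vanishes at infinity: where it does not, `φ` followed by a suitable projection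
to a three-dimensional space is open, although it takes its values in the image of the boundary,
which has measure zero. -/
theorem IsCobordism.pullbackOmega_eq_zero [T2Space M] [SigmaCompactSpace M] {E : EndStructure M}
    {φ : M → W × W} (h : IsCobordism E φ) {c : M} {y : E3}
    (hy : y ∈ (extChartAt (𝓡∂ 3) c).target) (h0 : 0 < y 0)
    (hK : (extChartAt (𝓡∂ 3) c).symm y ∉ E.K) : pullbackOmega φ c y = 0 := by
  by_contra hne
  have hyn : (extChartAt (𝓡∂ 3) c).target ∈ 𝓝 y := extChartAt_target_mem_nhds_of_pos hy h0
  set D : Fin 3 → W × W := fun k =>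
    fderiv ℝ (fun z => φ ((extChartAt (𝓡∂ 3) c).symm z)) y (EuclideanSpace.single k 1) with hD
  set X := (φ ((extChartAt (𝓡∂ 3) c).symm y)).1 with hX
  set w := det4 X (D 0).1 (D 1).1 (D 2).1 with hw
  have hom : pullbackOmega φ c y = w := by
    simp only [pullbackOmega, omega, ← fderivWithin_target hy, fderivWithin_of_mem_nhds hyn]
    rfl
  rw [hom] at hne
  -- the coordinates with respect to the differential of the base point
  set G : M → E3 := fun p => WithLp.toLp 2 ![det4 X (φ p).1 (D 1).1 (D 2).1,
    det4 X (D 0).1 (φ p).1 (D 2).1, det4 X (D 0).1 (D 1).1 (φ p).1] with hG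
  have hGd : ContDiff ℝ ∞ (fun q : W × W => (WithLp.toLp 2 ![det4 X q.1 (D 1).1 (D 2).1,
      det4 X (D 0).1 q.1 (D 2).1, det4 X (D 0).1 (D 1).1 q.1] : E3)) := by
    refine contDiff_euclidean.2 fun i => contDiff_iff_contDiffAt.2 fun q => ?_
    have hq : ContDiffAt ℝ ∞ (fun q : W × W => q.1) q := contDiff_fst.contDiffAt
    fin_cases i
    exacts [ContDiffWithinAt.det4 (s := univ) contDiffAt_const hq contDiffAt_const contDiffAt_const,
      ContDiffWithinAt.det4 (s := univ) contDiffAt_const contDiffAt_const hq contDiffAt_const,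
      ContDiffWithinAt.det4 (s := univ) contDiffAt_const contDiffAt_const contDiffAt_const hq]
  have hGs : ContMDiff (𝓡∂ 3) 𝓘(ℝ, E3) ∞ G := hGd.contMDiff.comp h.smooth
  have hφd : HasFDerivAt (fun z => φ ((extChartAt (𝓡∂ 3) c).symm z)) _ y :=
    ((contDiffOn_comp_extChartAt_symm h.smooth c).contDiffAt hyn |>.differentiableAt
      (by simp)).hasFDerivAt
  have hl : ∀ k : Fin 3, HasDerivAt (fun r : ℝ => (φ ((extChartAt (𝓡∂ 3) c).symm
      (y + r • EuclideanSpace.single k 1))).1) (D k).1 0 :=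
    fun k => hasDerivAt_fst (hφd.hasLineDerivAt _)
  have hst : HasStrictFDerivAt (fun z => G ((extChartAt (𝓡∂ 3) c).symm z)) _ y :=
    ((contDiffOn_comp_extChartAt_symm hGs c).contDiffAt hyn).hasStrictFDerivAt (by simp)
  set L := fderiv ℝ (fun z => G ((extChartAt (𝓡∂ 3) c).symm z)) y with hL
  have hLi : ∀ (i k : Fin 3) (g' : ℝ), HasDerivAt (fun r : ℝ => G ((extChartAt (𝓡∂ 3) c).symm
      (y + r • EuclideanSpace.single k 1)) i) g' 0 → L (EuclideanSpace.single k 1) i = g' := by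
    intro i k g' hg
    have h1 := (hasStrictFDerivAt_euclidean.1 hst i).hasFDerivAt.hasLineDerivAt
      (EuclideanSpace.single k 1)
    exact HasDerivAt.unique h1 hg
  have hc := fun v : W => hasDerivAt_const (0 : ℝ) v
  have hLw : ∀ i k : Fin 3, L (EuclideanSpace.single k 1) i
      = w * (EuclideanSpace.single k (1 : ℝ) : E3) i := by
    intro i k
    have e0 := hLi 0 k _ ((hc X).det4 (hl k) (hc (D 1).1) (hc (D 2).1))
    have e1 := hLi 1 k _ ((hc X).det4 (hc (D 0).1) (hl k) (hc (D 2).1))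
    have e2 := hLi 2 k _ ((hc X).det4 (hc (D 0).1) (hc (D 1).1) (hl k))
    fin_cases i <;> simp only [Fin.zero_eta, Fin.mk_one, Fin.reduceFinMk, e0, e1, e2] <;>
      fin_cases k <;> simp [det4_eq, hw] <;> ring
  have hLr : (L : E3 →L[ℝ] E3).range = ⊤ := by
    refine LinearMap.range_eq_top.2 fun z => ⟨w⁻¹ • z, ?_⟩
    rw [ContinuousLinearMap.coe_coe, map_smul, apply_eq_of_single (w := w)
      fun k => PiLp.ext fun i => hLw i k,
      smul_smul, inv_mul_cancel₀ hne, one_smul]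
  have hmap := hst.map_nhds_eq_of_surj hLr
  have hKn : ∀ᶠ z in 𝓝 y, (extChartAt (𝓡∂ 3) c).symm z ∉ E.K :=
    (((continuousOn_extChartAt_symm c).continuousAt hyn).eventually
      (E.isCompact_K.isClosed.isOpen_compl.mem_nhds hK))
  have hmem : G '' (𝓡∂ 3).boundary M ∈ 𝓝 (G ((extChartAt (𝓡∂ 3) c).symm y)) := by
    rw [← hmap]
    refine mem_map.2 (hKn.mono fun z hz => ?_)
    obtain ⟨q, hq, hqz⟩ := h.mem_image_boundary hz
    refine ⟨q, hq, ?_⟩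
    simp only [hG, hqz]
  exact (Measure.measure_pos_of_mem_nhds volume hmem).ne' (volume_image_boundary hGs)

theorem ae_pos : ∀ᵐ y : E3, y 0 ≠ 0 := by
  rw [ae_iff]
  simpa using volume_hyperplane

omit [IsManifold (𝓡∂ 3) ∞ M] in
theorem pos_of_mem_target {c : M} {y : E3} (hy : y ∈ (extChartAt (𝓡∂ 3) c).target)
    (h0 : y 0 ≠ 0) : 0 < y 0 := by
  rw [← (extChartAt (𝓡∂ 3) c).right_inv hy] at h0 ⊢
  exact lt_of_le_of_ne (extChartAt_apply_zero_nonneg _ _) h0.symm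

end Infinity
end AdS

namespace AdS

/-! ### The pointwise variational formula on the boundary -/

/-- The form `α` in terms of `x + n` and `x - n`; the mixed terms cancel. -/
theorem alpha_eq (p u v : W × W) : alpha p u v = -(1 / 16) *
    (det4 (nullPlus p) (nullMinus p) (nullPlus u) (nullPlus v)
      - det4 (nullPlus p) (nullMinus p) (nullMinus u) (nullMinus v)) := by
  simp only [alpha, det4_eq, nullPlus, nullMinus, Pi.add_apply, Pi.sub_apply]
  ring

theorem hasDerivAt_nullPlus {f : ℝ → W × W} {f' : W × W} {t : ℝ} (h : HasDerivAt f f' t) :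
    HasDerivAt (fun r => nullPlus (f r)) (nullPlus f') t :=
  (hasDerivAt_fst h).add (hasDerivAt_snd h)

theorem hasDerivAt_nullMinus {f : ℝ → W × W} {f' : W × W} {t : ℝ} (h : HasDerivAt f f' t) :
    HasDerivAt (fun r => nullMinus (f r)) (nullMinus f') t :=
  (hasDerivAt_fst h).sub (hasDerivAt_snd h)

/-- Differentiating at time zero an equation `⟨v, w⟩ = k` valid for small times. -/
theorem form_deriv_add {v w : ℝ → W} {v' w' : W} (hv : HasDerivAt v v' 0) (hw : HasDerivAt w w' 0)
    {k : ℝ} (hk : ∀ᶠ t in 𝓝 (0 : ℝ), form (v t) (w t) = k) :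
    form v' (w 0) + form (v 0) w' = 0 :=
  (hv.form hw).unique ((hasDerivAt_const (0 : ℝ) k).congr_of_eventuallyEq hk)

section Manifold

variable {M : Type*} [TopologicalSpace M] [ChartedSpace (EuclideanHalfSpace 3) M]

/-- The coefficients of the differentials of the coordinates of `x - n` in the primitive
`det (a, b, a', db) / 8 + det (a, b, a', da) / 16 - det (a, b, b', db) / 16`, where `a = x + n` and
`b = x - n`, and `a'`, `b'` are their time derivatives. -/
noncomputable def primitiveMinus (φ : ℝ → M → W × W) (k : Fin 4) (p : M) : ℝ :=
  det4 (nullPlus (φ 0 p)) (nullMinus (φ 0 p))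
    ((1 / 8 : ℝ) • nullPlus (velocity φ p) - (1 / 16 : ℝ) • nullMinus (velocity φ p))
    (Pi.single k 1)

/-- The coefficients of the differentials of the coordinates of `x + n` in the same primitive. -/
noncomputable def primitivePlus (φ : ℝ → M → W × W) (k : Fin 4) (p : M) : ℝ :=
  det4 (nullPlus (φ 0 p)) (nullMinus (φ 0 p)) ((1 / 16 : ℝ) • nullPlus (velocity φ p))
    (Pi.single k 1)

variable [IsManifold (𝓡∂ 3) ∞ M] {φ : ℝ → M → W × W}
  (hφ : ContMDiff (𝓘(ℝ, ℝ).prod (𝓡∂ 3)) 𝓘(ℝ, W × W) ∞ (fun q : ℝ × M => φ q.1 q.2))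

theorem IsCobordism.isHolonomicSurfaceOn {E : EndStructure M} {φ : M → W × W}
    (h : IsCobordism E φ) (c : M) : IsHolonomicSurfaceOn (bdryMap φ c) (bdryDomain c) where
  isOpen := isOpen_bdryDomain c
  smooth := contDiffOn_comp_bdryPoint h.smooth c
  mem_unitTangent _ _ := h.mem_unitTangent _
  holonomic := h.holonomic c
  isotropic := h.isotropic c

include hφ

theorem contMDiff_primitiveMinus (k : Fin 4) :
    ContMDiff (𝓡∂ 3) 𝓘(ℝ) ∞ (primitiveMinus φ k) := by
  refine contMDiff_of_comp hφ (g := fun q => det4 (nullPlus q.1) (nullMinus q.1)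
    ((1 / 8 : ℝ) • nullPlus q.2 - (1 / 16 : ℝ) • nullMinus q.2) (Pi.single k 1)) ?_
  refine contDiff_iff_contDiffAt.2 fun q => ContDiffWithinAt.det4 (s := univ) ?_ ?_ ?_
    contDiffAt_const
  exacts [(contDiff_nullPlus.comp contDiff_fst).contDiffAt,
    (contDiff_nullMinus.comp contDiff_fst).contDiffAt,
    (((contDiff_nullPlus.comp contDiff_snd).const_smul (1 / 8 : ℝ)).sub
      ((contDiff_nullMinus.comp contDiff_snd).const_smul (1 / 16 : ℝ))).contDiffAt]

theorem contMDiff_primitivePlus (k : Fin 4) :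
    ContMDiff (𝓡∂ 3) 𝓘(ℝ) ∞ (primitivePlus φ k) := by
  refine contMDiff_of_comp hφ (g := fun q => det4 (nullPlus q.1) (nullMinus q.1)
    ((1 / 16 : ℝ) • nullPlus q.2) (Pi.single k 1)) ?_
  refine contDiff_iff_contDiffAt.2 fun q => ContDiffWithinAt.det4 (s := univ) ?_ ?_ ?_
    contDiffAt_const
  exacts [(contDiff_nullPlus.comp contDiff_fst).contDiffAt,
    (contDiff_nullMinus.comp contDiff_fst).contDiffAt,
    ((contDiff_nullPlus.comp contDiff_snd).const_smul (1 / 16 : ℝ)).contDiffAt]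

theorem contMDiff_nullPlus (k : Fin 4) :
    ContMDiff (𝓡∂ 3) 𝓘(ℝ) ∞ (fun p => nullPlus (φ 0 p) k) :=
  contMDiff_of_comp hφ (g := fun q => nullPlus q.1 k)
    ((contDiff_apply ℝ ℝ k).comp (contDiff_nullPlus.comp contDiff_fst))

theorem contMDiff_nullMinus (k : Fin 4) :
    ContMDiff (𝓡∂ 3) 𝓘(ℝ) ∞ (fun p => nullMinus (φ 0 p) k) :=
  contMDiff_of_comp hφ (g := fun q => nullMinus q.1 k)
    ((contDiff_apply ℝ ℝ k).comp (contDiff_nullMinus.comp contDiff_fst))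

/-- On the boundary, `det (x, ẋ, dx, dx)` minus the variation of `α` plus `u F / 2` is exact. -/
theorem boundary_variation (hM : IsOrientedAtlas M) {E : EndStructure M}
    (hcob : ∀ᶠ t in 𝓝 (0 : ℝ), IsCobordism E (φ t)) {u : M → ℝ} {c : M} {s : E2}
    (hs : s ∈ bdryDomain c)
    (hu : ∀ i j : Fin 2, HasDerivAt (fun t => firstForm (bdryMap (φ t) c) s i j)
      (2 * u (bdryPoint c s) * firstForm (bdryMap (φ 0) c) s i j) 0) :
    (∑ i, ∑ j, omegaCoeff φ i j (bdryPoint c s)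
        * (bdryChartSystem hM).jac ![baseCoord (φ 0) i, baseCoord (φ 0) j] c s)
      - deriv (fun t => pullbackAlpha (φ t) c s) 0
      + 1 / 2 * (u (bdryPoint c s) * curvatureForm (bdryMap (φ 0) c) s)
    = (∑ k, (bdryChartSystem hM).jac ![primitiveMinus φ k, fun p => nullMinus (φ 0 p) k] c s)
      + ∑ k, (bdryChartSystem hM).jac ![primitivePlus φ k, fun p => nullPlus (φ 0 p) k] c s := by
  have hF := contDiffOn_family_bdry hφ c
  have hn : bdryDomain c ∈ 𝓝 s := (isOpen_bdryDomain c).mem_nhds hs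
  have h0 := hcob.self_of_nhds.isHolonomicSurfaceOn c
  -- the map and its velocity in the boundary chart, with their derivatives
  set V : E2 → W × W := fun r => velocity φ (bdryPoint c r) with hV
  set f : E2 → W × W := bdryMap (φ 0) c with hf
  have hfs : ContDiffAt ℝ ∞ f s := h0.contDiffAt hs
  have hVs : ContDiffAt ℝ ∞ V s :=
    (contDiffOn_comp_bdryPoint (contMDiff_velocity hφ) c).contDiffAt hn
  have ht : HasDerivAt (fun t => bdryMap (φ t) c s) (V s) 0 := hasDerivAt_velocity hφ _
  have hti : ∀ i, HasDerivAt (fun t => pd i (bdryMap (φ t) c) s) (pd i V s) 0 := fun i =>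
    hasDerivAt_fderiv_comm (isOpen_bdryDomain c) hF 0 hs _
  have lf := fun i => hasLineDerivAt_pd (hfs.differentiableAt (by simp)) i
  have lV := fun i => hasLineDerivAt_pd (hVs.differentiableAt (by simp)) i
  -- the variation of `α`
  have hα := (((hasDerivAt_nullPlus ht).det4 (hasDerivAt_nullMinus ht)
        (hasDerivAt_nullPlus (hti 0)) (hasDerivAt_nullPlus (hti 1))).fun_sub
      ((hasDerivAt_nullPlus ht).det4 (hasDerivAt_nullMinus ht)
        (hasDerivAt_nullMinus (hti 0)) (hasDerivAt_nullMinus (hti 1)))).const_mul (-(1 / 16))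
  rw [show (fun t => pullbackAlpha (φ t) c s) = _ from funext fun t => alpha_eq _ _ _,
    hα.deriv, h0.curvatureForm_eq hs]
  -- the first order conditions
  have hmem : ∀ᶠ t in 𝓝 (0 : ℝ), bdryMap (φ t) c s ∈ unitTangent :=
    hcob.mono fun t h => h.mem_unitTangent _
  have haa := form_deriv_add (hasDerivAt_nullPlus ht) (hasDerivAt_nullPlus ht)
    (hmem.mono fun t h => form_nullPlus_self h)
  have hbb := form_deriv_add (hasDerivAt_nullMinus ht) (hasDerivAt_nullMinus ht)
    (hmem.mono fun t h => form_nullMinus_self h)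
  have hab := form_deriv_add (hasDerivAt_nullPlus ht) (hasDerivAt_nullMinus ht)
    (hmem.mono fun t h => form_nullPlus_nullMinus h)
  have hconf : ∀ i j, form (nullPlus (pd i V s)) (nullPlus (pd j f s))
      + form (nullPlus (pd i f s)) (nullPlus (pd j V s))
      = 2 * u (bdryPoint c s) * form (nullPlus (pd i f s)) (nullPlus (pd j f s)) := by
    intro i j
    have h1 := ((hasDerivAt_nullPlus (hti i)).form (hasDerivAt_nullPlus (hti j))).const_mul (1 / 2)
    have hev : (fun t => firstForm (bdryMap (φ t) c) s i j) =ᶠ[𝓝 0] fun t => 1 / 2 *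
        form (nullPlus (pd i (bdryMap (φ t) c) s)) (nullPlus (pd j (bdryMap (φ t) c) s)) := by
      filter_upwards [hcob] with t h
      have ht := h.isHolonomicSurfaceOn c
      rw [ht.firstForm_apply hs, pd_nullPlus (ht.contDiffAt hs), pd_nullPlus (ht.contDiffAt hs)]
    have h2 := h1.unique ((hu i j).congr_of_eventuallyEq hev.symm)
    rw [h0.firstForm_apply hs, pd_nullPlus hfs, pd_nullPlus hfs] at h2
    simp only [← hf] at h2
    linarith
  have hfr := h0.isNullFrame hs
  have hΔ := h0.det4_ne_zero hs
  have hpm := h0.form_plus_pd_minus hs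
  have hmm := h0.form_minus_pd_minus hs
  have hsymm := h0.form_pd_minus_pd_plus_symm hs 0 1
  simp only [pd_nullPlus hfs, pd_nullMinus hfs] at hfr hΔ hpm hmm hsymm ⊢
  rw [form_comm (nullPlus (V s))] at haa
  rw [form_comm (nullMinus (V s))] at hbb
  have key := variation_identity hfr hΔ (hpm 0) (hpm 1) (hmm 0) (hmm 1)
    (a' := nullPlus (V s)) (b' := nullMinus (V s)) (b1' := nullMinus (pd 0 V s))
    (b2' := nullMinus (pd 1 V s)) (by linarith) (by linarith) hab hsymm (hconf 0 0) (hconf 0 1)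
    (hconf 1 1)
  -- the coordinate expressions
  have hpdx : ∀ i k, pd i (fun r => baseCoord (φ 0) k (bdryPoint c r)) s = (pd i f s).1 k :=
    fun i k => pd_eq_of_hasDerivAt
      (((contDiffOn_comp_bdryPoint (contMDiff_baseCoord hφ k) c).contDiffAt hn).differentiableAt
        (by simp)) (hasDerivAt_pi.1 (hasDerivAt_fst (lf i)) k)
  have hpda : ∀ i k, pd i (fun r => nullPlus (φ 0 (bdryPoint c r)) k) s = nullPlus (pd i f s) k :=
    fun i k => pd_eq_of_hasDerivAt
      (((contDiffOn_comp_bdryPoint (contMDiff_nullPlus hφ k) c).contDiffAt hn).differentiableAt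
        (by simp)) (hasDerivAt_pi.1 (hasDerivAt_nullPlus (lf i)) k)
  have hpdb : ∀ i k, pd i (fun r => nullMinus (φ 0 (bdryPoint c r)) k) s
      = nullMinus (pd i f s) k :=
    fun i k => pd_eq_of_hasDerivAt
      (((contDiffOn_comp_bdryPoint (contMDiff_nullMinus hφ k) c).contDiffAt hn).differentiableAt
        (by simp)) (hasDerivAt_pi.1 (hasDerivAt_nullMinus (lf i)) k)
  have hpP : ∀ i k, pd i (fun r => primitivePlus φ k (bdryPoint c r)) s =
      det4 (nullPlus (pd i f s)) (nullMinus (f s)) ((1 / 16 : ℝ) • nullPlus (V s)) (Pi.single k 1)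
      + det4 (nullPlus (f s)) (nullMinus (pd i f s)) ((1 / 16 : ℝ) • nullPlus (V s))
        (Pi.single k 1)
      + det4 (nullPlus (f s)) (nullMinus (f s)) ((1 / 16 : ℝ) • nullPlus (pd i V s))
        (Pi.single k 1) := by
    intro i k
    refine pd_eq_of_hasDerivAt
      (((contDiffOn_comp_bdryPoint (contMDiff_primitivePlus hφ k) c).contDiffAt hn).differentiableAt
        (by simp)) ?_
    have h1 := (hasDerivAt_nullPlus (lf i)).det4 (hasDerivAt_nullMinus (lf i))
      ((hasDerivAt_nullPlus (lV i)).const_smul (1 / 16 : ℝ))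
      (hasDerivAt_const (0 : ℝ) (Pi.single k (1 : ℝ) : W))
    refine h1.congr_deriv ?_
    simp only [zero_smul, add_zero, Pi.smul_apply]
    simp [det4_eq]
  have hpM : ∀ i k, pd i (fun r => primitiveMinus φ k (bdryPoint c r)) s =
      det4 (nullPlus (pd i f s)) (nullMinus (f s))
        ((1 / 8 : ℝ) • nullPlus (V s) - (1 / 16 : ℝ) • nullMinus (V s)) (Pi.single k 1)
      + det4 (nullPlus (f s)) (nullMinus (pd i f s))
        ((1 / 8 : ℝ) • nullPlus (V s) - (1 / 16 : ℝ) • nullMinus (V s)) (Pi.single k 1)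
      + det4 (nullPlus (f s)) (nullMinus (f s))
        ((1 / 8 : ℝ) • nullPlus (pd i V s) - (1 / 16 : ℝ) • nullMinus (pd i V s))
        (Pi.single k 1) := by
    intro i k
    refine pd_eq_of_hasDerivAt
      (((contDiffOn_comp_bdryPoint (contMDiff_primitiveMinus hφ k) c).contDiffAt
        hn).differentiableAt (by simp)) ?_
    have h1 := (hasDerivAt_nullPlus (lf i)).det4 (hasDerivAt_nullMinus (lf i))
      (((hasDerivAt_nullPlus (lV i)).const_smul (1 / 8 : ℝ)).sub
        ((hasDerivAt_nullMinus (lV i)).const_smul (1 / 16 : ℝ)))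
      (hasDerivAt_const (0 : ℝ) (Pi.single k (1 : ℝ) : W))
    refine h1.congr_deriv ?_
    simp only [zero_smul, add_zero, Pi.smul_apply, Pi.sub_apply]
    simp [det4_eq]
  have hT : (∑ i, ∑ j, omegaCoeff φ i j (bdryPoint c s)
      * (bdryChartSystem hM).jac ![baseCoord (φ 0) i, baseCoord (φ 0) j] c s)
      = det4 (f s).1 (V s).1 (pd 0 f s).1 (pd 1 f s).1 := by
    have e : ∀ i j, omegaCoeff φ i j (bdryPoint c s)
        * (bdryChartSystem hM).jac ![baseCoord (φ 0) i, baseCoord (φ 0) j] c s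
        = 1 / 2 * (det4 (f s).1 (V s).1 (Pi.single i 1) (Pi.single j 1)
            * ((pd 0 f s).1 i * (pd 1 f s).1 j)
          - det4 (f s).1 (V s).1 (Pi.single i 1) (Pi.single j 1)
            * ((pd 1 f s).1 i * (pd 0 f s).1 j)) := by
      intro i j
      rw [jac_bdryChartSystem hM _ _ hs, hpdx, hpdx, hpdx, hpdx]
      change 1 / 2 * det4 (f s).1 (V s).1 (Pi.single i 1) (Pi.single j 1) * _ = _
      ring
    simp only [e, ← Finset.mul_sum, Finset.sum_sub_distrib, sum_sum_det4_single]
    simp only [det4_eq]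
    ring
  rw [hT]
  simp only [jac_bdryChartSystem hM _ _ hs, hpda, hpdb, hpP, hpM, add_mul,
    Finset.sum_sub_distrib, Finset.sum_add_distrib, sum_det4_single]
  have hfx : (f s).1 = (1 / 2 : ℝ) • (nullPlus (f s) + nullMinus (f s)) := by
    simp only [nullPlus, nullMinus]; module
  have hVx : (V s).1 = (1 / 2 : ℝ) • (nullPlus (V s) + nullMinus (V s)) := by
    simp only [nullPlus, nullMinus]; module
  have hpx : ∀ i, (pd i f s).1 = (1 / 2 : ℝ) • (nullPlus (pd i f s) + nullMinus (pd i f s)) := by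
    intro i; simp only [nullPlus, nullMinus]; module
  rw [hfx, hVx, hpx, hpx]
  have hsub : ∀ (v w z d y : W) (p q : ℝ), det4 v w (p • z - q • y) d
      = p * det4 v w z d - q * det4 v w y d := by
    intro v w z d y p q
    simp only [det4_eq, Pi.sub_apply, Pi.smul_apply, smul_eq_mul]
    ring
  have hsmul : ∀ (v w z d : W) (p : ℝ), det4 v w (p • z) d = p * det4 v w z d := by
    intro v w z d p
    simp only [det4_eq, Pi.smul_apply, smul_eq_mul]
    ring
  have hhalf : ∀ v w z d : W, det4 ((1 / 2 : ℝ) • v) ((1 / 2 : ℝ) • w) ((1 / 2 : ℝ) • z)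
      ((1 / 2 : ℝ) • d) = 1 / 16 * det4 v w z d := by
    intro v w z d
    simp only [det4_eq, Pi.smul_apply, smul_eq_mul]
    ring
  rw [hhalf]
  simp only [hsub, hsmul, ← hf]
  linear_combination (1 / 16) * key

omit hφ [IsManifold (𝓡∂ 3) ∞ M] in
theorem velocity_eq_zero {E : EndStructure M}
    (hinf : ∀ᶠ t in 𝓝 (0 : ℝ), ∀ p ∉ E.K, φ t p = φ 0 p) {p : M} (hp : p ∉ E.K) :
    velocity φ p = 0 := by
  have : (fun t => φ t p) =ᶠ[𝓝 0] fun _ => φ 0 p := hinf.mono fun t h => h p hp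
  rw [velocity, this.deriv_eq, deriv_const]

omit hφ [IsManifold (𝓡∂ 3) ∞ M] in
theorem deriv_pullbackAlpha_eq_zero [T2Space M] {E : EndStructure M}
    (hinf : ∀ᶠ t in 𝓝 (0 : ℝ), ∀ p ∉ E.K, φ t p = φ 0 p) {c : M} {s : E2}
    (hs : s ∈ bdryDomain c) (hp : bdryPoint c s ∉ E.K)
    (hc : ContinuousOn (bdryPoint c) (bdryDomain c)) :
    deriv (fun t => pullbackAlpha (φ t) c s) 0 = 0 := by
  have hn : ∀ᶠ r in 𝓝 s, bdryPoint c r ∉ E.K :=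
    (hc.continuousAt ((isOpen_bdryDomain c).mem_nhds hs)).eventually
      (E.isCompact_K.isClosed.isOpen_compl.mem_nhds hp)
  have : (fun t => pullbackAlpha (φ t) c s) =ᶠ[𝓝 0] fun _ => pullbackAlpha (φ 0) c s := by
    filter_upwards [hinf] with t ht
    have hev : bdryMap (φ t) c =ᶠ[𝓝 s] bdryMap (φ 0) c := hn.mono fun r hr => ht _ hr
    simp only [pullbackAlpha, pd_congr hev, hev.self_of_nhds]
  rw [this.deriv_eq, deriv_const]

omit hφ in
theorem isContFormOn_jac_bdry (hM : IsOrientedAtlas M) {A B : M → ℝ} {k : Set M}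
    (hk : IsClosed k) (hA : ContMDiff (𝓡∂ 3) 𝓘(ℝ) ∞ A) (hB : ContMDiff (𝓡∂ 3) 𝓘(ℝ) ∞ B)
    (hA0 : ∀ p ∉ k, A p = 0) :
    (bdryChartSystem hM).IsContFormOn k ((bdryChartSystem hM).jac ![A, B]) where
  continuousOn := ChartSystem.continuousOn_jac fun i => by
    fin_cases i
    exacts [isSmooth_bdryChartSystem hM hA, isSmooth_bdryChartSystem hM hB]
  eq_zero _ _ hs hp := ChartSystem.jac_eq_zero hk (i := 0) hA0 hs hp

omit hφ in
theorem isContFormOn_jac (hM : IsOrientedAtlas M) {A B C : M → ℝ} {k : Set M}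
    (hk : IsClosed k) (hA : ContMDiff (𝓡∂ 3) 𝓘(ℝ) ∞ A) (hB : ContMDiff (𝓡∂ 3) 𝓘(ℝ) ∞ B)
    (hC : ContMDiff (𝓡∂ 3) 𝓘(ℝ) ∞ C) (hA0 : ∀ p ∉ k, A p = 0) :
    (chartSystem hM).IsContFormOn k ((chartSystem hM).jac ![A, B, C]) where
  continuousOn := ChartSystem.continuousOn_jac fun i => by
    fin_cases i
    exacts [isSmooth_chartSystem hM hA, isSmooth_chartSystem hM hB, isSmooth_chartSystem hM hC]
  eq_zero _ _ hy hp := ChartSystem.jac_eq_zero hk (i := 0) hA0 hy hp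

variable [T2Space M] [SigmaCompactSpace M]

/-- The variation of the integral of `φ^* ω` over the compact part is, by Stokes' theorem, the
integral of `det (x, ẋ, dx, dx)` over the boundary. -/
theorem integral_deriv_pullbackOmega (hM : IsOrientedAtlas M) {E : EndStructure M}
    (hcob : ∀ᶠ t in 𝓝 (0 : ℝ), IsCobordism E (φ t))
    (hinf : ∀ᶠ t in 𝓝 (0 : ℝ), ∀ p ∉ E.K, φ t p = φ 0 p) :
    (chartSystem hM).integral (pou M).toPartitionOfUnity E.K
      (fun c y => deriv (fun t => pullbackOmega (φ t) c y) 0)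
    = bdryIntegral univ fun c s => ∑ i, ∑ j, omegaCoeff φ i j (bdryPoint c s)
        * (bdryChartSystem hM).jac ![baseCoord (φ 0) i, baseCoord (φ 0) j] c s := by
  have hK := E.isCompact_K
  have hA0 : ∀ i j, ∀ p ∉ E.K, omegaCoeff φ i j p = 0 := fun i j p hp => by
    simp [omegaCoeff, velocity_eq_zero hinf hp, det4_eq]
  have hA := contMDiff_omegaCoeff hφ
  have hB := contMDiff_baseCoord hφ
  rw [← ChartSystem.integral_univ_eq]
  · rw [ChartSystem.integral_congr_ae (η' := fun c y => ∑ q : Fin 4 × Fin 4, (chartSystem hM).jac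
      ![omegaCoeff φ q.1 q.2, baseCoord (φ 0) q.1, baseCoord (φ 0) q.2] c y),
      ChartSystem.integral_finset_sum isSubordinate_pou _ hK fun q _ =>
        isContFormOn_jac hM hK.isClosed (hA q.1 q.2) (hB q.1) (hB q.2) (hA0 q.1 q.2)]
    · simp only [← mfdIntegral_eq hM]
      rw [Finset.sum_congr rfl fun q _ => mfdIntegral_jac hM (hA q.1 q.2) (hB q.1) (hB q.2)
        (HasCompactSupport.intro hK (hA0 q.1 q.2))]
      simp only [bdryIntegral_eq hM, Finset.sum_neg_distrib]
      rw [← ChartSystem.integral_finset_sum isSubordinate_pou _ hK fun q _ =>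
        isContFormOn_mul_jac hM (hA q.1 q.2) (hB q.1) (hB q.2) (hA0 q.1 q.2)]
      simp only [Fintype.sum_prod_type]
    · intro c
      filter_upwards [ae_pos] with y h0 hy
      rw [deriv_pullbackOmega hφ hM (hcob.mono fun t h => h.mem_unitTangent) hy
        (pos_of_mem_target hy h0), Fintype.sum_prod_type]
  · intro c
    filter_upwards [ae_pos] with y h0 hy hp
    have : (fun t => pullbackOmega (φ t) c y) =ᶠ[𝓝 0] fun _ => 0 :=
      hcob.mono fun t h => h.pullbackOmega_eq_zero hy (pos_of_mem_target hy h0) hp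
    rw [this.deriv_eq, deriv_const]

/-- The boundary integrals in the variation of the `W`-volume: the exact part of the pointwise
formula does not contribute. -/
theorem bdryIntegral_variation (hM : IsOrientedAtlas M) {E : EndStructure M}
    (hcob : ∀ᶠ t in 𝓝 (0 : ℝ), IsCobordism E (φ t))
    (hinf : ∀ᶠ t in 𝓝 (0 : ℝ), ∀ p ∉ E.K, φ t p = φ 0 p) {u : M → ℝ}
    (hu : ∀ c : M, ∀ s ∈ bdryDomain c, ∀ i j : Fin 2,
      HasDerivAt (fun t => firstForm (bdryMap (φ t) c) s i j)
        (2 * u (bdryPoint c s) * firstForm (bdryMap (φ 0) c) s i j) 0) :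
    (bdryIntegral univ fun c s => ∑ i, ∑ j, omegaCoeff φ i j (bdryPoint c s)
        * (bdryChartSystem hM).jac ![baseCoord (φ 0) i, baseCoord (φ 0) j] c s)
      - bdryIntegral E.K (fun c s => deriv (fun t => pullbackAlpha (φ t) c s) 0)
    = -(1 / 2) * bdryIntegral univ
      (fun c s => u (bdryPoint c s) * curvatureForm (bdryMap (φ 0) c) s) := by
  have hK := E.isCompact_K
  have hsub := isSubordinate_pou (M := M)
  set S := bdryChartSystem hM with hS
  set T : M → E2 → ℝ := fun c s => ∑ q : Fin 4 × Fin 4, omegaCoeff φ q.1 q.2 (bdryPoint c s)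
    * S.jac ![baseCoord (φ 0) q.1, baseCoord (φ 0) q.2] c s with hT
  set D : M → E2 → ℝ := fun c s => deriv (fun t => pullbackAlpha (φ t) c s) 0 with hD
  set P : Fin 4 → M → E2 → ℝ := fun k =>
    S.jac ![primitiveMinus φ k, fun p => nullMinus (φ 0 p) k] with hP
  set Q : Fin 4 → M → E2 → ℝ := fun k =>
    S.jac ![primitivePlus φ k, fun p => nullPlus (φ 0 p) k] with hQ
  have hP0 : ∀ k, ∀ p ∉ E.K, primitiveMinus φ k p = 0 := fun k p hp => by
    simp [primitiveMinus, velocity_eq_zero hinf hp, det4_eq, nullPlus, nullMinus]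
  have hQ0 : ∀ k, ∀ p ∉ E.K, primitivePlus φ k p = 0 := fun k p hp => by
    simp [primitivePlus, velocity_eq_zero hinf hp, det4_eq, nullPlus]
  have hA0 : ∀ i j, ∀ p ∉ E.K, omegaCoeff φ i j p = 0 := fun i j p hp => by
    simp [omegaCoeff, velocity_eq_zero hinf hp, det4_eq]
  have cT : ∀ q : Fin 4 × Fin 4, S.IsContFormOn E.K (fun c s =>
      omegaCoeff φ q.1 q.2 (bdryPoint c s)
        * S.jac ![baseCoord (φ 0) q.1, baseCoord (φ 0) q.2] c s) := fun q =>
    isContFormOn_mul_jac hM (contMDiff_omegaCoeff hφ q.1 q.2) (contMDiff_baseCoord hφ q.1)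
      (contMDiff_baseCoord hφ q.2) (hA0 q.1 q.2)
  have cT' : S.IsContFormOn E.K T := ChartSystem.IsContFormOn.sum fun q _ => cT q
  have cD : S.IsContFormOn E.K D :=
    { continuousOn := fun c => (contDiffOn_deriv_slice (isOpen_bdryDomain c).uniqueDiffOn
        (contDiffOn_pullbackAlpha hφ c) 0).continuousOn
      eq_zero := fun c s hs hp => deriv_pullbackAlpha_eq_zero hinf hs hp (S.continuousOn_pt c) }
  have cP : ∀ k, S.IsContFormOn E.K (P k) := fun k => isContFormOn_jac_bdry hM hK.isClosed
    (contMDiff_primitiveMinus hφ k) (contMDiff_nullMinus hφ k) (hP0 k)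
  have cQ : ∀ k, S.IsContFormOn E.K (Q k) := fun k => isContFormOn_jac_bdry hM hK.isClosed
    (contMDiff_primitivePlus hφ k) (contMDiff_nullPlus hφ k) (hQ0 k)
  have iP : S.integral (pou M).toPartitionOfUnity univ (fun c s => ∑ k, P k c s) = 0 := by
    rw [ChartSystem.integral_finset_sum hsub _ hK fun k _ => cP k]
    refine Finset.sum_eq_zero fun k _ => ?_
    have := bdryIntegral_jac hM (contMDiff_primitiveMinus hφ k) (contMDiff_nullMinus hφ k)
      (HasCompactSupport.intro hK (hP0 k))
    rwa [bdryIntegral_eq hM, neg_eq_zero] at this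
  have iQ : S.integral (pou M).toPartitionOfUnity univ (fun c s => ∑ k, Q k c s) = 0 := by
    rw [ChartSystem.integral_finset_sum hsub _ hK fun k _ => cQ k]
    refine Finset.sum_eq_zero fun k _ => ?_
    have := bdryIntegral_jac hM (contMDiff_primitivePlus hφ k) (contMDiff_nullPlus hφ k)
      (HasCompactSupport.intro hK (hQ0 k))
    rwa [bdryIntegral_eq hM, neg_eq_zero] at this
  have eD : S.integral (pou M).toPartitionOfUnity univ D
      = S.integral (pou M).toPartitionOfUnity E.K D :=
    ChartSystem.integral_univ_eq fun c => Eventually.of_forall fun s hs hp => cD.eq_zero c s hs hp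
  have hpt : ∀ c, ∀ s ∈ S.dom c, (∑ k, P k c s) + (∑ k, Q k c s)
      = (T c s + -1 * D c s)
        + 1 / 2 * (u (bdryPoint c s) * curvatureForm (bdryMap (φ 0) c) s) := by
    intro c s hs
    have := boundary_variation hφ hM hcob hs (hu c s hs)
    simp only [hT, Fintype.sum_prod_type]
    linear_combination -this
  have cPQ : S.IsContFormOn E.K (fun c s => (∑ k, P k c s) + ∑ k, Q k c s) :=
    (ChartSystem.IsContFormOn.sum fun k _ => cP k).add
      (ChartSystem.IsContFormOn.sum fun k _ => cQ k)
  have key : 1 / 2 * S.integral (pou M).toPartitionOfUnity univ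
      (fun c s => u (bdryPoint c s) * curvatureForm (bdryMap (φ 0) c) s)
      = - S.integral (pou M).toPartitionOfUnity univ T
        + S.integral (pou M).toPartitionOfUnity univ D := by
    rw [← ChartSystem.integral_const_mul, ChartSystem.integral_congr (η' := fun c s =>
      ((∑ k, P k c s) + ∑ k, Q k c s) + (-1 * T c s + D c s))
      (fun c s hs => by linear_combination -hpt c s hs),
      ChartSystem.integral_add hsub hK cPQ ((cT'.const_mul (-1)).add cD),
      ChartSystem.integral_add hsub hK (ChartSystem.IsContFormOn.sum fun k _ => cP k)
        (ChartSystem.IsContFormOn.sum fun k _ => cQ k),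
      ChartSystem.integral_add hsub hK (cT'.const_mul (-1)) cD,
      ChartSystem.integral_const_mul, iP, iQ]
    ring
  have eT : (fun c s => ∑ i, ∑ j, omegaCoeff φ i j (bdryPoint c s)
      * S.jac ![baseCoord (φ 0) i, baseCoord (φ 0) j] c s) = T := by
    funext c s
    simp only [hT, Fintype.sum_prod_type]
  rw [eT]
  simp only [bdryIntegral_eq hM, ← hS, ← eD]
  linear_combination -key

end Manifold
end AdS

theorem mainTheorem2 {M : Type*} [TopologicalSpace M] [ChartedSpace (EuclideanHalfSpace 3) M]
    [IsManifold (𝓡∂ 3) ∞ M] [T2Space M] [SigmaCompactSpace M]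
    (hM : IsOrientedAtlas M)
    (E : EndStructure M) (φ : ℝ → M → W × W)
    (hφ : ContMDiff (𝓘(ℝ, ℝ).prod (𝓡∂ 3)) 𝓘(ℝ, W × W) ∞ (fun q : ℝ × M => φ q.1 q.2))
    (hcob : ∀ᶠ t in 𝓝 (0 : ℝ), IsCobordism E (φ t))
    (hinf : ∀ᶠ t in 𝓝 (0 : ℝ), ∀ p ∉ E.K, φ t p = φ 0 p)
    (u : M → ℝ)
    (hu : ∀ c : M, ∀ s ∈ bdryDomain c, ∀ i j : Fin 2,
      HasDerivAt (fun t => firstForm (bdryMap (φ t) c) s i j)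
        (2 * u (bdryPoint c s) * firstForm (bdryMap (φ 0) c) s i j) 0) :
    HasDerivAt (fun t => WVolume E (φ t))
      (-(1 / 2) * bdryIntegral univ
        (fun c s => u (bdryPoint c s) * curvatureForm (bdryMap (φ 0) c) s)) 0 := by
  have hK := E.isCompact_K
  have h1 := ChartSystem.hasDerivAt_integral (S := chartSystem hM) isSubordinate_pou hK
    (η := fun t => pullbackOmega (φ t)) (contDiffOn_pullbackOmega hφ)
  have h2 := (ChartSystem.hasDerivAt_integral (S := bdryChartSystem hM) isSubordinate_pou hK
    (η := fun t => pullbackAlpha (φ t)) (contDiffOn_pullbackAlpha hφ)).neg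
  rw [integral_deriv_pullbackOmega hφ hM hcob hinf] at h1
  rw [← bdryIntegral_variation hφ hM hcob hinf hu]
  refine (h1.sub h2).congr_of_eventuallyEq ?_
  -- the form `φ^* ω` vanishes at infinity, so that its integral is an integral over `K`
  filter_upwards [hcob] with t ht
  rw [WVolume, mfdIntegral_eq hM, ChartSystem.integral_univ_eq (k := E.K)]
  · rfl
  · intro c
    filter_upwards [ae_pos] with y h0 hy hp
    exact ht.pullbackOmega_eq_zero hy (pos_of_mem_target hy h0) hp
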